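/- Let $\mathfrak H$ be a separable complex Hilbert space with inner product $\langle\cdot,\cdot\rangle$ (linear in the first variable) and orthonormal basis $\{e_k\}$, and let $Z=\{Z(h):h\in\mathfrak H\}$ be a complex isonormal Gaussian process on a probability space: a centred, jointly Gaussian complex family with $\mathbb E[Z(h)^2]=0$ and $\mathbb E[Z(g)\overline{Z(h)}]=\langle g,h\rangle$. Tensors in $\mathfrak H^{\otimes m}\otimes\mathfrak H^{\otimes n}$ are written as $f=\sum f(p;q)\,e_{p_1}\otimes\dots\otimes e_{p_m}\otimes\bar e_{q_1}\otimes\dots\otimes\bar e_{q_n}$ with square summable coefficients, and $f\in\mathfrak H^{\odot m}\otimes\mathfrak H^{\odot n}$ if $f(p;q)$ is symmetric in $p$ and symmetric in $q$. Let $I_{m,n}:\mathfrak H^{\otimes m}\otimes\mathfrak H^{\otimes n}\to L^2(\Omega)$ be the complex multiple Wiener–Itô integral, i.e. the continuous linear map with $$I_{m,n}(e_{p_1}\otimes\dots\otimes\bar e_{q_n})=\prod_k J_{m_k,n_k}(Z(e_k),1),$$ where $m_k,n_k$ are the numbers of occurrences of $k$ in $p$ and in $q$, and $J_{a,b}(z,\rho)=\sum_{r=0}^{a\wedge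 b}(-1)^r r!\binom ar\binom br z^{a-r}\bar z^{b-r}\rho^r$. For $f$ of order $(a,b)$, $g$ of order $(c,d)$, $i\le a\wedge d$ and $j\le b\wedge c$, the contraction $f\otimes_{i,j}g$, of order $(a+c-i-j,\,b+d-i-j)$, has coefficients $$(f\otimes_{i,j}g)(p,p';q,q')=\sum_{u,v}f(p,u;q,v)\,g(p',v;q',u),$$ where $p,q,p',q'$ have lengths $a-i,\ b-j,\ c-j,\ d-i$ and $u,v$ run over multi-indices of lengths $i,j$; and $f\tilde\otimes_{i,j}g$ is its symmetrization, over the variables of the first kind and over those of the second kind separately. **Proposition.** Let $m,n\ge 0$, $m+n\ge1$, $f\in\mathfrak H^{\odot m}\otimes\mathfrak H^{\odot n}$, $F=I_{m,n}(f)$, let $h(q;p)=\overline{f(p;q)}$ be the reversed complex conjugate of $f$, and put $l=m+n$, $l'=2(m\wedge n)$ and $L=\min(l',\,l-1)$. Then the series defining $F$ converges unconditionally in $L^2(\Omega)$, $\overline F=I_{n,m}(h)$ almost surely, $\mathbb E|F|^4<\infty$, and \begin{align*} &\mathbb E[|F|^4]-2\big(\mathbb E[|F|^2]\big)^2-\big|\mathbb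 E[F^2]\big|^2\\ &=\sum_{\substack{0\le i,j\le m\wedge n\\ 0<i+j<l}}\binom mi\binom ni\binom nj\binom mj(m!\,n!)^2\,\|f\otimes_{i,j}f\|^2+\sum_{r=1}^{l-1}\big((l-r)!\big)^2\|\psi_r\|^2\\ &=\sum_{\substack{0\le i\le m,\ 0\le j\le n\\ 0<i+j<l}}\binom mi^2\binom nj^2(m!\,n!)^2\,\|f\otimes_{i,j}h\|^2+\sum_{r=1}^{L}(2m-r)!\,(2n-r)!\,\|\varphi_r\|^2 , \end{align*} and, if $m\ge1$, this quantity also equals $$2\sum_{r=1}^{l-1}\big((l-r)!\big)^2\langle\vartheta_r,\psi_r\rangle+\sum_{r=1}^{L}(2m-r)!\,(2n-r)!\,\langle\varsigma_r,\varphi_r\rangle .$$ All norms and inner products are those of $\mathfrak H^{\otimes(2l-2i-2j)}$, respectively $\mathfrak H^{\otimes(2l-2r)}$, and \begin{align*} \vartheta_r&=\sum_{i+j=r}\frac im\binom mi^2\binom nj^2 i!\,j!\,f\tilde\otimes_{i,j}h, & \psi_r&=\sum_{i+j=r}\binom mi^2\binom nj^2 i!\,j!\,f\tilde\otimes_{i,j}h,\\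 \varsigma_r&=\sum_{i+j=r}\frac im\binom mi\binom ni\binom mj\binom nj i!\,j!\,f\tilde\otimes_{i,j}f, & \varphi_r&=\sum_{i+j=r}\binom mi\binom ni\binom nj\binom mj i!\,j!\,f\tilde\otimes_{i,j}f , \end{align*} where terms with a vanishing binomial coefficient are omitted. -/

import Mathlib

open MeasureTheory ProbabilityTheory Finset
open scoped ComplexConjugate ENNReal

noncomputable section

namespace ComplexChaos

/-! ### Complex isonormal Gaussian processes -/

/-- `Z` is a complex isonormal Gaussian process over `H`: a centred jointly Gaussian family of
complex random variables with `E[Z(h)²] = 0` and `E[Z(g) conj Z(h)] = ⟨g, h⟩`.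
Mathlib's `inner ℂ h g` is linear in `g`. -/
structure IsComplexIsonormal {Ω H : Type*} [MeasurableSpace Ω] [NormedAddCommGroup H]
    [InnerProductSpace ℂ H] (Z : H → Ω → ℂ) (P : Measure Ω) : Prop where
  isGaussianProcess : IsGaussianProcess Z P
  centered : ∀ h, ∫ ω, Z h ω ∂P = 0
  symmetric : ∀ h, ∫ ω, Z h ω ^ 2 ∂P = 0
  covariance : ∀ g h, ∫ ω, Z g ω * conj (Z h ω) ∂P = inner ℂ h g

/-! ### Complex Hermite polynomials -/

/-- The complex Hermite polynomial `J_{m,n}(z, ρ)`. -/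
def hermite (m n : ℕ) (z ρ : ℂ) : ℂ :=
  ∑ r ∈ range (min m n + 1),
    (-1) ^ r * (r.factorial : ℂ) * (m.choose r : ℂ) * (n.choose r : ℂ)
      * z ^ (m - r) * conj z ^ (n - r) * ρ ^ r

/-! ### Kernels -/

/-- The Hilbert tensor product `H^{⊗m} ⊗ H^{⊗n}`, in the coordinates of an orthonormal basis
`(e_k)_{k : ι}` of `H`: the square summable arrays `a` of coefficients, where `a (p, q)` is the
coefficient of `e_{p 0} ⊗ ⋯ ⊗ e_{p (m-1)} ⊗ ē_{q 0} ⊗ ⋯ ⊗ ē_{q (n-1)}`. -/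
abbrev ChaosKernel (ι : Type*) (m n : ℕ) : Type _ :=
  lp (fun _ : (Fin m → ι) × (Fin n → ι) => ℂ) 2

lemma memlp_iff {X : Type*} {F : X → ℂ} :
    Memℓp F 2 ↔ Summable fun x => ‖F x‖ ^ 2 := by
  rw [memℓp_gen_iff (by norm_num)]
  simp

lemma memlp_comp {X Y : Type*} {F : X → ℂ} (hF : Memℓp F 2) {φ : Y → X}
    (hφ : Function.Injective φ) : Memℓp (fun y => F (φ y)) 2 := by
  rw [memlp_iff] at hF ⊢
  exact hF.comp_injective hφ

/-- A pairing of two square summable arrays over common indices is square summable. -/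
lemma memlp_contract {X Y W : Type*} {F : X × W → ℂ} {G : Y × W → ℂ} (hF : Memℓp F 2)
    (hG : Memℓp G 2) : Memℓp (fun z : X × Y => ∑' w, F (z.1, w) * G (z.2, w)) 2 := by
  rw [memlp_iff] at hF hG ⊢
  have hF1 : ∀ x, Summable fun w => ‖F (x, w)‖ ^ 2 := fun x => hF.prod_factor x
  have hG1 : ∀ y, Summable fun w => ‖G (y, w)‖ ^ 2 := fun y => hG.prod_factor y
  have key : Summable fun z : X × Y => (∑' w, ‖F (z.1, w)‖ ^ 2) * ∑' w, ‖G (z.2, w)‖ ^ 2 :=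
    Summable.mul_of_nonneg hF.prod hG.prod (fun x => tsum_nonneg fun w => by positivity)
      (fun y => tsum_nonneg fun w => by positivity)
  refine Summable.of_nonneg_of_le (fun z => by positivity) (fun z => ?_) key
  have h1 := Real.summable_mul_of_Lp_Lq_of_nonneg (p := 2) (q := 2)
    (f := fun w => ‖F (z.1, w)‖) (g := fun w => ‖G (z.2, w)‖) (by constructor <;> norm_num)
    (fun w => norm_nonneg _) (fun w => norm_nonneg _) (by simpa using hF1 z.1)
    (by simpa using hG1 z.2)
  have h2 := Real.inner_le_Lp_mul_Lq_tsum_of_nonneg (p := 2) (q := 2)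
    (f := fun w => ‖F (z.1, w)‖) (g := fun w => ‖G (z.2, w)‖) (by constructor <;> norm_num)
    (fun w => norm_nonneg _) (fun w => norm_nonneg _) (by simpa using hF1 z.1)
    (by simpa using hG1 z.2)
  have h3 : ‖∑' w, F (z.1, w) * G (z.2, w)‖ ≤ ∑' w, ‖F (z.1, w)‖ * ‖G (z.2, w)‖ := by
    have : Summable fun w => ‖F (z.1, w) * G (z.2, w)‖ := by simpa using h1
    simpa using norm_tsum_le_tsum_norm this
  have h4 := h3.trans h2
  calc _ ≤ _ := pow_le_pow_left₀ (norm_nonneg _) h4 2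
    _ = _ := by
      have hA : 0 ≤ ∑' w, ‖F (z.1, w)‖ ^ 2 := tsum_nonneg fun w => by positivity
      have hB : 0 ≤ ∑' w, ‖G (z.2, w)‖ ^ 2 := tsum_nonneg fun w => by positivity
      simp only [Real.rpow_two, ← Real.sqrt_eq_rpow]
      rw [mul_pow, Real.sq_sqrt hA, Real.sq_sqrt hB]

lemma memlp_conj_swap {X Y : Type*} {F : X × Y → ℂ} (hF : Memℓp F 2) :
    Memℓp (fun z : Y × X => conj (F (z.2, z.1))) 2 := by
  have h := memlp_comp hF (φ := fun z : Y × X => (z.2, z.1)) Prod.swap_injective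
  rw [memlp_iff] at h ⊢
  simpa using h

variable {ι : Type*}

/-- `f` lies in `H^{⊙m} ⊗ H^{⊙n}`. -/
def IsSymmetric {m n : ℕ} (f : ChaosKernel ι m n) : Prop :=
  ∀ (σ : Equiv.Perm (Fin m)) (τ : Equiv.Perm (Fin n)) (p : Fin m → ι) (q : Fin n → ι),
    f (p ∘ σ, q ∘ τ) = f (p, q)

lemma permute_injective {m n : ℕ} (σ : Equiv.Perm (Fin m)) (τ : Equiv.Perm (Fin n)) :
    Function.Injective fun x : (Fin m → ι) × (Fin n → ι) => (x.1 ∘ σ, x.2 ∘ τ) := by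
  intro x y h
  have h' := Prod.ext_iff.1 h
  exact Prod.ext (σ.surjective.injective_comp_right h'.1) (τ.surjective.injective_comp_right h'.2)

/-- Permutation of the first `m` and of the last `n` variables of a kernel. -/
def permute {m n : ℕ} (σ : Equiv.Perm (Fin m)) (τ : Equiv.Perm (Fin n)) (f : ChaosKernel ι m n) :
    ChaosKernel ι m n :=
  ⟨fun x => f (x.1 ∘ σ, x.2 ∘ τ), memlp_comp (lp.memℓp f) (permute_injective σ τ)⟩

/-- The symmetrization in the sense of Itô: over the first `m` variables and over the last `n`
variables separately. -/
def symmetrize {m n : ℕ} (f : ChaosKernel ι m n) : ChaosKernel ι m n :=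
  ((m.factorial * n.factorial : ℕ) : ℂ)⁻¹ •
    ∑ σ : Equiv.Perm (Fin m), ∑ τ : Equiv.Perm (Fin n), permute σ τ f

/-- The reversed complex conjugate `h(t, s) = conj (f(s, t))` of `f`. -/
def revConj {m n : ℕ} (f : ChaosKernel ι m n) : ChaosKernel ι n m :=
  ⟨fun x => conj (f (x.2, x.1)), memlp_conj_swap (lp.memℓp f)⟩

/-- The variables `(p, u)`, with `p` of length `a - i` and `u` of length `i`. -/
def join {a i : ℕ} (h : i ≤ a) (p : Fin (a - i) → ι) (u : Fin i → ι) : Fin a → ι :=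
  Fin.append p u ∘ Fin.cast (Nat.sub_add_cancel h).symm

lemma join_injective {a i : ℕ} (h : i ≤ a) {p p' : Fin (a - i) → ι} {u u' : Fin i → ι}
    (hj : join h p u = join h p' u') : p = p' ∧ u = u' := by
  have h1 : Fin.append p u = Fin.append p' u' :=
    (finCongr (Nat.sub_add_cancel h).symm).surjective.injective_comp_right hj
  constructor
  · funext k
    simpa using congrFun h1 (Fin.castAdd i k)
  · funext k
    simpa using congrFun h1 (Fin.natAdd (a - i) k)

lemma memlp_contraction {a b c d i j : ℕ} (f : ChaosKernel ι a b) (g : ChaosKernel ι c d)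
    (ha : i ≤ a) (hb : j ≤ b) (hc : j ≤ c) (hd : i ≤ d) :
    Memℓp (fun x : (Fin ((a - i) + (c - j)) → ι) × (Fin ((b - j) + (d - i)) → ι) =>
      ∑' w : (Fin i → ι) × (Fin j → ι),
        f (join ha (x.1 ∘ Fin.castAdd _) w.1, join hb (x.2 ∘ Fin.castAdd _) w.2)
          * g (join hc (x.1 ∘ Fin.natAdd _) w.2, join hd (x.2 ∘ Fin.natAdd _) w.1)) 2 := by
  have hF : Memℓp (fun y : ((Fin (a - i) → ι) × (Fin (b - j) → ι)) ×
      ((Fin i → ι) × (Fin j → ι)) => f (join ha y.1.1 y.2.1, join hb y.1.2 y.2.2)) 2 := by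
    refine memlp_comp (φ := fun y : ((Fin (a - i) → ι) × (Fin (b - j) → ι)) ×
      ((Fin i → ι) × (Fin j → ι)) => (join ha y.1.1 y.2.1, join hb y.1.2 y.2.2))
      (lp.memℓp f) ?_
    rintro ⟨⟨p, q⟩, u, v⟩ ⟨⟨p', q'⟩, u', v'⟩ h
    obtain ⟨h1, h2⟩ := Prod.ext_iff.1 h
    obtain ⟨rfl, rfl⟩ := join_injective ha h1
    obtain ⟨rfl, rfl⟩ := join_injective hb h2
    rfl
  have hG : Memℓp (fun y : ((Fin (c - j) → ι) × (Fin (d - i) → ι)) ×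
      ((Fin i → ι) × (Fin j → ι)) => g (join hc y.1.1 y.2.2, join hd y.1.2 y.2.1)) 2 := by
    refine memlp_comp (φ := fun y : ((Fin (c - j) → ι) × (Fin (d - i) → ι)) ×
      ((Fin i → ι) × (Fin j → ι)) => (join hc y.1.1 y.2.2, join hd y.1.2 y.2.1))
      (lp.memℓp g) ?_
    rintro ⟨⟨p, q⟩, u, v⟩ ⟨⟨p', q'⟩, u', v'⟩ h
    obtain ⟨h1, h2⟩ := Prod.ext_iff.1 h
    obtain ⟨rfl, rfl⟩ := join_injective hc h1
    obtain ⟨rfl, rfl⟩ := join_injective hd h2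
    rfl
  refine memlp_comp (memlp_contract hF hG)
    (φ := fun x : (Fin ((a - i) + (c - j)) → ι) × (Fin ((b - j) + (d - i)) → ι) =>
      ((x.1 ∘ Fin.castAdd _, x.2 ∘ Fin.castAdd _), (x.1 ∘ Fin.natAdd _, x.2 ∘ Fin.natAdd _))) ?_
  rintro ⟨p, q⟩ ⟨p', q'⟩ h
  simp only [Prod.mk.injEq] at h
  obtain ⟨⟨h1, h2⟩, h3, h4⟩ := h
  refine Prod.ext (funext fun k => ?_) (funext fun k => ?_)
  · exact Fin.addCases (fun k => congrFun h1 k) (fun k => congrFun h3 k) k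
  · exact Fin.addCases (fun k => congrFun h2 k) (fun k => congrFun h4 k) k

/-- The contraction `f ⊗_{i,j} g`, with `i` variables of the first kind of `f` contracted with
variables of the second kind of `g`, and `j` variables of the second kind of `f` contracted with
variables of the first kind of `g`. It is only meaningful for `i ≤ min a d` and `j ≤ min b c`. -/
def contraction {a b c d : ℕ} (f : ChaosKernel ι a b) (g : ChaosKernel ι c d) (i j : ℕ) :
    ChaosKernel ι ((a - i) + (c - j)) ((b - j) + (d - i)) :=
  if h : (i ≤ a ∧ i ≤ d) ∧ (j ≤ b ∧ j ≤ c) then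
    ⟨_, memlp_contraction f g h.1.1 h.2.1 h.2.2 h.1.2⟩
  else 0

/-- The same kernel, seen in `H^{⊗m} ⊗ H^{⊗n}` when `a = m` and `b = n` (`0` otherwise). -/
def toOrder {a b : ℕ} (m n : ℕ) (f : ChaosKernel ι a b) : ChaosKernel ι m n :=
  if h : a = m ∧ b = n then
    ⟨fun x => f (x.1 ∘ Fin.cast h.1, x.2 ∘ Fin.cast h.2), by
      obtain ⟨rfl, rfl⟩ := h
      exact lp.memℓp f⟩
  else 0

section FourthMomentKernels

variable {m n : ℕ} (f : ChaosKernel ι m n) (r : ℕ)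

/-- `ϑ_r = ∑_{i+j=r} (i/m) C(m,i)² C(n,j)² i! j! (f ⊗̃_{i,j} h)`. -/
def vartheta : ChaosKernel ι (m + n - r) (m + n - r) :=
  ∑ x ∈ antidiagonal r,
    ((x.1 : ℂ) / m * (m.choose x.1 : ℂ) ^ 2 * (n.choose x.2 : ℂ) ^ 2
        * (x.1.factorial : ℂ) * (x.2.factorial : ℂ)) •
      toOrder _ _ (symmetrize (contraction f (revConj f) x.1 x.2))

/-- `ψ_r = ∑_{i+j=r} C(m,i)² C(n,j)² i! j! (f ⊗̃_{i,j} h)`. -/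
def psi : ChaosKernel ι (m + n - r) (m + n - r) :=
  ∑ x ∈ antidiagonal r,
    ((m.choose x.1 : ℂ) ^ 2 * (n.choose x.2 : ℂ) ^ 2
        * (x.1.factorial : ℂ) * (x.2.factorial : ℂ)) •
      toOrder _ _ (symmetrize (contraction f (revConj f) x.1 x.2))

/-- `ς_r = ∑_{i+j=r} (i/m) C(m,i) C(n,i) C(m,j) C(n,j) i! j! (f ⊗̃_{i,j} f)`. -/
def varsigma : ChaosKernel ι (2 * m - r) (2 * n - r) :=
  ∑ x ∈ antidiagonal r,
    ((x.1 : ℂ) / m * (m.choose x.1 : ℂ) * (n.choose x.1 : ℂ) * (m.choose x.2 : ℂ)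
        * (n.choose x.2 : ℂ) * (x.1.factorial : ℂ) * (x.2.factorial : ℂ)) •
      toOrder _ _ (symmetrize (contraction f f x.1 x.2))

/-- `φ_r = ∑_{i+j=r} C(m,i) C(n,i) C(m,j) C(n,j) i! j! (f ⊗̃_{i,j} f)`. -/
def varphi : ChaosKernel ι (2 * m - r) (2 * n - r) :=
  ∑ x ∈ antidiagonal r,
    ((m.choose x.1 : ℂ) * (n.choose x.1 : ℂ) * (m.choose x.2 : ℂ)
        * (n.choose x.2 : ℂ) * (x.1.factorial : ℂ) * (x.2.factorial : ℂ)) •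
      toOrder _ _ (symmetrize (contraction f f x.1 x.2))

end FourthMomentKernels

/-! ### Multiple Wiener–Itô integrals -/

section Integral

variable {Ω H : Type*} [MeasurableSpace Ω] [NormedAddCommGroup H] [InnerProductSpace ℂ H]
  {Z : H → Ω → ℂ} {P : Measure Ω}

/-- The Fourier–Hermite polynomial `∏_k J_{m_k,n_k}(Z(e_k), 1)`, where `m_k` and `n_k` are the
numbers of occurrences of `k` in `p` and in `q`. It is the multiple integral of
`e_{p 0} ⊗ ⋯ ⊗ e_{p (m-1)} ⊗ ē_{q 0} ⊗ ⋯ ⊗ ē_{q (n-1)}`. As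
`J_{a,b}(√2 z, 2) = 2 ^ ((a + b) / 2) J_{a,b}(z, 1)`, its factors are also the
`2 ^ (-(m_k + n_k) / 2) J_{m_k,n_k}(√2 Z(e_k), 2)`. -/
def fourierHermite (Z : H → Ω → ℂ) (e : ι → H) {m n : ℕ} (p : Fin m → ι) (q : Fin n → ι)
    (ω : Ω) : ℂ :=
  ∏ᶠ k : ι, hermite (Nat.card {s // p s = k}) (Nat.card {s // q s = k}) (Z (e k) ω) 1

/-- All moments are finite. -/
def AllMoments (P : Measure Ω) (X : Ω → ℂ) : Prop := ∀ p : ℝ≥0∞, p ≠ ∞ → MemLp X p P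

lemma AllMoments.mul {X Y : Ω → ℂ} (hX : AllMoments P X) (hY : AllMoments P Y) :
    AllMoments P (fun ω => X ω * Y ω) := by
  intro p hp
  have h2 : p * 2 ≠ ∞ := ENNReal.mul_ne_top hp (by norm_num)
  have : ENNReal.HolderTriple (p * 2) (p * 2) p := ⟨by
    rw [ENNReal.mul_inv (Or.inr (by norm_num)) (Or.inr (by norm_num)), ← mul_add,
      ENNReal.inv_two_add_inv_two, mul_one]⟩
  exact (hY _ h2).mul (hX _ h2)

lemma AllMoments.const [IsFiniteMeasure P] (c : ℂ) : AllMoments P (fun _ => c) :=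
  fun _ _ => memLp_const c

lemma AllMoments.pow [IsFiniteMeasure P] {X : Ω → ℂ} (hX : AllMoments P X) (k : ℕ) :
    AllMoments P (fun ω => X ω ^ k) := by
  induction k with
  | zero => simpa using AllMoments.const (1 : ℂ)
  | succ k ih => simpa [pow_succ] using ih.mul hX

lemma AllMoments.sum {κ : Type*} (s : Finset κ) {X : κ → Ω → ℂ}
    (hX : ∀ k ∈ s, AllMoments P (X k)) : AllMoments P (fun ω => ∑ k ∈ s, X k ω) :=
  fun p hp => memLp_finsetSum s fun k hk => hX k hk p hp

lemma AllMoments.prod [IsFiniteMeasure P] {κ : Type*} (s : Finset κ) {X : κ → Ω → ℂ}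
    (hX : ∀ k, AllMoments P (X k)) : AllMoments P (fun ω => ∏ k ∈ s, X k ω) := by
  classical
  induction s using Finset.induction_on with
  | empty => simpa using AllMoments.const (1 : ℂ)
  | insert a s ha ih => simpa [Finset.prod_insert ha] using (hX a).mul ih

lemma AllMoments.conj {X : Ω → ℂ} (hX : AllMoments P X) : AllMoments P (fun ω => conj (X ω)) :=
  fun p hp => (hX p hp).star

lemma AllMoments.hermite [IsFiniteMeasure P] {X : Ω → ℂ} (hX : AllMoments P X) (a b : ℕ) (ρ : ℂ) :
    AllMoments P (fun ω => hermite a b (X ω) ρ) :=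
  AllMoments.sum _ fun _ _ =>
    (((AllMoments.const _).mul (hX.pow _)).mul (hX.conj.pow _)).mul (AllMoments.const _)

lemma IsComplexIsonormal.memLp_fourierHermite (hZ : IsComplexIsonormal Z P) (e : ι → H)
    {m n : ℕ} (p : Fin m → ι) (q : Fin n → ι) : MemLp (fourierHermite Z e p q) 2 P := by
  classical
  have : IsProbabilityMeasure P := (hZ.isGaussianProcess.hasGaussianLaw ∅).isProbabilityMeasure
  have hM : ∀ h, AllMoments P (Z h) := fun h r hr =>
    (hZ.isGaussianProcess.hasGaussianLaw_eval h).memLp hr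
  have hcard : ∀ {N : ℕ} (t : Fin N → ι) (k : ι), k ∉ univ.image t →
      Nat.card {s // t s = k} = 0 := by
    intro N t k hk
    have : IsEmpty {s // t s = k} :=
      ⟨fun s => hk (mem_image.2 ⟨s.1, mem_univ _, s.2⟩)⟩
    exact Nat.card_of_isEmpty
  have heq : fourierHermite Z e p q = fun ω => ∏ k ∈ univ.image p ∪ univ.image q,
      hermite (Nat.card {s // p s = k}) (Nat.card {s // q s = k}) (Z (e k) ω) 1 := by
    funext ω
    refine finprod_eq_prod_of_mulSupport_subset _ fun k hk => ?_
    by_contra hk'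
    simp only [coe_union, Set.mem_union, mem_coe, not_or] at hk'
    refine hk ?_
    simp only [hcard p k hk'.1, hcard q k hk'.2]
    simp [ComplexChaos.hermite]
  rw [heq]
  exact AllMoments.prod _ (fun k => (hM (e k)).hermite _ _ _) 2 (by norm_num)

/-- The complex multiple Wiener–Itô integral `I_{m,n}(f)` with respect to `Z`, as an element of
`L²(Ω)`: the continuous linear extension of
`e_{p 0} ⊗ ⋯ ⊗ ē_{q (n-1)} ↦ fourierHermite Z e p q` (the sum is over all coefficients of `f` and
converges unconditionally in `L²(Ω)`). -/
def multipleIntegral (hZ : IsComplexIsonormal Z P) (e : HilbertBasis ι ℂ H) {m n : ℕ}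
    (f : ChaosKernel ι m n) : Lp ℂ 2 P :=
  ∑' x : (Fin m → ι) × (Fin n → ι), f x • (hZ.memLp_fourierHermite e x.1 x.2).toLp

end Integral

end ComplexChaos

end

open ComplexChaos

/-! Over finitely many modes the theorem is algebra in the polynomial ring generated by the letters
z_k and conj z_k. Wick ordering sends the monomial of a pair of words to its Fourier–Hermite
polynomial, so the multiple integral of a kernel is the value of `wick (kernelPoly f)` at z_k =
Z(e_k). Under the Gaussian expectation, multiplication by a letter inside the Wick sign is adjoint
to the derivative in the conjugate letter (`gaussE_wick_X_mul`). Stripping letters one at a time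
then gives two formulas, both governed by the operator `contract` = ∑ ∂_s ⊗ ∂_{s.swap}. The product
formula `wick_mul_wick` says that :A: :B: is the Wick ordering of the product of the two tensor
factors of exp(contract)(A ⊗ B). The four-factor formula `pairing_mul_mul` evaluates E[:AB: :CD:] by
first contracting A with C and B with D.

For symmetric kernels a derivative freezes a variable, so contracted polynomials are the polynomials
of contracted kernels. The product formula becomes |F|² = ∑ I(ψ_r) and F² = ∑ I(φ_r), and
orthogonality of integrals of different orders writes E|F|⁴ as a weighted sum of ‖ψ_r‖², or of
‖φ_r‖². The four-factor formula expands the r = 0 term into squared norms of contractions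
(`pairing_mul_kernelPoly`). The extreme contractions (0,0) and (m,n), together with the kernel of
order zero when there is one, account exactly for 2(E|F|²)² + |E F²|². For the third expression,
Euler's identity and integration by parts bring in ∑ ∂_k F · conj(∂_k F) and ∑ ∂_k F · ∂̄_k F; these
have the same product expansions with an additional weight i, which produces ϑ_r and ς_r
(`gaussE_fourth_eq`).

The passage to infinitely many modes rests on the ψ-expansion itself: it bounds the fourth moment by
a constant times ‖f‖⁴ (`integral_norm_finiteIntegral_fourth_le`), so the defining series converges
in L⁴ as well as in L². All kernel operations are continuous in ℓ², truncation to the words over a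
finite set of modes preserves symmetry, and each identity passes to the limit
(`cumulant_eq_of_forall_finset`). The link with probability is that the Z(e_k) are independent
standard complex Gaussian variables (`integral_evalAt`). -/

open ComplexChaos

noncomputable section

namespace ComplexChaos

open MvPolynomial
open scoped TensorProduct

/-! ### Complex Hermite polynomials over a commutative ring -/

section HermitePoly

variable {R : Type*} [CommRing R]

/-- The complex Hermite polynomial `J_{a,b}(·, 1)`, in two independent variables. -/
def hermitePoly (a b : ℕ) (x y : R) : R :=
  ∑ r ∈ range (min a b + 1),
    (-1) ^ r * (r.factorial : R) * (a.choose r : R) * (b.choose r : R) * x ^ (a - r) * y ^ (b - r)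

/-- The added terms contain a vanishing binomial coefficient, so polynomials of different orders can
be compared over one summation range. -/
lemma hermitePoly_eq_sum_range {a b N : ℕ} (h : min a b ≤ N) (x y : R) :
    hermitePoly a b x y = ∑ r ∈ range (N + 1), (-1) ^ r * (r.factorial : R) * (a.choose r : R)
      * (b.choose r : R) * x ^ (a - r) * y ^ (b - r) := by
  refine sum_subset (range_mono (by omega)) fun r _ hr => ?_
  have hr' : a < r ∨ b < r := by
    simp only [mem_range] at hr
    omega
  rcases hr' with h | h <;> simp [Nat.choose_eq_zero_of_lt h]

lemma hermitePoly_comm (a b : ℕ) (x y : R) : hermitePoly a b x y = hermitePoly b a y x := by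
  unfold hermitePoly
  rw [min_comm]
  exact sum_congr rfl fun r _ => by ring

@[simp] lemma hermitePoly_zero_zero (x y : R) : hermitePoly 0 0 x y = 1 := by
  simp [hermitePoly]

/-- Pascal's rule splits the coefficient of index r + 1, and b C(b-1, r) = (r+1) C(b, r+1)
identifies the shifted half with the polynomial of order (a, b-1). For b = 0 the factor b removes
the term with the truncated b - 1. -/
lemma hermitePoly_succ (a b : ℕ) (x y : R) :
    hermitePoly (a + 1) b x y = x * hermitePoly a b x y - b * hermitePoly a (b - 1) x y := by
  rw [hermitePoly_eq_sum_range (N := a + 1) (by omega), hermitePoly_eq_sum_range (N := a + 1)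
    (a := a) (b := b) (by omega), hermitePoly_eq_sum_range (N := a) (a := a) (b := b - 1)
    (by omega)]
  conv_lhs => rw [sum_range_succ']
  conv_rhs => rw [sum_range_succ']
  have key : ∀ r ∈ range (a + 1),
      (-1 : R) ^ (r + 1) * ((r + 1).factorial : R) * ((a + 1).choose (r + 1) : R)
        * (b.choose (r + 1) : R) * x ^ (a + 1 - (r + 1)) * y ^ (b - (r + 1)) =
      x * ((-1 : R) ^ (r + 1) * ((r + 1).factorial : R) * (a.choose (r + 1) : R)
        * (b.choose (r + 1) : R) * x ^ (a - (r + 1)) * y ^ (b - (r + 1))) -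
      b * ((-1 : R) ^ r * (r.factorial : R) * (a.choose r : R)
        * ((b - 1).choose r : R) * x ^ (a - r) * y ^ (b - 1 - r)) := by
    intro r _
    have h1 : (b : R) * ((b - 1).choose r : R) = (r + 1) * (b.choose (r + 1) : R) := by
      rcases b with _ | b
      · simp
      · have := Nat.add_one_mul_choose_eq b r
        have := congrArg (Nat.cast (R := R)) this
        push_cast at this
        rw [Nat.add_sub_cancel]
        push_cast
        linear_combination this
    have h2 : y ^ (b - 1 - r) = y ^ (b - (r + 1)) := by congr 1; omega
    have h3 : (a.choose (r + 1) : R) * (x * x ^ (a - (r + 1)))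
        = (a.choose (r + 1) : R) * x ^ (a - r) := by
      rcases lt_or_ge a (r + 1) with h | h
      · simp [Nat.choose_eq_zero_of_lt h]
      · rw [← pow_succ']; congr 2; omega
    have h4 : a + 1 - (r + 1) = a - r := by omega
    rw [h2, h4, Nat.choose_succ_succ, Nat.factorial_succ, pow_succ]
    push_cast
    linear_combination (-1) ^ r * (r.factorial : R) * (a.choose r : R) * x ^ (a - r)
      * y ^ (b - (r + 1)) * h1 + (-1) ^ r * ((r : R) + 1) * (r.factorial : R)
        * (b.choose (r + 1) : R) * y ^ (b - (r + 1)) * h3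
  rw [sum_congr rfl key, sum_sub_distrib, ← mul_sum, ← mul_sum]
  simp only [pow_zero, Nat.factorial_zero, Nat.choose_zero_right, Nat.sub_zero]
  ring

lemma map_hermitePoly {S : Type*} [CommRing S] (φ : R →+* S) (a b : ℕ) (x y : R) :
    φ (hermitePoly a b x y) = hermitePoly a b (φ x) (φ y) := by
  simp [hermitePoly]

/-- The Appell property in the second variable, from C(b, r)(b - r) = b C(b-1, r). -/
lemma derivation_hermitePoly {A : Type*} [CommRing A] [Algebra A R] (d : Derivation A R R)
    (a b : ℕ) {x y : R} (hx : d x = 0) (hy : d y = 1) :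
    d (hermitePoly a b x y) = b * hermitePoly a (b - 1) x y := by
  rw [hermitePoly_eq_sum_range (N := a) (by omega), hermitePoly_eq_sum_range (N := a)
    (b := b - 1) (by omega), map_sum, mul_sum]
  refine sum_congr rfl fun r _ => ?_
  have h0 : ∀ k : ℕ, d (k : R) = 0 := fun k => d.map_natCast k
  have hc : d ((-1) ^ r * (r.factorial : R) * (a.choose r : R) * (b.choose r : R)
      * x ^ (a - r)) = 0 := by
    simp [h0, hx, Derivation.leibniz, Derivation.leibniz_pow]
  have h1 : (b : R) * ((b - 1).choose r : R) = (b.choose r : R) * ((b - r : ℕ) : R) := by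
    rcases b with _ | b
    · simp
    · have := Nat.choose_mul_succ_eq b r
      have := congrArg (Nat.cast (R := R)) this
      simp only [Nat.add_sub_cancel]
      push_cast at this ⊢
      linear_combination this
  rw [Derivation.leibniz, hc, Derivation.leibniz_pow, hy, smul_zero, add_zero]
  simp only [smul_eq_mul, nsmul_eq_mul, mul_one]
  rw [show b - 1 - r = b - r - 1 by omega]
  linear_combination -(-1) ^ r * (r.factorial : R) * (a.choose r : R) * x ^ (a - r)
      * y ^ (b - r - 1) * h1

end HermitePoly

lemma hermite_eq_hermitePoly (a b : ℕ) (z : ℂ) : hermite a b z 1 = hermitePoly a b z (conj z) := by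
  simp [hermite, hermitePoly]

lemma conj_hermite (a b : ℕ) (z : ℂ) : conj (hermite a b z 1) = hermite b a z 1 := by
  rw [hermite_eq_hermitePoly, hermite_eq_hermitePoly, map_hermitePoly, hermitePoly_comm]
  simp

/-! ### Wick polynomials -/

section Wick

variable {ι : Type*} [Fintype ι]

/-- The Wick product `:x^α:` of a monomial, where `inl k` and `inr k` index the variables
`z_k` and `conj z_k`. -/
def wickMonomial (α : ι ⊕ ι →₀ ℕ) : MvPolynomial (ι ⊕ ι) ℂ :=
  ∏ k, hermitePoly (α (.inl k)) (α (.inr k)) (X (.inl k)) (X (.inr k))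

/-- The Wick ordering `A ↦ :A:`. -/
def wick : MvPolynomial (ι ⊕ ι) ℂ →ₗ[ℂ] MvPolynomial (ι ⊕ ι) ℂ :=
  (basisMonomials (ι ⊕ ι) ℂ).constr ℂ wickMonomial

lemma wick_monomial (α : ι ⊕ ι →₀ ℕ) (c : ℂ) :
    wick (monomial α c) = c • wickMonomial α := by
  have h : (monomial α c : MvPolynomial (ι ⊕ ι) ℂ) = c • basisMonomials (ι ⊕ ι) ℂ α := by
    simp [smul_monomial]
  rw [h, map_smul, wick, Module.Basis.constr_basis]

lemma wick_one : wick (1 : MvPolynomial (ι ⊕ ι) ℂ) = 1 := by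
  rw [← C_1, ← monomial_zero', wick_monomial]
  simp [wickMonomial]

/-- The index of the mode of a letter. -/
def mode : ι ⊕ ι → ι := Sum.elim id id

variable [DecidableEq ι]

/-- Isolates the mode of `s`. The symmetry `hermitePoly_comm` lets a letter and its conjugate be
treated alike, so later arguments need not distinguish `inl` from `inr`. -/
lemma wickMonomial_eq (α : ι ⊕ ι →₀ ℕ) (s : ι ⊕ ι) :
    wickMonomial α = hermitePoly (α s) (α s.swap) (X s) (X s.swap) *
      ∏ k ∈ univ.erase (mode s),
        hermitePoly (α (.inl k)) (α (.inr k)) (X (.inl k)) (X (.inr k)) := by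
  rw [wickMonomial, ← mul_prod_erase univ _ (mem_univ (mode s))]
  rcases s with k | k
  · rfl
  · rw [hermitePoly_comm (α (.inr k))]
    rfl

lemma prod_erase_mode_congr {α β : ι ⊕ ι →₀ ℕ} {s : ι ⊕ ι}
    (h : ∀ t, t ≠ s → t ≠ s.swap → α t = β t) :
    ∏ k ∈ univ.erase (mode s),
        hermitePoly (α (.inl k)) (α (.inr k)) (X (.inl k) : MvPolynomial (ι ⊕ ι) ℂ) (X (.inr k)) =
      ∏ k ∈ univ.erase (mode s),
        hermitePoly (β (.inl k)) (β (.inr k)) (X (.inl k)) (X (.inr k)) := by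
  refine prod_congr rfl fun k hk => ?_
  have hk' := (mem_erase.1 hk).1
  rw [h (.inl k), h (.inr k)] <;> rcases s with l | l <;> simp_all [mode]

lemma wickMonomial_add_single (α : ι ⊕ ι →₀ ℕ) (s : ι ⊕ ι) :
    wickMonomial (α + Finsupp.single s 1) =
      X s * wickMonomial α - (α s.swap : ℂ) • wickMonomial (α - Finsupp.single s.swap 1) := by
  have hs : s ≠ s.swap := by rcases s with k | k <;> simp
  rw [wickMonomial_eq _ s, wickMonomial_eq α s, wickMonomial_eq _ s,
    prod_erase_mode_congr (β := α), prod_erase_mode_congr (α := α - _) (β := α)]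
  · have h1 : (α + Finsupp.single s 1 : ι ⊕ ι →₀ ℕ) s = α s + 1 := by simp
    have h2 : (α + Finsupp.single s 1 : ι ⊕ ι →₀ ℕ) s.swap = α s.swap := by simp [hs]
    have h3 : (α - Finsupp.single s.swap 1 : ι ⊕ ι →₀ ℕ) s = α s := by simp [hs.symm]
    have h4 : (α - Finsupp.single s.swap 1 : ι ⊕ ι →₀ ℕ) s.swap = α s.swap - 1 := by simp
    rw [h1, h2, h3, h4, hermitePoly_succ, Algebra.smul_def]
    simp only [map_natCast]
    ring
  · intro t _ ht; simp [ht.symm]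
  · intro t ht _; simp [ht.symm]

lemma pderiv_wickMonomial (α : ι ⊕ ι →₀ ℕ) (s : ι ⊕ ι) :
    pderiv s (wickMonomial α) = (α s : ℂ) • wickMonomial (α - Finsupp.single s 1) := by
  have hs : s.swap ≠ s := by rcases s with k | k <;> simp
  have h0 : pderiv s (∏ k ∈ univ.erase (mode s), hermitePoly (α (.inl k)) (α (.inr k))
      (X (.inl k) : MvPolynomial (ι ⊕ ι) ℂ) (X (.inr k))) = 0 := by
    have hgen : ∀ T : Finset ι, mode s ∉ T → pderiv s (∏ k ∈ T, hermitePoly (α (.inl k))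
        (α (.inr k)) (X (.inl k) : MvPolynomial (ι ⊕ ι) ℂ) (X (.inr k))) = 0 := by
      intro T
      induction T using Finset.induction_on with
      | empty => intro _; simp
      | insert k T hk ih =>
        intro hT
        simp only [mem_insert, not_or] at hT
        have hl : pderiv s (X (.inl k) : MvPolynomial (ι ⊕ ι) ℂ) = 0 :=
          pderiv_X_of_ne (by rintro rfl; exact hT.1 rfl)
        have hr : pderiv s (X (.inr k) : MvPolynomial (ι ⊕ ι) ℂ) = 0 :=
          pderiv_X_of_ne (by rintro rfl; exact hT.1 rfl)
        rw [prod_insert hk, Derivation.leibniz, ih hT.2]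
        simp [hermitePoly, Derivation.leibniz, Derivation.leibniz_pow, hl, hr]
    exact hgen _ (by simp)
  rw [wickMonomial_eq _ s, wickMonomial_eq _ s, prod_erase_mode_congr (α := α - _) (β := α),
    Derivation.leibniz, h0, smul_zero, zero_add, hermitePoly_comm, derivation_hermitePoly _ _ _
    (pderiv_X_of_ne hs) (pderiv_X_self s), Nat.cast_smul_eq_nsmul ℂ, nsmul_eq_mul, smul_eq_mul]
  · have h3 : (α - Finsupp.single s 1 : ι ⊕ ι →₀ ℕ) s.swap = α s.swap := by simp [hs.symm]
    have h4 : (α - Finsupp.single s 1 : ι ⊕ ι →₀ ℕ) s = α s - 1 := by simp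
    rw [h3, h4, hermitePoly_comm (α s - 1)]
    ring
  · intro t ht _; simp [ht.symm]

lemma wick_pderiv (s : ι ⊕ ι) (A : MvPolynomial (ι ⊕ ι) ℂ) :
    wick (pderiv s A) = pderiv s (wick A) := by
  induction A using MvPolynomial.induction_on' with
  | monomial α c =>
    rw [pderiv_monomial, wick_monomial, wick_monomial, Derivation.map_smul, pderiv_wickMonomial,
      smul_smul]
  | add A B hA hB => simp [hA, hB]

/-- The Hermite recurrence, extended linearly: its lower order term is a derivative of the Wick
monomial by `pderiv_wickMonomial`. -/
lemma wick_X_mul (s : ι ⊕ ι) (A : MvPolynomial (ι ⊕ ι) ℂ) :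
    wick (X s * A) = X s * wick A - pderiv s.swap (wick A) := by
  induction A using MvPolynomial.induction_on' with
  | monomial α c =>
    have h : (X s * monomial α c : MvPolynomial (ι ⊕ ι) ℂ) =
        monomial (α + Finsupp.single s 1) c := by
      rw [X, monomial_mul, one_mul, add_comm]
    rw [h, wick_monomial, wick_monomial, Derivation.map_smul, pderiv_wickMonomial,
      wickMonomial_add_single, smul_sub, mul_smul_comm]
  | add A B hA hB => rw [mul_add, map_add, hA, hB, map_add, mul_add, map_add]; ring

end Wick

/-! ### Gaussian expectation of polynomials and integration by parts -/

section Gauss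

variable {ι : Type*} [Fintype ι]

/-- The moment `E[∏ Z_k ^ α_k conj Z_k ^ β_k]` of independent standard complex Gaussian
variables. -/
def gaussMoment (α : ι ⊕ ι →₀ ℕ) : ℂ :=
  ∏ k, if α (.inl k) = α (.inr k) then ((α (.inl k)).factorial : ℂ) else 0

/-- The expectation of a polynomial in independent standard complex Gaussian variables. -/
def gaussE : MvPolynomial (ι ⊕ ι) ℂ →ₗ[ℂ] ℂ :=
  (basisMonomials (ι ⊕ ι) ℂ).constr ℂ gaussMoment

lemma gaussE_monomial (α : ι ⊕ ι →₀ ℕ) (c : ℂ) :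
    gaussE (monomial α c) = c * gaussMoment α := by
  have h : (monomial α c : MvPolynomial (ι ⊕ ι) ℂ) = c • basisMonomials (ι ⊕ ι) ℂ α := by
    simp [smul_monomial]
  rw [h, map_smul, gaussE, Module.Basis.constr_basis, smul_eq_mul]

variable [DecidableEq ι]

lemma gaussMoment_eq (α : ι ⊕ ι →₀ ℕ) (s : ι ⊕ ι) :
    gaussMoment α = (if α s = α s.swap then ((α s).factorial : ℂ) else 0) *
      ∏ k ∈ univ.erase (mode s),
        if α (.inl k) = α (.inr k) then ((α (.inl k)).factorial : ℂ) else 0 := by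
  rw [gaussMoment, ← mul_prod_erase univ _ (mem_univ (mode s))]
  rcases s with k | k
  · rfl
  · simp only [mode, Sum.elim_inr, id, Sum.swap_inr]
    by_cases h : α (.inl k) = α (.inr k)
    · simp [h]
    · simp [h, Ne.symm h]

/-- Only the mode of `s` changes, and there it is b! = b (b-1)!. If the conjugate exponent is zero,
the new exponents differ and both sides vanish. -/
lemma gaussMoment_add_single (α : ι ⊕ ι →₀ ℕ) (s : ι ⊕ ι) :
    gaussMoment (α + Finsupp.single s 1) =
      α s.swap * gaussMoment (α - Finsupp.single s.swap 1) := by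
  have hs : s ≠ s.swap := by rcases s with k | k <;> simp
  have hp : ∀ β γ : ι ⊕ ι →₀ ℕ, (∀ t, t ≠ s → t ≠ s.swap → β t = γ t) →
      (∏ k ∈ univ.erase (mode s),
        if β (.inl k) = β (.inr k) then ((β (.inl k)).factorial : ℂ) else 0) =
      ∏ k ∈ univ.erase (mode s),
        if γ (.inl k) = γ (.inr k) then ((γ (.inl k)).factorial : ℂ) else 0 := by
    intro β γ h
    refine prod_congr rfl fun k hk => ?_
    have hk' := (mem_erase.1 hk).1
    rw [h (.inl k), h (.inr k)] <;> rcases s with l | l <;> simp_all [mode]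
  rw [gaussMoment_eq _ s, gaussMoment_eq _ s, hp (α + _) α, hp (α - _) α, ← mul_assoc]
  · have h1 : (α + Finsupp.single s 1 : ι ⊕ ι →₀ ℕ) s = α s + 1 := by simp
    have h2 : (α + Finsupp.single s 1 : ι ⊕ ι →₀ ℕ) s.swap = α s.swap := by simp [hs]
    have h3 : (α - Finsupp.single s.swap 1 : ι ⊕ ι →₀ ℕ) s = α s := by simp [hs.symm]
    have h4 : (α - Finsupp.single s.swap 1 : ι ⊕ ι →₀ ℕ) s.swap = α s.swap - 1 := by simp
    rw [h1, h2, h3, h4]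
    congr 1
    rcases α s.swap with _ | b
    · simp
    · simp only [add_left_inj, Nat.add_sub_cancel]
      by_cases h : α s = b
      · simp [h, Nat.factorial_succ]
      · simp [h]
  · intro t _ ht; simp [ht.symm]
  · intro t ht _; simp [ht.symm]

/-- Gaussian integration by parts. -/
lemma gaussE_X_mul (s : ι ⊕ ι) (G : MvPolynomial (ι ⊕ ι) ℂ) :
    gaussE (X s * G) = gaussE (pderiv s.swap G) := by
  induction G using MvPolynomial.induction_on' with
  | monomial α c =>
    have h : (X s * monomial α c : MvPolynomial (ι ⊕ ι) ℂ) =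
        monomial (α + Finsupp.single s 1) c := by
      rw [X, monomial_mul, one_mul, add_comm]
    rw [h, pderiv_monomial, gaussE_monomial, gaussE_monomial, gaussMoment_add_single, mul_assoc]
  | add A B hA hB => rw [mul_add, map_add, hA, hB, map_add, map_add]

omit [DecidableEq ι] in
lemma gaussE_one : gaussE (1 : MvPolynomial (ι ⊕ ι) ℂ) = 1 := by
  rw [← C_1, ← monomial_zero', gaussE_monomial]
  simp [gaussMoment]

/-- Integrating X_s :A: G by parts differentiates :A: and G in the conjugate letter; the correction
term of `wick_X_mul` cancels the derivative of :A:. -/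
lemma gaussE_wick_X_mul (s : ι ⊕ ι) (A G : MvPolynomial (ι ⊕ ι) ℂ) :
    gaussE (wick (X s * A) * G) = gaussE (wick A * pderiv s.swap G) := by
  rw [wick_X_mul, sub_mul, mul_assoc, map_sub, gaussE_X_mul, Derivation.leibniz, ← map_sub]
  congr 1
  simp only [smul_eq_mul]
  ring

/-- A letter in front of the rest of a monomial turns into a derivative of the constant 1, so only
the constant term has non-zero mean. -/
lemma gaussE_wick (A : MvPolynomial (ι ⊕ ι) ℂ) : gaussE (wick A) = constantCoeff A := by
  induction A using MvPolynomial.induction_on with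
  | C c =>
    have : (C c : MvPolynomial (ι ⊕ ι) ℂ) = c • 1 := by rw [smul_eq_C_mul, mul_one]
    rw [constantCoeff_C, this, map_smul, map_smul, wick_one, gaussE_one, smul_eq_mul, mul_one]
  | add A B hA hB => rw [map_add, map_add, hA, hB, map_add]
  | mul_X A s _ =>
    rw [mul_comm, ← mul_one (wick (X s * A)), gaussE_wick_X_mul]
    simp

/-- The bilinear pairing `E[:A: :B:]`. -/
def pairing : MvPolynomial (ι ⊕ ι) ℂ →ₗ[ℂ] MvPolynomial (ι ⊕ ι) ℂ →ₗ[ℂ] ℂ :=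
  ((LinearMap.mul ℂ (MvPolynomial (ι ⊕ ι) ℂ)).compl₁₂ wick wick).compr₂ gaussE

omit [DecidableEq ι] in
lemma pairing_apply (A B : MvPolynomial (ι ⊕ ι) ℂ) :
    pairing A B = gaussE (wick A * wick B) := rfl

/-- The adjointness on which all evaluations of the pairing rest. The pairing is bilinear, so no
conjugation of coefficients occurs and a letter is matched with its swap. -/
lemma pairing_X_mul (s : ι ⊕ ι) (A B : MvPolynomial (ι ⊕ ι) ℂ) :
    pairing (X s * A) B = pairing A (pderiv s.swap B) := by
  rw [pairing_apply, pairing_apply, gaussE_wick_X_mul, wick_pderiv]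

lemma pairing_one (A : MvPolynomial (ι ⊕ ι) ℂ) : pairing 1 A = constantCoeff A := by
  rw [pairing_apply, wick_one, one_mul, gaussE_wick]

end Gauss

/-! ### The product formula -/

section Product

/-- Each of the n + 1 factors D leaves a T behind when it passes L, and T commutes with the
remaining factors. -/
lemma pow_succ_mul_of_commutator {R : Type*} [Semiring R] {D L T : R} (h : D * L = L * D + T)
    (hT : Commute D T) (n : ℕ) : D ^ (n + 1) * L = L * D ^ (n + 1) + (n + 1) • (D ^ n * T) := by
  induction n with
  | zero => simpa using h
  | succ n ih =>
    have e : D * (D ^ n * T) = D ^ (n + 1) * T := by rw [pow_succ', mul_assoc]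
    rw [pow_succ' D (n + 1), mul_assoc, ih, mul_add, ← mul_assoc, h, mul_smul_comm, e, add_mul,
      mul_assoc, ← hT.pow_left (n + 1), succ_nsmul _ (n + 1)]
    abel

variable {ι : Type*}

/-- The motive carries a degree bound because it will involve an exponential truncated at that
level: moving a letter through level N + 1 leaves a term of level N, so the step needs the statement
for `A` at both levels. -/
lemma degree_induction {motive : ℕ → MvPolynomial (ι ⊕ ι) ℂ → Prop}
    (const : ∀ N c, motive N (C c))
    (add : ∀ N A B, motive N A → motive N B → motive N (A + B))
    (X_mul : ∀ N s A, motive N A → motive (N + 1) A → motive (N + 1) (X s * A))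
    {N : ℕ} {A : MvPolynomial (ι ⊕ ι) ℂ} (hA : A.totalDegree ≤ N) : motive N A := by
  have hmon : ∀ (d N : ℕ) (α : ι ⊕ ι →₀ ℕ) (c : ℂ), α.degree = d → d ≤ N →
      motive N (monomial α c) := by
    intro d
    induction d with
    | zero =>
      intro N α c hα _
      rw [(Finsupp.degree_eq_zero_iff α).1 hα]
      exact const N c
    | succ d ih =>
      intro N α c hα hN
      obtain ⟨s, hs⟩ : ∃ s, α s ≠ 0 := by
        by_contra! h
        have : α = 0 := Finsupp.ext h
        simp [this] at hα
      have hsplit : α = Finsupp.single s 1 + (α - Finsupp.single s 1) := by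
        rw [add_tsub_cancel_of_le]
        simpa [Nat.one_le_iff_ne_zero] using hs
      obtain ⟨N, rfl⟩ : ∃ M, N = M + 1 := ⟨N - 1, by omega⟩
      have hdeg : (α - Finsupp.single s 1).degree = d := by
        have := congrArg Finsupp.degree hsplit
        rw [map_add, hα] at this
        simp at this
        omega
      rw [hsplit, ← one_mul c, ← monomial_mul]
      exact X_mul N s _ (ih N _ c hdeg (by omega)) (ih (N + 1) _ c hdeg (by omega))
  rw [A.as_sum]
  have : ∀ T ⊆ A.support, motive N (∑ α ∈ T, monomial α (A.coeff α)) := by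
    intro T
    induction T using Finset.cons_induction with
    | empty => intro _; simpa using const N 0
    | cons α T hα ih =>
      intro hT
      rw [sum_cons]
      rw [cons_subset] at hT
      exact add _ _ _ (hmon _ N α _ rfl ((le_totalDegree hT.1).trans hA)) (ih hT.2)
  exact this _ subset_rfl

local notation "𝒫" => MvPolynomial (ι ⊕ ι) ℂ

/-- Multiplication by a variable in the first factor. -/
def mulFst (s : ι ⊕ ι) : Module.End ℂ (𝒫 ⊗[ℂ] 𝒫) :=
  TensorProduct.map (LinearMap.mulLeft ℂ (X s)) LinearMap.id

/-- Differentiation of the second factor. -/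
def derivSnd (s : ι ⊕ ι) : Module.End ℂ (𝒫 ⊗[ℂ] 𝒫) :=
  TensorProduct.map LinearMap.id ((pderiv s : Derivation ℂ 𝒫 𝒫) : 𝒫 →ₗ[ℂ] 𝒫)

/-- Contraction of a letter of the first factor with the conjugate letter of the second. -/
def contractLetter (s : ι ⊕ ι) : Module.End ℂ (𝒫 ⊗[ℂ] 𝒫) :=
  TensorProduct.map ((pderiv s : Derivation ℂ 𝒫 𝒫) : 𝒫 →ₗ[ℂ] 𝒫) ((pderiv s.swap : Derivation ℂ 𝒫 𝒫) : 𝒫 →ₗ[ℂ] 𝒫)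

@[simp] lemma mulFst_tmul (s : ι ⊕ ι) (A B : 𝒫) : mulFst s (A ⊗ₜ[ℂ] B) = (X s * A) ⊗ₜ B := rfl

@[simp] lemma derivSnd_tmul (s : ι ⊕ ι) (A B : 𝒫) :
    derivSnd s (A ⊗ₜ[ℂ] B) = A ⊗ₜ pderiv s B := rfl

@[simp] lemma contractLetter_tmul (s : ι ⊕ ι) (A B : 𝒫) :
    contractLetter s (A ⊗ₜ[ℂ] B) = pderiv s A ⊗ₜ pderiv s.swap B := rfl

lemma pderiv_comm (s t : ι ⊕ ι) (A : 𝒫) : pderiv s (pderiv t A) = pderiv t (pderiv s A) := by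
  induction A using MvPolynomial.induction_on' with
  | monomial α c =>
    classical
    rw [pderiv_monomial, pderiv_monomial, pderiv_monomial, pderiv_monomial, tsub_right_comm]
    congr 1
    by_cases h : s = t
    · subst h; rfl
    · have h1 : (α - Finsupp.single t 1 : ι ⊕ ι →₀ ℕ) s = α s := by simp [Ne.symm h]
      have h2 : (α - Finsupp.single s 1 : ι ⊕ ι →₀ ℕ) t = α t := by simp [h]
      rw [h1, h2]
      ring
  | add A B hA hB => simp [hA, hB]

lemma contractLetter_commute (s t : ι ⊕ ι) :
    Commute (contractLetter s) (contractLetter t) := by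
  refine TensorProduct.ext' fun A B => ?_
  simp only [Module.End.mul_apply, contractLetter_tmul]
  rw [pderiv_comm s, pderiv_comm s.swap]

lemma contractLetter_commute_derivSnd (s t : ι ⊕ ι) :
    Commute (contractLetter s) (derivSnd t) := by
  refine TensorProduct.ext' fun A B => ?_
  simp only [Module.End.mul_apply, contractLetter_tmul, derivSnd_tmul]
  rw [pderiv_comm t]

variable [Fintype ι]

/-- Contraction of one pair of letters. -/
def contract : Module.End ℂ (𝒫 ⊗[ℂ] 𝒫) := ∑ s, contractLetter s

lemma contract_tmul (A B : 𝒫) :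
    contract (A ⊗ₜ[ℂ] B) = ∑ s, pderiv s A ⊗ₜ[ℂ] pderiv s.swap B := by
  simp [contract]

/-- Leibniz: the new letter is either spared, or removed by the single contraction with t = s, which
differentiates the second factor in `s.swap`. -/
lemma contract_mul_mulFst (s : ι ⊕ ι) :
    contract * mulFst s = mulFst s * contract + derivSnd s.swap := by
  classical
  refine TensorProduct.ext' fun A B => ?_
  simp only [Module.End.mul_apply, mulFst_tmul, contract_tmul, LinearMap.add_apply, map_sum,
    derivSnd_tmul]
  have h : ∀ t, pderiv t (X s * A) ⊗ₜ[ℂ] pderiv t.swap B =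
      (X s * pderiv t A) ⊗ₜ[ℂ] pderiv t.swap B + if t = s then A ⊗ₜ[ℂ] pderiv t.swap B else 0 := by
    intro t
    rw [Derivation.leibniz, TensorProduct.add_tmul]
    split_ifs with hts
    · subst hts; simp
    · rw [pderiv_X_of_ne (Ne.symm hts)]; simp
  rw [sum_congr rfl fun t _ => h t, sum_add_distrib]
  simp

lemma contract_commute_derivSnd (t : ι ⊕ ι) : Commute contract (derivSnd t) :=
  Commute.sum_left _ _ _ fun s _ => contractLetter_commute_derivSnd s t

/-- The truncated exponential of the contraction operator. -/
def contractExp (N : ℕ) : Module.End ℂ (𝒫 ⊗[ℂ] 𝒫) :=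
  ∑ r ∈ range (N + 1), ((r.factorial : ℂ)⁻¹) • contract ^ r

/-- The factor r + 1 of the commutator turns 1/(r+1)! into 1/r!, so the remainder is again an
exponential, truncated one level lower. -/
lemma contractExp_mul_mulFst (N : ℕ) (s : ι ⊕ ι) :
    contractExp (N + 1) * mulFst s =
      mulFst s * contractExp (N + 1) + contractExp N * derivSnd s.swap := by
  have h : ∀ r ∈ range (N + 1), (((r + 1).factorial : ℂ)⁻¹) • contract ^ (r + 1) * mulFst s =
      mulFst s * ((((r + 1).factorial : ℂ)⁻¹) • contract ^ (r + 1)) +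
        ((r.factorial : ℂ)⁻¹) • contract ^ r * derivSnd s.swap := by
    intro r _
    rw [smul_mul_assoc, pow_succ_mul_of_commutator (contract_mul_mulFst s)
      (contract_commute_derivSnd _), smul_add, mul_smul_comm, smul_mul_assoc,
      ← Nat.cast_smul_eq_nsmul ℂ, smul_smul]
    congr 2
    have h1 : (r.factorial : ℂ) ≠ 0 := by exact_mod_cast r.factorial_ne_zero
    have h2 : ((r : ℂ) + 1) ≠ 0 := by exact_mod_cast r.succ_ne_zero
    rw [Nat.factorial_succ]
    push_cast
    field_simp
  rw [contractExp, sum_range_succ', add_mul, sum_mul, sum_congr rfl h, sum_add_distrib,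
    ← mul_sum, ← sum_mul, mul_add, contractExp]
  simp only [pow_zero, Nat.factorial_zero, Nat.cast_one, inv_one, one_smul, one_mul, mul_one]
  abel

lemma contractExp_mulFst_apply (N : ℕ) (s : ι ⊕ ι) (t : 𝒫 ⊗[ℂ] 𝒫) :
    contractExp (N + 1) (mulFst s t) =
      mulFst s (contractExp (N + 1) t) + contractExp N (derivSnd s.swap t) :=
  LinearMap.congr_fun (contractExp_mul_mulFst N s) t

lemma contractExp_derivSnd (N : ℕ) (s : ι ⊕ ι) (t : 𝒫 ⊗[ℂ] 𝒫) :
    contractExp N (derivSnd s t) = derivSnd s (contractExp N t) := by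
  have : Commute (contractExp N) (derivSnd s) :=
    Commute.sum_left _ _ _ fun r _ =>
      ((contract_commute_derivSnd s).pow_left r).smul_left _
  exact LinearMap.congr_fun this t

/-- Every contraction differentiates the first factor and so kills a constant there. -/
lemma contractExp_C (N : ℕ) (c : ℂ) (B : 𝒫) :
    contractExp N (C c ⊗ₜ[ℂ] B) = C c ⊗ₜ B := by
  have h : contract (C c ⊗ₜ[ℂ] B : 𝒫 ⊗[ℂ] 𝒫) = 0 := by simp [contract_tmul]
  rw [contractExp, sum_range_succ', LinearMap.add_apply, LinearMap.sum_apply,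
    sum_eq_zero fun r _ => ?_]
  · simp
  · rw [LinearMap.smul_apply, pow_succ, Module.End.mul_apply, h, map_zero, smul_zero]

/-- Multiplication of polynomials, as a linear map on the tensor product. -/
abbrev mulTensor : 𝒫 ⊗[ℂ] 𝒫 →ₗ[ℂ] 𝒫 := LinearMap.mul' ℂ 𝒫

omit [Fintype ι] in
lemma mulTensor_mulFst (s : ι ⊕ ι) (t : 𝒫 ⊗[ℂ] 𝒫) :
    mulTensor (mulFst s t) = X s * mulTensor t := by
  induction t with
  | zero => simp
  | tmul A B => simp [mul_assoc]
  | add a b ha hb => simp only [map_add, ha, hb, mul_add]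

variable [DecidableEq ι]

/-- Induction on the letters of `A`. For X_s A the right side is X_s :A: :B: - ∂(:A: :B:) + :A:
∂:B:, with ∂ the derivative in `s.swap`. By Leibniz this is (X_s :A: - ∂:A:) :B:, which is :X_s A:
:B:. -/
theorem wick_mul_wick {N : ℕ} {A : 𝒫} (hA : A.totalDegree ≤ N) (B : 𝒫) :
    wick A * wick B = wick (mulTensor (contractExp N (A ⊗ₜ B))) := by
  refine degree_induction (motive := fun N A => ∀ B, wick A * wick B =
    wick (mulTensor (contractExp N (A ⊗ₜ B)))) ?_ ?_ ?_ hA B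
  · intro N c B
    have : (C c : 𝒫) = c • 1 := by rw [smul_eq_C_mul, mul_one]
    rw [contractExp_C, LinearMap.mul'_apply, this, map_smul, wick_one]
    simp
  · intro N A A' h h' B
    rw [map_add, add_mul, h, h', TensorProduct.add_tmul, map_add, map_add, map_add]
  · intro N s A h h' B
    rw [← mulFst_tmul, contractExp_mulFst_apply, derivSnd_tmul, map_add, map_add,
      mulTensor_mulFst, wick_X_mul, wick_X_mul, ← h', ← h, wick_pderiv, Derivation.leibniz]
    simp only [smul_eq_mul]
    ring

/-- The pairing of `A ⊗ C` and `B ⊗ D` in which `A` is paired with `D` and `B` with `C`. -/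
def crossPairing : 𝒫 ⊗[ℂ] 𝒫 →ₗ[ℂ] Module.Dual ℂ (𝒫 ⊗[ℂ] 𝒫) :=
  TensorProduct.dualDistrib ℂ 𝒫 𝒫 ∘ₗ TensorProduct.map pairing.flip pairing ∘ₗ
    (TensorProduct.comm ℂ 𝒫 𝒫).toLinearMap

omit [DecidableEq ι] in
@[simp] lemma crossPairing_tmul (A B C D : 𝒫) :
    crossPairing (A ⊗ₜ[ℂ] C) (B ⊗ₜ[ℂ] D) = pairing B C * pairing A D := rfl

/-- The letter sits in `A`, which is paired with the second factor of the other tensor, so it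
reappears there as a derivative. -/
lemma crossPairing_mulFst_left (s : ι ⊕ ι) (t t' : 𝒫 ⊗[ℂ] 𝒫) :
    crossPairing (mulFst s t) t' = crossPairing t (derivSnd s.swap t') := by
  induction t with
  | zero => simp
  | add a b ha hb => simp only [map_add, ha, hb, LinearMap.add_apply]
  | tmul A C =>
    induction t' with
    | zero => simp
    | add a b ha hb => simp only [map_add, ha, hb]
    | tmul B D => simp [pairing_X_mul]

lemma crossPairing_mulFst_right (s : ι ⊕ ι) (t t' : 𝒫 ⊗[ℂ] 𝒫) :
    crossPairing t (mulFst s t') = crossPairing (derivSnd s.swap t) t' := by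
  induction t with
  | zero => simp
  | add a b ha hb => simp only [map_add, ha, hb, LinearMap.add_apply]
  | tmul A C =>
    induction t' with
    | zero => simp
    | add a b ha hb => simp only [map_add, ha, hb]
    | tmul B D => simp [pairing_X_mul]

/-- Every letter of AB is matched with one of CD. The exponential on A ⊗ C removes the pairs between
A and C, that on B ⊗ D the pairs between B and D; the remaining letters are matched between A and D
and between B and C. Formally, a letter stripped from the left becomes a derivative of CD, and
Leibniz decides which of C and D it meets. -/
theorem pairing_mul_mul {N M : ℕ} {A B : 𝒫} (hA : A.totalDegree ≤ N) (hB : B.totalDegree ≤ M)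
    (C D : 𝒫) : pairing (A * B) (C * D) =
      crossPairing (contractExp N (A ⊗ₜ C)) (contractExp M (B ⊗ₜ D)) := by
  have hC : ∀ c : ℂ, (MvPolynomial.C c : 𝒫) = c • 1 := fun c => by rw [smul_eq_C_mul, mul_one]
  -- The case A = 1, where the exponential on 1 ⊗ C is trivial; it is the base of the induction on
  -- the letters of `A`.
  have step : ∀ C D : 𝒫, pairing B (C * D) =
      crossPairing (1 ⊗ₜ C) (contractExp M (B ⊗ₜ D)) := by
    refine degree_induction (motive := fun M B => ∀ C D : 𝒫, pairing B (C * D) =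
      crossPairing (1 ⊗ₜ C) (contractExp M (B ⊗ₜ D))) ?_ ?_ ?_ hB
    · intro N c C D
      rw [contractExp_C, hC, crossPairing_tmul, map_smul, LinearMap.smul_apply,
        LinearMap.smul_apply, pairing_one, pairing_one, pairing_one, map_mul, smul_eq_mul,
        smul_eq_mul]
      ring
    · intro N B B' h h' C D
      rw [map_add, LinearMap.add_apply, h, h', TensorProduct.add_tmul, map_add, map_add]
    · intro N s B h h' C D
      rw [← mulFst_tmul, contractExp_mulFst_apply, derivSnd_tmul, map_add,
        crossPairing_mulFst_right, derivSnd_tmul, ← h, ← h', ← map_add, pairing_X_mul,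
        Derivation.leibniz]
      congr 1
      simp only [smul_eq_mul]
      ring
  refine degree_induction (motive := fun N A => ∀ C D : 𝒫, pairing (A * B) (C * D) =
      crossPairing (contractExp N (A ⊗ₜ C)) (contractExp M (B ⊗ₜ D))) ?_ ?_ ?_ hA C D
  · intro N c C D
    rw [contractExp_C, hC, smul_mul_assoc, one_mul, map_smul, LinearMap.smul_apply, step,
      ← TensorProduct.smul_tmul', map_smul, LinearMap.smul_apply]
  · intro N A A' h h' C D
    rw [add_mul, map_add, LinearMap.add_apply, h, h', TensorProduct.add_tmul, map_add, map_add,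
      LinearMap.add_apply]
  · intro N s A h h' C D
    rw [← mulFst_tmul, contractExp_mulFst_apply, derivSnd_tmul, map_add, LinearMap.add_apply,
      crossPairing_mulFst_left, ← contractExp_derivSnd, derivSnd_tmul, ← h, ← h', ← map_add,
      mul_assoc, pairing_X_mul, Derivation.leibniz]
    congr 1
    simp only [smul_eq_mul]
    ring

/-- Contraction of a variable of the first kind with one of the second kind. -/
def contractX : Module.End ℂ (𝒫 ⊗[ℂ] 𝒫) := ∑ k, contractLetter (.inl k)

/-- Contraction of a variable of the second kind with one of the first kind. -/
def contractY : Module.End ℂ (𝒫 ⊗[ℂ] 𝒫) := ∑ k, contractLetter (.inr k)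

omit [DecidableEq ι] in
lemma contractX_commute_contractY : Commute (contractX (ι := ι)) contractY :=
  Commute.sum_left _ _ _ fun _ _ => Commute.sum_right _ _ _ fun _ _ => contractLetter_commute _ _

-- The binomial theorem for the commuting operators `contractX` and `contractY`; it separates the
-- total contraction order r into the pairs (i, j).
omit [DecidableEq ι] in
lemma inv_factorial_smul_contract_pow (r : ℕ) :
    ((r.factorial : ℂ)⁻¹) • (contract (ι := ι)) ^ r = ∑ x ∈ antidiagonal r,
      ((x.1.factorial : ℂ) * (x.2.factorial : ℂ))⁻¹ • (contractX ^ x.1 * contractY ^ x.2) := by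
  have : contract (ι := ι) = contractX + contractY := by
    rw [contract, Fintype.sum_sum_type]; rfl
  rw [this, contractX_commute_contractY.add_pow', smul_sum]
  refine sum_congr rfl fun x hx => ?_
  rw [← Nat.cast_smul_eq_nsmul ℂ, smul_smul]
  congr 1
  rw [HasAntidiagonal.mem_antidiagonal] at hx
  have h := Nat.add_choose_mul_factorial_mul_factorial x.1 x.2
  rw [← Nat.choose_symm_add, hx] at h
  have h' := congrArg (Nat.cast (R := ℂ)) h
  push_cast at h'
  have h1 : (x.1.factorial : ℂ) ≠ 0 := by exact_mod_cast x.1.factorial_ne_zero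
  have h2 : (x.2.factorial : ℂ) ≠ 0 := by exact_mod_cast x.2.factorial_ne_zero
  have h3 : (r.factorial : ℂ) ≠ 0 := by exact_mod_cast r.factorial_ne_zero
  field_simp
  linear_combination h'

end Product

/-! ### Polynomials attached to kernels -/

section Words

variable {ι : Type*}

local notation "𝒫" => MvPolynomial (ι ⊕ ι) ℂ

/-- The monomial of a word in the variables of one kind. -/
def wordMonomial (c : ι → ι ⊕ ι) {a : ℕ} (p : Fin a → ι) : 𝒫 := ∏ s, X (c (p s))

@[simp] lemma wordMonomial_zero (c : ι → ι ⊕ ι) (p : Fin 0 → ι) : wordMonomial c p = 1 := by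
  simp [wordMonomial]

lemma wordMonomial_snoc (c : ι → ι ⊕ ι) {a : ℕ} (p : Fin a → ι) (k : ι) :
    wordMonomial c (Fin.snoc p k : Fin (a + 1) → ι) = wordMonomial c p * X (c k) := by
  simp [wordMonomial, Fin.prod_univ_castSucc]

lemma wordMonomial_append (c : ι → ι ⊕ ι) {a b : ℕ} (p : Fin a → ι) (q : Fin b → ι) :
    wordMonomial c (Fin.append p q) = wordMonomial c p * wordMonomial c q := by
  simp [wordMonomial, Fin.prod_univ_add]

lemma wordMonomial_comp_perm (c : ι → ι ⊕ ι) {a : ℕ} (p : Fin a → ι) (σ : Equiv.Perm (Fin a)) :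
    wordMonomial c (p ∘ σ) = wordMonomial c p :=
  Fintype.prod_equiv σ _ _ fun _ => rfl

lemma constantCoeff_wordMonomial (c : ι → ι ⊕ ι) {a : ℕ} (ha : a ≠ 0) (p : Fin a → ι) :
    constantCoeff (wordMonomial c p) = 0 := by
  rw [wordMonomial, map_prod]
  exact prod_eq_zero (mem_univ ⟨0, Nat.pos_of_ne_zero ha⟩) (by simp)

lemma totalDegree_wordMonomial (c : ι → ι ⊕ ι) {a : ℕ} (p : Fin a → ι) :
    (wordMonomial c p).totalDegree ≤ a := by
  refine (totalDegree_finsetProd _ _).trans ?_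
  simp [totalDegree_X]

lemma pderiv_wordMonomial_of_ne {c : ι → ι ⊕ ι} {s : ι ⊕ ι} (h : ∀ k, c k ≠ s) {a : ℕ}
    (p : Fin a → ι) : pderiv s (wordMonomial c p) = 0 := by
  induction a with
  | zero => simp
  | succ a ih =>
    rw [← Fin.snoc_init_self p, wordMonomial_snoc, Derivation.leibniz, ih, pderiv_X_of_ne (h _)]
    simp

/-- The iterated derivative along a word. -/
def derivWord (c : ι → ι ⊕ ι) : {i : ℕ} → (Fin i → ι) → Module.End ℂ 𝒫
  | 0, _ => 1
  | i + 1, u => derivWord c (Fin.init u : Fin i → ι) *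
      ((pderiv (c (u (Fin.last i))) : Derivation ℂ 𝒫 𝒫) : 𝒫 →ₗ[ℂ] 𝒫)

@[simp] lemma derivWord_zero (c : ι → ι ⊕ ι) (u : Fin 0 → ι) (A : 𝒫) : derivWord c u A = A := rfl

lemma derivWord_succ (c : ι → ι ⊕ ι) {i : ℕ} (u : Fin (i + 1) → ι) (A : 𝒫) :
    derivWord c u A = derivWord c (Fin.init u : Fin i → ι) (pderiv (c (u (Fin.last i))) A) := rfl

lemma derivWord_snoc (c : ι → ι ⊕ ι) {i : ℕ} (u : Fin i → ι) (k : ι) (A : 𝒫) :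
    derivWord c (Fin.snoc u k : Fin (i + 1) → ι) A = derivWord c u (pderiv (c k) A) := by
  rw [derivWord_succ, Fin.init_snoc, Fin.snoc_last]

lemma derivWord_pderiv (c : ι → ι ⊕ ι) {i : ℕ} (u : Fin i → ι) (s : ι ⊕ ι) (A : 𝒫) :
    derivWord c u (pderiv s A) = pderiv s (derivWord c u A) := by
  induction i generalizing A with
  | zero => rfl
  | succ i ih => rw [derivWord_succ, pderiv_comm, ih, derivWord_succ]

lemma derivWord_comm (c c' : ι → ι ⊕ ι) {i j : ℕ} (u : Fin i → ι) (v : Fin j → ι) (A : 𝒫) :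
    derivWord c u (derivWord c' v A) = derivWord c' v (derivWord c u A) := by
  induction i generalizing A with
  | zero => rfl
  | succ i ih => rw [derivWord_succ, ← derivWord_pderiv, ih, derivWord_succ]

variable [Fintype ι]

lemma sum_snoc {M : Type*} [AddCommMonoid M] {i : ℕ} (F : (Fin (i + 1) → ι) → M) :
    ∑ u, F u = ∑ k, ∑ u : Fin i → ι, F (Fin.snoc u k) := by
  classical
  rw [← Fintype.sum_prod_type']
  exact (Fintype.sum_equiv (Fin.snocEquiv fun _ => ι) _ _ fun _ => rfl).symm

lemma sum_append {M : Type*} [AddCommMonoid M] {i j : ℕ} (F : (Fin (i + j) → ι) → M) :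
    ∑ u, F u = ∑ p : Fin i → ι, ∑ q : Fin j → ι, F (Fin.append p q) := by
  classical
  rw [← Fintype.sum_prod_type']
  exact (Fintype.sum_equiv (Fin.appendEquiv i j) _ _ fun _ => rfl).symm

/-- Each further factor adds one contracted index as the last letter of `u` or `v`. Conjugate
letters meet, so `u` acts on letters of the first kind in `A` and of the second kind in `B`, and `v`
the other way round. -/
lemma contractX_pow_mul_contractY_pow (i j : ℕ) (A B : 𝒫) :
    (contractX ^ i * contractY ^ j : Module.End ℂ (𝒫 ⊗[ℂ] 𝒫)) (A ⊗ₜ[ℂ] B) =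
      ∑ u : Fin i → ι, ∑ v : Fin j → ι, derivWord .inl u (derivWord .inr v A) ⊗ₜ[ℂ]
        derivWord .inl v (derivWord .inr u B) := by
  have hX : ∀ (i : ℕ) (A B : 𝒫), (contractX ^ i : Module.End ℂ (𝒫 ⊗[ℂ] 𝒫)) (A ⊗ₜ[ℂ] B) =
      ∑ u : Fin i → ι, derivWord .inl u A ⊗ₜ[ℂ] derivWord .inr u B := by
    intro i
    induction i with
    | zero => intro A B; simp
    | succ i ih =>
      intro A B
      rw [pow_succ, Module.End.mul_apply, contractX, LinearMap.sum_apply, map_sum, sum_snoc]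
      refine sum_congr rfl fun k _ => ?_
      rw [contractLetter_tmul, ← contractX, ih]
      exact sum_congr rfl fun u _ => by rw [derivWord_snoc, derivWord_snoc]; rfl
  have hY : ∀ (i : ℕ) (A B : 𝒫), (contractY ^ i : Module.End ℂ (𝒫 ⊗[ℂ] 𝒫)) (A ⊗ₜ[ℂ] B) =
      ∑ u : Fin i → ι, derivWord .inr u A ⊗ₜ[ℂ] derivWord .inl u B := by
    intro i
    induction i with
    | zero => intro A B; simp
    | succ i ih =>
      intro A B
      rw [pow_succ, Module.End.mul_apply, contractY, LinearMap.sum_apply, map_sum, sum_snoc]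
      refine sum_congr rfl fun k _ => ?_
      rw [contractLetter_tmul, ← contractY, ih]
      exact sum_congr rfl fun u _ => by rw [derivWord_snoc, derivWord_snoc]; rfl
  rw [Module.End.mul_apply, hY, map_sum, sum_comm]
  refine sum_congr rfl fun v _ => ?_
  rw [hX]
  exact sum_congr rfl fun u _ => by rw [derivWord_comm .inl .inr v u B]

/-- A polynomial that is homogeneous in the variables of one kind, with coefficients `ψ`. -/
def wordSum (c : ι → ι ⊕ ι) {a : ℕ} (ψ : (Fin a → ι) → 𝒫) : 𝒫 := ∑ p, ψ p * wordMonomial c p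

lemma wordSum_succ (c : ι → ι ⊕ ι) {a : ℕ} (ψ : (Fin (a + 1) → ι) → 𝒫) :
    wordSum c ψ = ∑ k, wordSum c (fun p => ψ (Fin.snoc p k)) * X (c k) := by
  rw [wordSum, sum_snoc]
  refine sum_congr rfl fun k _ => ?_
  rw [wordSum, sum_mul]
  exact sum_congr rfl fun p _ => by rw [wordMonomial_snoc, mul_assoc]

/-- Invariance under permutation of the letters. -/
def PermInvariant {E : Type*} {a : ℕ} (ψ : (Fin a → ι) → E) : Prop :=
  ∀ (σ : Equiv.Perm (Fin a)) p, ψ (p ∘ σ) = ψ p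

-- A permutation of the first letters extends by fixing the last one.
omit [Fintype ι] in
lemma PermInvariant.snoc {E : Type*} {a : ℕ} {ψ : (Fin (a + 1) → ι) → E} (h : PermInvariant ψ)
    (k : ι) : PermInvariant fun p : Fin a → ι => ψ (Fin.snoc p k) := by
  intro σ p
  change ψ (Fin.snoc (p ∘ σ) k) = ψ (Fin.snoc p k)
  rw [← h ((finSuccEquivLast.trans (Equiv.optionCongr σ)).trans finSuccEquivLast.symm)
    (Fin.snoc p k)]
  congr 1
  funext s
  refine Fin.lastCases ?_ (fun s => ?_) s <;> simp

omit [Fintype ι] in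
lemma PermInvariant.snoc_snoc {E : Type*} {a : ℕ} {ψ : (Fin (a + 2) → ι) → E}
    (h : PermInvariant ψ) (k l : ι) (p : Fin a → ι) :
    ψ (Fin.snoc (Fin.snoc p k : Fin (a + 1) → ι) l) =
      ψ (Fin.snoc (Fin.snoc p l : Fin (a + 1) → ι) k) := by
  rw [← h (Equiv.swap (Fin.last (a + 1)) (Fin.last a).castSucc) (Fin.snoc _ l)]
  congr 1
  funext s
  refine Fin.lastCases ?_ (fun s => ?_) s
  · simp
  · refine Fin.lastCases ?_ (fun s => ?_) s
    · simp
    · have h1 : s.castSucc.castSucc ≠ Fin.last (a + 1) := (Fin.castSucc_lt_last _).ne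
      have h2 : s.castSucc.castSucc ≠ (Fin.last a).castSucc :=
        fun h => (Fin.castSucc_lt_last s).ne (Fin.castSucc_injective _ h)
      simp [Equiv.swap_apply_of_ne_of_ne h1 h2]

lemma pderiv_wordSum_zero {c : ι → ι ⊕ ι} {ψ : (Fin 0 → ι) → 𝒫}
    {k : ι} (h0 : ∀ p, pderiv (c k) (ψ p) = 0) : pderiv (c k) (wordSum c ψ) = 0 := by
  simp [wordSum, h0]

lemma pderiv_wordSum_succ {c : ι → ι ⊕ ι} (hc : Function.Injective c) {a : ℕ}
    (ψ : (Fin (a + 1) → ι) → 𝒫) (k : ι) :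
    pderiv (c k) (wordSum c ψ) = wordSum c (fun p => ψ (Fin.snoc p k)) +
      ∑ l, X (c l) * pderiv (c k) (wordSum c fun p => ψ (Fin.snoc p l)) := by
  classical
  have hX : ∀ l, pderiv (c k) (X (c l) : 𝒫) = if l = k then 1 else 0 := by
    intro l
    rw [pderiv_X]
    simp [Pi.single_apply, hc.eq_iff]
  rw [wordSum_succ, map_sum]
  simp only [Derivation.leibniz, hX, smul_eq_mul, mul_ite, mul_one, mul_zero, sum_add_distrib,
    sum_ite_eq', mem_univ, if_true]

/-- The derivative hits one of a + 1 positions, and by symmetry each contributes the same sum. In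
the induction the last position is split off, and `snoc_snoc` exchanges the frozen letter with it.
-/
lemma pderiv_wordSum {c : ι → ι ⊕ ι} (hc : Function.Injective c) {a : ℕ}
    {ψ : (Fin (a + 1) → ι) → 𝒫} (h : PermInvariant ψ) {k : ι}
    (h0 : ∀ p, pderiv (c k) (ψ p) = 0) :
    pderiv (c k) (wordSum c ψ) =
      ((a + 1 : ℕ) : ℂ) • wordSum c fun p => ψ (Fin.snoc p k) := by
  induction a with
  | zero =>
    rw [pderiv_wordSum_succ hc, sum_eq_zero fun l _ => ?_]
    · simp
    · rw [pderiv_wordSum_zero fun p => h0 _, mul_zero]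
  | succ a ih =>
    have key : ∑ l, X (c l) * pderiv (c k) (wordSum c fun p => ψ (Fin.snoc p l)) =
        ((a + 1 : ℕ) : ℂ) • wordSum c fun p => ψ (Fin.snoc p k) := by
      rw [wordSum_succ c fun p => ψ (Fin.snoc p k), smul_sum]
      refine sum_congr rfl fun l _ => ?_
      have h1 := ih (ψ := fun p => ψ (Fin.snoc p l)) (h.snoc l) (fun p => h0 _)
      rw [h1, mul_smul_comm, mul_comm]
      congr 3
      funext p
      exact h.snoc_snoc k l p
    rw [pderiv_wordSum_succ hc, key, Nat.cast_succ (a + 1), add_smul, one_smul, add_comm]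

/-- The descending factorial counts the ordered choices of the positions hit by successive
derivatives. -/
lemma derivWord_wordSum {c : ι → ι ⊕ ι} (hc : Function.Injective c) {a i : ℕ}
    {ψ : (Fin (a + i) → ι) → 𝒫} (h : PermInvariant ψ)
    (h0 : ∀ k p, pderiv (c k) (ψ p) = 0) (u : Fin i → ι) :
    derivWord c u (wordSum c ψ) =
      ((a + i).descFactorial i : ℂ) • wordSum c fun p => ψ (Fin.append p u) := by
  induction i with
  | zero =>
    simp only [derivWord_zero, Nat.descFactorial_zero, Nat.cast_one, one_smul]
    congr 1
    funext p
    rw [Fin.append_right_nil _ _ rfl]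
    rfl
  | succ i ih =>
    have ih' := ih (ψ := fun p => ψ (Fin.snoc p (u (Fin.last i)))) (h.snoc _)
      (fun k p => h0 k _) (Fin.init u)
    rw [derivWord_succ, pderiv_wordSum (a := a + i) hc h (h0 _), map_smul]
    refine (congrArg _ ih').trans ?_
    rw [smul_smul, ← Nat.cast_mul, ← Nat.succ_descFactorial_succ]
    refine congrArg _ (congrArg _ (funext fun p => ?_))
    rw [← Fin.append_snoc, Fin.snoc_init_self]

lemma derivWord_wordSum_of_lt {c : ι → ι ⊕ ι} (hc : Function.Injective c) {a i : ℕ} (hi : a < i)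
    {ψ : (Fin a → ι) → 𝒫} (h : PermInvariant ψ)
    (h0 : ∀ k p, pderiv (c k) (ψ p) = 0) (u : Fin i → ι) :
    derivWord c u (wordSum c ψ) = 0 := by
  induction i generalizing a with
  | zero => omega
  | succ i ih =>
    rw [derivWord_succ]
    rcases a with _ | a
    · rw [pderiv_wordSum_zero (h0 _), map_zero]
    · rw [pderiv_wordSum hc h (h0 _), map_smul, ih (by omega) (h.snoc _) fun k p => h0 k _,
        smul_zero]

lemma derivWord_wordSum_of_ne {c c' : ι → ι ⊕ ι} (h : ∀ k l, c k ≠ c' l) {a i : ℕ}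
    (ψ : (Fin a → ι) → 𝒫) (u : Fin i → ι) :
    derivWord c' u (wordSum c ψ) = wordSum c fun p => derivWord c' u (ψ p) := by
  induction i generalizing ψ with
  | zero => rfl
  | succ i ih =>
    have : pderiv (c' (u (Fin.last i))) (wordSum c ψ) =
        wordSum c fun p => pderiv (c' (u (Fin.last i))) (ψ p) := by
      simp only [wordSum, map_sum, Derivation.leibniz, smul_eq_mul,
        pderiv_wordMonomial_of_ne (fun k => h k _), mul_zero, zero_add]
      exact sum_congr rfl fun p _ => mul_comm _ _
    rw [derivWord_succ, this, ih]
    rfl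

end Words

/-! ### Derivatives, products and pairings of kernel polynomials -/

section KernelPoly

variable {ι : Type*}

local notation "𝒫" => MvPolynomial (ι ⊕ ι) ℂ

/-- Symmetry in the variables of each kind. -/
def SymmFun {a b : ℕ} (φ : (Fin a → ι) × (Fin b → ι) → ℂ) : Prop :=
  ∀ (σ : Equiv.Perm (Fin a)) (τ : Equiv.Perm (Fin b)) (p : Fin a → ι) (q : Fin b → ι),
    φ (p ∘ σ, q ∘ τ) = φ (p, q)

/-- The array obtained by freezing the last variables of each kind. -/
def slice {a b a' b' i j : ℕ} (φ : (Fin a → ι) × (Fin b → ι) → ℂ) (ha : a' + i = a)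
    (hb : b' + j = b) (u : Fin i → ι) (v : Fin j → ι) : (Fin a' → ι) × (Fin b' → ι) → ℂ :=
  fun x => φ (Fin.append x.1 u ∘ Fin.cast ha.symm, Fin.append x.2 v ∘ Fin.cast hb.symm)

lemma append_comp_perm {a i : ℕ} (p : Fin a → ι) (u : Fin i → ι) (σ : Equiv.Perm (Fin a)) :
    Fin.append (p ∘ σ) u = Fin.append p u ∘
      ((finSumFinEquiv.symm.trans (Equiv.sumCongr σ (Equiv.refl _))).trans finSumFinEquiv :
        Equiv.Perm (Fin (a + i))) := by
  funext s
  refine Fin.addCases (fun s => ?_) (fun s => ?_) s <;> simp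

lemma SymmFun.slice {a b a' b' i j : ℕ} {φ : (Fin a → ι) × (Fin b → ι) → ℂ} (h : SymmFun φ)
    (ha : a' + i = a) (hb : b' + j = b) (u : Fin i → ι) (v : Fin j → ι) :
    SymmFun (slice φ ha hb u v) := by
  subst ha hb
  intro σ τ p q
  simp only [ComplexChaos.slice, Fin.cast_refl, Function.comp_id, append_comp_perm]
  exact h _ _ _ _

lemma SymmFun.permInvariant_snd {a b : ℕ} {φ : (Fin a → ι) × (Fin b → ι) → ℂ} (h : SymmFun φ)
    (p : Fin a → ι) : PermInvariant fun q => (C (φ (p, q)) : 𝒫) :=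
  fun τ q => congrArg C (h 1 τ p q)

variable [Fintype ι]

lemma SymmFun.permInvariant_fst {a b : ℕ} {φ : (Fin a → ι) × (Fin b → ι) → ℂ} (h : SymmFun φ) :
    PermInvariant fun p => (wordSum .inr fun q => C (φ (p, q)) : 𝒫) :=
  fun σ p => congrArg (wordSum .inr) (funext fun q => congrArg C (h σ 1 p q))

/-- The polynomial with an array of coefficients. -/
def kernelPoly {a b : ℕ} : ((Fin a → ι) × (Fin b → ι) → ℂ) →ₗ[ℂ] 𝒫 :=
  Fintype.linearCombination ℂ fun x => wordMonomial .inl x.1 * wordMonomial .inr x.2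

lemma kernelPoly_apply {a b : ℕ} (φ : (Fin a → ι) × (Fin b → ι) → ℂ) :
    kernelPoly φ = ∑ x, φ x • (wordMonomial .inl x.1 * wordMonomial .inr x.2) := rfl

/-- The nested form regards the polynomial in the letters of the second kind as coefficients for
those of the first, so the results on words of one kind apply twice. -/
lemma kernelPoly_eq_wordSum {a b : ℕ} (φ : (Fin a → ι) × (Fin b → ι) → ℂ) :
    kernelPoly φ = wordSum .inl fun p => wordSum .inr fun q => C (φ (p, q)) := by
  rw [kernelPoly_apply, Fintype.sum_prod_type, wordSum]
  refine sum_congr rfl fun p _ => ?_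
  rw [wordSum, sum_mul]
  refine sum_congr rfl fun q _ => ?_
  rw [smul_eq_C_mul]
  ring

lemma totalDegree_kernelPoly {a b : ℕ} (φ : (Fin a → ι) × (Fin b → ι) → ℂ) :
    (kernelPoly φ).totalDegree ≤ a + b := by
  refine totalDegree_finsetSum_le fun x _ => (totalDegree_smul_le _ _).trans ?_
  exact (totalDegree_mul _ _).trans
    (add_le_add (totalDegree_wordMonomial _ _) (totalDegree_wordMonomial _ _))

lemma constantCoeff_kernelPoly_of_ne {a b : ℕ} (h : a ≠ 0 ∨ b ≠ 0)
    (φ : (Fin a → ι) × (Fin b → ι) → ℂ) : constantCoeff (kernelPoly φ) = 0 := by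
  rw [kernelPoly_apply, map_sum]
  refine sum_eq_zero fun x _ => ?_
  rw [smul_eq_C_mul, map_mul, map_mul]
  rcases h with h | h <;> simp [constantCoeff_wordMonomial _ h]

lemma kernelPoly_zero_zero (φ : (Fin 0 → ι) × (Fin 0 → ι) → ℂ) :
    kernelPoly φ = C (φ (Fin.elim0, Fin.elim0)) := by
  have : ∀ x : (Fin 0 → ι) × (Fin 0 → ι), x = (Fin.elim0, Fin.elim0) :=
    fun x => Subsingleton.elim _ _
  rw [kernelPoly_apply, Fintype.sum_eq_single (Fin.elim0, Fin.elim0) fun x hx => (hx (this x)).elim]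
  simp [smul_eq_C_mul]

lemma pderiv_inl_wordSum_inr {b : ℕ} (ψ : (Fin b → ι) → ℂ) (k : ι) :
    pderiv (.inl k) (wordSum .inr fun q => C (ψ q) : 𝒫) = 0 := by
  rw [wordSum, map_sum]
  refine sum_eq_zero fun q _ => ?_
  rw [Derivation.leibniz, pderiv_wordMonomial_of_ne (by simp)]
  simp

lemma derivWord_inr_kernelPoly {a b' j : ℕ} {φ : (Fin a → ι) × (Fin (b' + j) → ι) → ℂ}
    (h : SymmFun φ) (v : Fin j → ι) :
    derivWord .inr v (kernelPoly φ) =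
      ((b' + j).descFactorial j : ℂ) • kernelPoly fun x => φ (x.1, Fin.append x.2 v) := by
  rw [kernelPoly_eq_wordSum, derivWord_wordSum_of_ne (by simp), kernelPoly_eq_wordSum, wordSum,
    wordSum, smul_sum]
  refine sum_congr rfl fun p _ => ?_
  rw [derivWord_wordSum Sum.inr_injective, smul_mul_assoc]
  · exact h.permInvariant_snd p
  · simp

lemma derivWord_inl_kernelPoly {a' i b : ℕ} {φ : (Fin (a' + i) → ι) × (Fin b → ι) → ℂ}
    (h : SymmFun φ) (u : Fin i → ι) :
    derivWord .inl u (kernelPoly φ) =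
      ((a' + i).descFactorial i : ℂ) • kernelPoly fun x => φ (Fin.append x.1 u, x.2) := by
  rw [kernelPoly_eq_wordSum, derivWord_wordSum Sum.inl_injective, kernelPoly_eq_wordSum]
  · exact h.permInvariant_fst
  · intro k p
    exact pderiv_inl_wordSum_inr _ _

/-- Differentiating along words freezes the last variables of a symmetric kernel. The equations `ha`
and `hb` let the orders a and b stay fixed, so that later the free orders can be a - i and b - j. -/
lemma derivWord_kernelPoly {a b a' b' i j : ℕ} {φ : (Fin a → ι) × (Fin b → ι) → ℂ}
    (h : SymmFun φ) (ha : a' + i = a) (hb : b' + j = b) (u : Fin i → ι) (v : Fin j → ι) :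
    derivWord .inl u (derivWord .inr v (kernelPoly φ)) =
      ((a.descFactorial i : ℂ) * b.descFactorial j) • kernelPoly (slice φ ha hb u v) := by
  subst ha hb
  rw [derivWord_inr_kernelPoly h, map_smul, derivWord_inl_kernelPoly, smul_smul, mul_comm]
  · rfl
  · intro σ τ p q
    simp only [append_comp_perm]
    exact h _ _ _ _

lemma derivWord_kernelPoly_of_lt {a b i j : ℕ} {φ : (Fin a → ι) × (Fin b → ι) → ℂ}
    (h : SymmFun φ) (hab : a < i ∨ b < j) (u : Fin i → ι) (v : Fin j → ι) :
    derivWord .inl u (derivWord .inr v (kernelPoly φ)) = 0 := by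
  rcases hab with hi | hj
  · rw [derivWord_comm, kernelPoly_eq_wordSum, derivWord_wordSum_of_lt Sum.inl_injective hi,
      map_zero]
    · exact h.permInvariant_fst
    · intro k p
      exact pderiv_inl_wordSum_inr _ _
  · rw [kernelPoly_eq_wordSum, derivWord_wordSum_of_ne (by simp), wordSum, sum_eq_zero, map_zero]
    intro p _
    rw [derivWord_wordSum_of_lt Sum.inr_injective hj, zero_mul]
    · exact h.permInvariant_snd p
    · simp

lemma kernelPoly_mul {a b c d : ℕ} (φ : (Fin a → ι) × (Fin b → ι) → ℂ)
    (χ : (Fin c → ι) × (Fin d → ι) → ℂ) :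
    kernelPoly (fun x : (Fin (a + c) → ι) × (Fin (b + d) → ι) =>
        φ (x.1 ∘ Fin.castAdd c, x.2 ∘ Fin.castAdd d) *
          χ (x.1 ∘ Fin.natAdd a, x.2 ∘ Fin.natAdd b)) =
      kernelPoly φ * kernelPoly χ := by
  have h1 : ∀ {a c : ℕ} (p : Fin a → ι) (p' : Fin c → ι),
      Fin.append p p' ∘ Fin.castAdd c = p := fun p p' => funext fun s => by simp
  have h2 : ∀ {a c : ℕ} (p : Fin a → ι) (p' : Fin c → ι),
      Fin.append p p' ∘ Fin.natAdd a = p' := fun p p' => funext fun s => by simp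
  rw [kernelPoly_apply, kernelPoly_apply, kernelPoly_apply, Fintype.sum_prod_type,
    Fintype.sum_prod_type, Fintype.sum_prod_type, sum_append, sum_mul_sum]
  refine sum_congr rfl fun p _ => sum_congr rfl fun p' _ => ?_
  rw [sum_append, sum_mul_sum]
  refine sum_congr rfl fun q _ => sum_congr rfl fun q' _ => ?_
  simp only [h1, h2, wordMonomial_append, smul_eq_C_mul, C_mul]
  ring

lemma kernelPoly_permute {a b : ℕ} (σ : Equiv.Perm (Fin a)) (τ : Equiv.Perm (Fin b))
    (φ : (Fin a → ι) × (Fin b → ι) → ℂ) :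
    kernelPoly (fun x => φ (x.1 ∘ σ, x.2 ∘ τ)) = kernelPoly φ := by
  rw [kernelPoly_apply, kernelPoly_apply]
  refine Fintype.sum_equiv ((Equiv.arrowCongr σ.symm (Equiv.refl _)).prodCongr
    (Equiv.arrowCongr τ.symm (Equiv.refl _))) _ _ fun x => ?_
  have h : ∀ {a : ℕ} (σ : Equiv.Perm (Fin a)) (p : Fin a → ι),
      Equiv.arrowCongr σ.symm (Equiv.refl ι) p = p ∘ σ := fun σ p => rfl
  simp only [Equiv.prodCongr_apply, Prod.map, h, wordMonomial_comp_perm]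

omit [Fintype ι] in
lemma coe_permute {a b : ℕ} (σ : Equiv.Perm (Fin a)) (τ : Equiv.Perm (Fin b))
    (f : ChaosKernel ι a b) : ⇑(permute σ τ f) = fun x => f (x.1 ∘ σ, x.2 ∘ τ) := rfl

omit [Fintype ι] in
lemma coe_symmetrize {a b : ℕ} (f : ChaosKernel ι a b) :
    ⇑(symmetrize f) = ((a.factorial * b.factorial : ℕ) : ℂ)⁻¹ •
      ∑ σ : Equiv.Perm (Fin a), ∑ τ : Equiv.Perm (Fin b), fun x => f (x.1 ∘ σ, x.2 ∘ τ) := by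
  simp only [symmetrize, lp.coeFn_smul, lp.coeFn_sum, coe_permute]

/-- Commuting letters forget their order, so all permuted kernels have the same polynomial.
Symmetrization is thus invisible to integrals, although it changes norms. -/
lemma kernelPoly_symmetrize {a b : ℕ} (f : ChaosKernel ι a b) :
    kernelPoly ⇑(symmetrize f) = kernelPoly ⇑f := by
  have h : ((a.factorial * b.factorial : ℕ) : ℂ) ≠ 0 := by
    exact_mod_cast (Nat.mul_pos a.factorial_pos b.factorial_pos).ne'
  rw [coe_symmetrize, map_smul, map_sum]
  simp only [map_sum, kernelPoly_permute]
  rw [sum_const, sum_const, card_univ, card_univ, Fintype.card_perm, Fintype.card_perm,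
    Fintype.card_fin, Fintype.card_fin, smul_smul, ← Nat.cast_smul_eq_nsmul ℂ,
    inv_smul_smul₀ h]

omit [Fintype ι] in
lemma isSymmetric_symmetrize {a b : ℕ} (f : ChaosKernel ι a b) : IsSymmetric (symmetrize f) := by
  intro σ τ p q
  simp only [coe_symmetrize, Pi.smul_apply, Finset.sum_apply]
  congr 1
  refine Fintype.sum_equiv (Equiv.mulLeft σ) _ _ fun σ' => ?_
  exact Fintype.sum_equiv (Equiv.mulLeft τ) _ _ fun τ' => rfl

omit [Fintype ι] in
lemma coe_contraction {a b c d i j : ℕ} (f : ChaosKernel ι a b) (g : ChaosKernel ι c d)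
    (h : (i ≤ a ∧ i ≤ d) ∧ (j ≤ b ∧ j ≤ c)) : ⇑(contraction f g i j) = fun x =>
      ∑' w : (Fin i → ι) × (Fin j → ι),
        slice f (Nat.sub_add_cancel h.1.1) (Nat.sub_add_cancel h.2.1) w.1 w.2
            (x.1 ∘ Fin.castAdd _, x.2 ∘ Fin.castAdd _) *
          slice g (Nat.sub_add_cancel h.2.2) (Nat.sub_add_cancel h.1.2) w.2 w.1
            (x.1 ∘ Fin.natAdd _, x.2 ∘ Fin.natAdd _) := by
  rw [contraction, dif_pos h]
  rfl

lemma kernelPoly_contraction {a b c d i j : ℕ} (f : ChaosKernel ι a b) (g : ChaosKernel ι c d)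
    (h : (i ≤ a ∧ i ≤ d) ∧ (j ≤ b ∧ j ≤ c)) :
    kernelPoly ⇑(contraction f g i j) = ∑ u : Fin i → ι, ∑ v : Fin j → ι,
      kernelPoly (slice f (Nat.sub_add_cancel h.1.1) (Nat.sub_add_cancel h.2.1) u v) *
        kernelPoly (slice g (Nat.sub_add_cancel h.2.2) (Nat.sub_add_cancel h.1.2) v u) := by
  simp only [← kernelPoly_mul]
  rw [coe_contraction f g h]
  simp only [tsum_fintype, Fintype.sum_prod_type, ← map_sum]
  congr 1
  funext x
  simp only [Finset.sum_apply]

omit [Fintype ι] in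
lemma contraction_of_not {a b c d i j : ℕ} (f : ChaosKernel ι a b) (g : ChaosKernel ι c d)
    (h : ¬((i ≤ a ∧ i ≤ d) ∧ (j ≤ b ∧ j ≤ c))) : contraction f g i j = 0 := by
  rw [contraction, dif_neg h]

/-- The derivatives freeze `u` and `v` in both kernels, and summing over these words is the
contraction. Outside the admissible range one kernel is differentiated too often, in agreement with
the default value 0 of `contraction`. -/
lemma mulTensor_contract_kernelPoly {a b c d : ℕ} {f : ChaosKernel ι a b} {g : ChaosKernel ι c d}
    (hf : IsSymmetric f) (hg : IsSymmetric g) (i j : ℕ) :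
    mulTensor ((contractX ^ i * contractY ^ j : Module.End ℂ (𝒫 ⊗[ℂ] 𝒫))
        (kernelPoly ⇑f ⊗ₜ[ℂ] kernelPoly ⇑g)) =
      ((a.descFactorial i : ℂ) * b.descFactorial j * c.descFactorial j * d.descFactorial i) •
        kernelPoly ⇑(contraction f g i j) := by
  rw [contractX_pow_mul_contractY_pow, map_sum]
  simp only [map_sum, LinearMap.mul'_apply]
  by_cases h : (i ≤ a ∧ i ≤ d) ∧ (j ≤ b ∧ j ≤ c)
  · rw [kernelPoly_contraction f g h, smul_sum]
    refine sum_congr rfl fun u _ => ?_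
    rw [smul_sum]
    refine sum_congr rfl fun v _ => ?_
    rw [derivWord_kernelPoly hf (Nat.sub_add_cancel h.1.1) (Nat.sub_add_cancel h.2.1),
      derivWord_kernelPoly hg (Nat.sub_add_cancel h.2.2) (Nat.sub_add_cancel h.1.2),
      smul_mul_smul_comm]
    congr 1
    ring
  · have h' : (a < i ∨ b < j) ∨ (c < j ∨ d < i) := by omega
    rw [contraction_of_not f g h, lp.coeFn_zero, map_zero, smul_zero]
    refine sum_eq_zero fun u _ => sum_eq_zero fun v _ => ?_
    rcases h' with h' | h'
    · rw [derivWord_kernelPoly_of_lt hf h', zero_mul]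
    · rw [derivWord_kernelPoly_of_lt hg h', mul_zero]

lemma kernelPoly_toOrder {a b m n : ℕ} (ha : a = m) (hb : b = n) (f : ChaosKernel ι a b) :
    kernelPoly ⇑(toOrder m n f) = kernelPoly ⇑f := by
  subst ha hb
  rw [toOrder, dif_pos ⟨rfl, rfl⟩]
  rfl

omit [Fintype ι] in
lemma isSymmetric_toOrder {a b m n : ℕ} {f : ChaosKernel ι a b} (hf : IsSymmetric f) :
    IsSymmetric (toOrder m n f) := by
  unfold toOrder
  split_ifs with h
  · obtain ⟨rfl, rfl⟩ := h
    exact hf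
  · intro σ τ p q
    simp

omit [Fintype ι] in
lemma isSymmetric_sum_smul {κ : Type*} (s : Finset κ) (c : κ → ℂ) {a b : ℕ}
    {f : κ → ChaosKernel ι a b} (hf : ∀ k ∈ s, IsSymmetric (f k)) :
    IsSymmetric (∑ k ∈ s, c k • f k) := by
  intro σ τ p q
  simp only [lp.coeFn_sum, lp.coeFn_smul, Finset.sum_apply, Pi.smul_apply]
  exact sum_congr rfl fun k hk => by rw [hf k hk]

omit [Fintype ι] in
lemma isSymmetric_revConj {a b : ℕ} {f : ChaosKernel ι a b} (hf : IsSymmetric f) :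
    IsSymmetric (revConj f) := by
  intro σ τ p q
  exact congrArg conj (hf τ σ q p)

omit [Fintype ι] in
@[simp] lemma revConj_revConj {a b : ℕ} (f : ChaosKernel ι a b) : revConj (revConj f) = f := by
  ext x
  exact Complex.conj_conj _

variable [DecidableEq ι]

lemma pairing_wordMonomial_mul {c c' : ι → ι ⊕ ι} (h : ∀ k, (c k).swap = c' k) {a : ℕ}
    (p : Fin a → ι) (A B : 𝒫) :
    pairing (wordMonomial c p * A) B = pairing A (derivWord c' p B) := by
  induction a generalizing A with
  | zero => simp
  | succ a ih =>
    rw [← Fin.snoc_init_self p, wordMonomial_snoc, mul_assoc, ih, pairing_X_mul, derivWord_snoc,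
      derivWord_pderiv, h]

/-- All letters move to the other side as derivatives, which leaves the pairing with 1. -/
lemma pairing_wordMonomial {a b : ℕ} (p : Fin a → ι) (q : Fin b → ι) (B : 𝒫) :
    pairing (wordMonomial .inl p * wordMonomial .inr q) B =
      constantCoeff (derivWord .inl q (derivWord .inr p B)) := by
  rw [pairing_wordMonomial_mul (c' := .inr) (by simp), ← mul_one (wordMonomial .inr q),
    pairing_wordMonomial_mul (c' := .inl) (by simp), pairing_one]

/-- Orthogonality of integrals of different orders: after as many derivatives as `φ` has letters,
`χ` is zero or still has positive degree in some kind. -/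
lemma pairing_kernelPoly_of_ne {a b c d : ℕ} (h : a ≠ d ∨ b ≠ c)
    (φ : (Fin a → ι) × (Fin b → ι) → ℂ) {χ : (Fin c → ι) × (Fin d → ι) → ℂ} (hχ : SymmFun χ) :
    pairing (kernelPoly φ) (kernelPoly χ) = 0 := by
  rw [kernelPoly_apply, map_sum, LinearMap.sum_apply]
  refine sum_eq_zero fun x _ => ?_
  rw [map_smul, LinearMap.smul_apply, pairing_wordMonomial]
  by_cases hle : b ≤ c ∧ a ≤ d
  · rw [derivWord_kernelPoly hχ (Nat.sub_add_cancel hle.1) (Nat.sub_add_cancel hle.2),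
      smul_eq_C_mul, map_mul, constantCoeff_kernelPoly_of_ne (by omega)]
    simp
  · rw [derivWord_kernelPoly_of_lt hχ (by omega)]
    simp

lemma pairing_kernelPoly {a b : ℕ} (φ : (Fin a → ι) × (Fin b → ι) → ℂ)
    {χ : (Fin b → ι) × (Fin a → ι) → ℂ} (hχ : SymmFun χ) :
    pairing (kernelPoly φ) (kernelPoly χ) =
      (a.factorial * b.factorial) * ∑ x, φ x * χ (x.2, x.1) := by
  rw [kernelPoly_apply, map_sum, LinearMap.sum_apply, mul_sum]
  refine sum_congr rfl fun x _ => ?_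
  rw [map_smul, LinearMap.smul_apply, pairing_wordMonomial,
    derivWord_kernelPoly hχ (zero_add _) (zero_add _), kernelPoly_zero_zero, smul_eq_C_mul,
    map_mul, constantCoeff_C, constantCoeff_C, Nat.descFactorial_self, Nat.descFactorial_self]
  have : slice χ (zero_add _) (zero_add _) x.2 x.1 (Fin.elim0, Fin.elim0) = χ (x.2, x.1) := by
    simp only [slice, Fin.elim0_append]
    rfl
  rw [this, smul_eq_mul]
  ring

omit [DecidableEq ι] in
lemma inner_eq_sum {a b : ℕ} (f g : ChaosKernel ι a b) :
    inner ℂ f g = ∑ x, conj (f x) * g x := by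
  rw [lp.inner_eq_tsum, tsum_fintype]
  exact sum_congr rfl fun x _ => by rw [RCLike.inner_apply, mul_comm]

/-- The reversed conjugate supplies the conjugation that the bilinear pairing lacks; for g = f this
is the isometry of the multiple integral. -/
lemma pairing_kernelPoly_revConj {a b : ℕ} (f : ChaosKernel ι a b) {g : ChaosKernel ι a b}
    (hg : IsSymmetric g) :
    pairing (kernelPoly ⇑f) (kernelPoly ⇑(revConj g)) =
      (a.factorial * b.factorial) * inner ℂ g f := by
  rw [pairing_kernelPoly _ (isSymmetric_revConj hg), inner_eq_sum]
  congr 1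
  exact sum_congr rfl fun x _ => mul_comm _ _

end KernelPoly

/-! ### Wick pairing of products and norms of contractions -/

section ContractionNorm

variable {ι : Type*} [Fintype ι]

local notation "𝒫" => MvPolynomial (ι ⊕ ι) ℂ

-- An exchange of sums: pairing the Gram matrices of F and G gives the Hilbert–Schmidt norm of the
-- array contracted over w.
omit [Fintype ι] in
lemma sum_gram_mul_gram {W X Y : Type*} [Fintype W] [Fintype X] [Fintype Y] (F : W → Y → ℂ)
    (G : W → X → ℂ) :
    ∑ w, ∑ w', (∑ x, G w' x * conj (G w x)) * (∑ y, F w y * conj (F w' y)) =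
      ∑ y, ∑ x, (∑ w, F w y * conj (G w x)) * conj (∑ w, F w y * conj (G w x)) := by
  simp only [map_sum, sum_mul_sum, map_mul, Complex.conj_conj]
  have h1 : ∀ w, ∑ w', ∑ x, ∑ y, G w' x * conj (G w x) * (F w y * conj (F w' y)) =
      ∑ y, ∑ x, ∑ w', F w y * conj (G w x) * (conj (F w' y) * G w' x) := by
    intro w
    rw [sum_comm]
    simp only [sum_comm (s := univ (α := W)) (t := univ (α := Y))]
    rw [sum_comm]
    exact sum_congr rfl fun y _ => sum_congr rfl fun x _ => sum_congr rfl fun w' _ => by ring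
  rw [sum_congr rfl fun w _ => h1 w, sum_comm]
  exact sum_congr rfl fun y _ => sum_comm

/-- The free variables of `g` are listed in reversed order so that, when `g` is a reversed
conjugate, the sum has the shape of `sum_gram_mul_gram`. -/
lemma norm_sq_contraction {a b c d i j : ℕ} (f : ChaosKernel ι a b) (g : ChaosKernel ι c d)
    (h : (i ≤ a ∧ i ≤ d) ∧ (j ≤ b ∧ j ≤ c)) :
    ((‖contraction f g i j‖ ^ 2 : ℝ) : ℂ) =
      ∑ y, ∑ x : (Fin (d - i) → ι) × (Fin (c - j) → ι),
        (∑ w : (Fin i → ι) × (Fin j → ι),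
          slice f (Nat.sub_add_cancel h.1.1) (Nat.sub_add_cancel h.2.1) w.1 w.2 y *
          slice g (Nat.sub_add_cancel h.2.2) (Nat.sub_add_cancel h.1.2) w.2 w.1 (x.2, x.1)) *
        conj (∑ w : (Fin i → ι) × (Fin j → ι),
          slice f (Nat.sub_add_cancel h.1.1) (Nat.sub_add_cancel h.2.1) w.1 w.2 y *
          slice g (Nat.sub_add_cancel h.2.2) (Nat.sub_add_cancel h.1.2) w.2 w.1 (x.2, x.1)) := by
  have h1 : ∀ {a c : ℕ} (p : Fin a → ι) (p' : Fin c → ι),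
      Fin.append p p' ∘ Fin.castAdd c = p := fun p p' => funext fun s => by simp
  have h2 : ∀ {a c : ℕ} (p : Fin a → ι) (p' : Fin c → ι),
      Fin.append p p' ∘ Fin.natAdd a = p' := fun p p' => funext fun s => by simp
  have h3 : ((‖contraction f g i j‖ ^ 2 : ℝ) : ℂ) =
      ∑ z, contraction f g i j z * conj (contraction f g i j z) := by
    have := inner_self_eq_norm_sq_to_K (𝕜 := ℂ) (contraction f g i j)
    rw [inner_eq_sum] at this
    push_cast
    rw [← Complex.coe_algebraMap] at *
    rw [← this]
    exact sum_congr rfl fun z _ => mul_comm _ _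
  rw [h3, coe_contraction f g h]
  simp only [tsum_fintype]
  rw [Fintype.sum_prod_type, sum_append, Fintype.sum_prod_type]
  refine sum_congr rfl fun p _ => ?_
  simp only [sum_append, h1, h2]
  rw [sum_comm]
  refine sum_congr rfl fun q _ => ?_
  rw [Fintype.sum_prod_type, sum_comm]

/-- Groups the terms by i + j. More than a or b derivatives of one kind kill the kernel, so only the
box survives and the truncation level no longer matters. -/
lemma contractExp_kernelPoly {a b : ℕ} {f : ChaosKernel ι a b} (hf : IsSymmetric f) {N : ℕ}
    (hN : a + b ≤ N) (B : 𝒫) :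
    contractExp N (kernelPoly ⇑f ⊗ₜ[ℂ] B) =
      ∑ x ∈ range (a + 1) ×ˢ range (b + 1),
        ((x.1.factorial : ℂ) * x.2.factorial)⁻¹ •
          (contractX ^ x.1 * contractY ^ x.2 : Module.End ℂ (𝒫 ⊗[ℂ] 𝒫))
            (kernelPoly ⇑f ⊗ₜ[ℂ] B) := by
  have hmaps : ∀ x ∈ range (a + 1) ×ˢ range (b + 1), x.1 + x.2 ∈ range (N + 1) := by
    intro x hx
    simp only [mem_product, mem_range] at hx ⊢
    omega
  rw [← sum_fiberwise_of_maps_to hmaps, contractExp, LinearMap.sum_apply]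
  refine sum_congr rfl fun r _ => ?_
  rw [inv_factorial_smul_contract_pow, LinearMap.sum_apply]
  refine (sum_subset ?_ fun x hx hx' => ?_).symm
  · intro x hx
    exact HasAntidiagonal.mem_antidiagonal.2 (mem_filter.1 hx).2
  · have hlt : a < x.1 ∨ b < x.2 := by
      by_contra hcon
      refine hx' (mem_filter.2 ⟨?_, HasAntidiagonal.mem_antidiagonal.1 hx⟩)
      simp only [mem_product, mem_range]
      omega
    rw [LinearMap.smul_apply, contractX_pow_mul_contractY_pow, sum_eq_zero, smul_zero]
    refine fun u _ => sum_eq_zero fun v _ => ?_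
    rw [derivWord_kernelPoly_of_lt hf hlt, TensorProduct.zero_tmul]

variable [DecidableEq ι]

/-- The factor left of `f` has order (a-i, b-j) and the factor left of its reversed conjugate has
order (b-l, a-k); orthogonality requires k = i and l = j. -/
lemma crossPairing_contract_of_ne {a b c d i j k l : ℕ} {f : ChaosKernel ι a b}
    (hf : IsSymmetric f) {g : ChaosKernel ι c d} (hi : i ≤ a) (hj : j ≤ b)
    (hne : (k, l) ≠ (i, j)) :
    crossPairing ((contractX ^ i * contractY ^ j : Module.End ℂ (𝒫 ⊗[ℂ] 𝒫))
        (kernelPoly ⇑f ⊗ₜ[ℂ] kernelPoly ⇑(revConj g)))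
      ((contractX ^ k * contractY ^ l : Module.End ℂ (𝒫 ⊗[ℂ] 𝒫))
        (kernelPoly ⇑g ⊗ₜ[ℂ] kernelPoly ⇑(revConj f))) = 0 := by
  rw [contractX_pow_mul_contractY_pow, contractX_pow_mul_contractY_pow]
  simp only [map_sum, LinearMap.sum_apply, crossPairing_tmul]
  refine sum_eq_zero fun u _ => sum_eq_zero fun v _ => sum_eq_zero fun u' _ =>
    sum_eq_zero fun v' _ => ?_
  convert mul_zero _
  by_cases h : k ≤ a ∧ l ≤ b
  · rw [derivWord_kernelPoly hf (Nat.sub_add_cancel hi) (Nat.sub_add_cancel hj),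
      derivWord_kernelPoly (isSymmetric_revConj hf) (Nat.sub_add_cancel h.2)
        (Nat.sub_add_cancel h.1), map_smul, map_smul, LinearMap.smul_apply,
      pairing_kernelPoly_of_ne _ _ (SymmFun.slice (isSymmetric_revConj hf) _ _ _ _)]
    · simp
    · have : ¬(k = i ∧ l = j) := fun h => hne (Prod.ext h.1 h.2)
      omega
  · rw [derivWord_kernelPoly_of_lt (isSymmetric_revConj hf) (by omega), map_zero]

/-- For fixed contracted words the two pairings are entries of the Gram matrices of the slices of
`f` and `g`. Their sum over all words is the norm of a contraction by `sum_gram_mul_gram`. -/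
lemma crossPairing_contract {a b c d i j : ℕ} {f : ChaosKernel ι a b}
    (hf : IsSymmetric f) {g : ChaosKernel ι c d} (hg : IsSymmetric g)
    (h : (i ≤ a ∧ i ≤ c) ∧ (j ≤ b ∧ j ≤ d)) :
    crossPairing ((contractX ^ i * contractY ^ j : Module.End ℂ (𝒫 ⊗[ℂ] 𝒫))
        (kernelPoly ⇑f ⊗ₜ[ℂ] kernelPoly ⇑(revConj g)))
      ((contractX ^ i * contractY ^ j : Module.End ℂ (𝒫 ⊗[ℂ] 𝒫))
        (kernelPoly ⇑g ⊗ₜ[ℂ] kernelPoly ⇑(revConj f))) =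
      (a.factorial * b.factorial * c.factorial * d.factorial) *
        (a.descFactorial i * b.descFactorial j * c.descFactorial i * d.descFactorial j) *
        ((‖contraction f (revConj g) i j‖ ^ 2 : ℝ) : ℂ) := by
  rw [contractX_pow_mul_contractY_pow, contractX_pow_mul_contractY_pow]
  simp only [map_sum, LinearMap.sum_apply, crossPairing_tmul]
  have hterm : ∀ (u : Fin i → ι) (v : Fin j → ι) (u' : Fin i → ι) (v' : Fin j → ι),
      pairing (derivWord .inl u' (derivWord .inr v' (kernelPoly ⇑g)))
          (derivWord .inl v (derivWord .inr u (kernelPoly ⇑(revConj g)))) *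
        pairing (derivWord .inl u (derivWord .inr v (kernelPoly ⇑f)))
          (derivWord .inl v' (derivWord .inr u' (kernelPoly ⇑(revConj f)))) =
      (a.factorial * b.factorial * c.factorial * d.factorial) *
        (a.descFactorial i * b.descFactorial j * c.descFactorial i * d.descFactorial j) *
      ((∑ x, slice g (Nat.sub_add_cancel h.1.2) (Nat.sub_add_cancel h.2.2) u' v' x *
          conj (slice g (Nat.sub_add_cancel h.1.2) (Nat.sub_add_cancel h.2.2) u v x)) *
        (∑ y, slice f (Nat.sub_add_cancel h.1.1) (Nat.sub_add_cancel h.2.1) u v y *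
          conj (slice f (Nat.sub_add_cancel h.1.1) (Nat.sub_add_cancel h.2.1) u' v' y))) := by
    intro u v u' v'
    rw [derivWord_kernelPoly hf (Nat.sub_add_cancel h.1.1) (Nat.sub_add_cancel h.2.1),
      derivWord_kernelPoly hg (Nat.sub_add_cancel h.1.2) (Nat.sub_add_cancel h.2.2),
      derivWord_kernelPoly (isSymmetric_revConj hf) (Nat.sub_add_cancel h.2.1)
        (Nat.sub_add_cancel h.1.1),
      derivWord_kernelPoly (isSymmetric_revConj hg) (Nat.sub_add_cancel h.2.2)
        (Nat.sub_add_cancel h.1.2)]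
    simp only [map_smul, LinearMap.smul_apply, smul_eq_mul]
    rw [pairing_kernelPoly _ (SymmFun.slice (isSymmetric_revConj hg) _ _ _ _),
      pairing_kernelPoly _ (SymmFun.slice (isSymmetric_revConj hf) _ _ _ _)]
    -- Each descending factorial occurs twice, from a kernel and from its reversed conjugate; one
    -- copy completes the (n-k)! of the pairing to n!.
    have e : ∀ {n k : ℕ}, k ≤ n →
        (n.factorial : ℂ) = (n - k).factorial * n.descFactorial k := by
      intro n k hk
      exact_mod_cast (Nat.factorial_mul_descFactorial hk).symm
    rw [e h.1.1, e h.2.1, e h.1.2, e h.2.2]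
    have e1 : ∀ x, slice ⇑(revConj g) (Nat.sub_add_cancel h.2.2) (Nat.sub_add_cancel h.1.2) v u
        (x.2, x.1) = conj (slice g (Nat.sub_add_cancel h.1.2) (Nat.sub_add_cancel h.2.2) u v x) :=
      fun x => rfl
    have e2 : ∀ x, slice ⇑(revConj f) (Nat.sub_add_cancel h.2.1) (Nat.sub_add_cancel h.1.1) v' u'
        (x.2, x.1) = conj (slice f (Nat.sub_add_cancel h.1.1) (Nat.sub_add_cancel h.2.1) u' v' x) :=
      fun x => rfl
    simp only [e1, e2]
    ring
  simp only [hterm, ← mul_sum]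
  congr 1
  rw [norm_sq_contraction f (revConj g) ⟨⟨h.1.1, h.1.2⟩, h.2.1, h.2.2⟩]
  have := sum_gram_mul_gram
    (fun w : (Fin i → ι) × (Fin j → ι) =>
      slice f (Nat.sub_add_cancel h.1.1) (Nat.sub_add_cancel h.2.1) w.1 w.2)
    (fun w : (Fin i → ι) × (Fin j → ι) =>
      slice g (Nat.sub_add_cancel h.1.2) (Nat.sub_add_cancel h.2.2) w.1 w.2)
  rw [sum_comm] at this
  refine Eq.trans ?_ this
  simp only [Fintype.sum_prod_type]

/-- The norm of the symmetrized tensor product of symmetric kernels, in terms of the norms of the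
contractions. -/
theorem pairing_mul_kernelPoly {a b c d : ℕ} {f : ChaosKernel ι a b}
    (hf : IsSymmetric f) {g : ChaosKernel ι c d} (hg : IsSymmetric g) :
    pairing (kernelPoly ⇑f * kernelPoly ⇑g)
        (kernelPoly ⇑(revConj g) * kernelPoly ⇑(revConj f)) =
      ∑ x ∈ range (a + 1) ×ˢ range (b + 1),
        (a.choose x.1 * c.choose x.1 * b.choose x.2 * d.choose x.2 *
          (a.factorial * b.factorial * c.factorial * d.factorial) *
          ((‖contraction f (revConj g) x.1 x.2‖ ^ 2 : ℝ) : ℂ)) := by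
  rw [pairing_mul_mul (totalDegree_kernelPoly _) (totalDegree_kernelPoly _),
    contractExp_kernelPoly hf le_rfl, contractExp_kernelPoly hg le_rfl]
  simp only [map_sum, LinearMap.sum_apply, map_smul, LinearMap.smul_apply, smul_sum]
  rw [sum_comm]
  refine sum_congr rfl fun x hx => ?_
  simp only [mem_product, mem_range] at hx
  -- The double sum over contraction orders reduces to its diagonal.
  have hne : ∀ y : ℕ × ℕ, y ≠ x → crossPairing
      ((contractX ^ x.1 * contractY ^ x.2 : Module.End ℂ (𝒫 ⊗[ℂ] 𝒫))
        (kernelPoly ⇑f ⊗ₜ[ℂ] kernelPoly ⇑(revConj g)))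
      ((contractX ^ y.1 * contractY ^ y.2 : Module.End ℂ (𝒫 ⊗[ℂ] 𝒫))
        (kernelPoly ⇑g ⊗ₜ[ℂ] kernelPoly ⇑(revConj f))) = 0 :=
    fun y hy => crossPairing_contract_of_ne hf (by omega) (by omega) hy
  by_cases h : x.1 ≤ c ∧ x.2 ≤ d
  · rw [sum_eq_single x]
    · rw [crossPairing_contract hf hg ⟨⟨by omega, h.1⟩, by omega, h.2⟩]
      have h1 : (x.1.factorial : ℂ) ≠ 0 := by exact_mod_cast x.1.factorial_ne_zero
      have h2 : (x.2.factorial : ℂ) ≠ 0 := by exact_mod_cast x.2.factorial_ne_zero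
      simp only [Nat.descFactorial_eq_factorial_mul_choose, smul_eq_mul]
      push_cast
      field_simp
    · intro y _ hy
      rw [hne y hy, smul_zero, smul_zero]
    · intro hx'
      simp only [mem_product, mem_range] at hx'
      omega
  · rw [sum_eq_zero]
    · have : c.choose x.1 = 0 ∨ d.choose x.2 = 0 := by
        rcases not_and_or.1 h with h | h
        · exact Or.inl (Nat.choose_eq_zero_of_lt (by omega))
        · exact Or.inr (Nat.choose_eq_zero_of_lt (by omega))
      rcases this with h | h <;> simp [h]
    · intro y hy
      rw [hne y, smul_zero, smul_zero]
      rintro rfl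
      simp only [mem_product, mem_range] at hy
      omega

end ContractionNorm

/-! ### The product formula for kernels and the integration by parts formula -/

section ProductFormula

variable {ι : Type*} [Fintype ι]

local notation "𝒫" => MvPolynomial (ι ⊕ ι) ℂ

/-- The coefficient of `f ⊗_{i,j} g` in the product formula, for `f` of order `(a, b)` and `g` of
order `(c, d)`. -/
def productCoeff (a b c d : ℕ) (x : ℕ × ℕ) : ℂ :=
  a.choose x.1 * d.choose x.1 * b.choose x.2 * c.choose x.2 * x.1.factorial * x.2.factorial

lemma productCoeff_eq (a b c d : ℕ) (x : ℕ × ℕ) :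
    productCoeff a b c d x = ((x.1.factorial : ℂ) * (x.2.factorial : ℂ))⁻¹ *
      ((a.descFactorial x.1 : ℂ) * b.descFactorial x.2 * c.descFactorial x.2
        * d.descFactorial x.1) := by
  have h1 : (x.1.factorial : ℂ) ≠ 0 := by exact_mod_cast x.1.factorial_ne_zero
  have h2 : (x.2.factorial : ℂ) ≠ 0 := by exact_mod_cast x.2.factorial_ne_zero
  simp only [productCoeff, Nat.descFactorial_eq_factorial_mul_choose]
  push_cast
  field_simp

lemma productCoeff_eq_zero {a b c d : ℕ} {x : ℕ × ℕ}
    (h : ¬((x.1 ≤ a ∧ x.1 ≤ d) ∧ (x.2 ≤ b ∧ x.2 ≤ c))) : productCoeff a b c d x = 0 := by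
  have : a.choose x.1 = 0 ∨ d.choose x.1 = 0 ∨ b.choose x.2 = 0 ∨ c.choose x.2 = 0 := by
    simp only [Nat.choose_eq_zero_iff]
    omega
  rcases this with h | h | h | h <;> simp [productCoeff, h]

lemma inv_smul_mulTensor_contract {a b c d : ℕ} {f : ChaosKernel ι a b} {g : ChaosKernel ι c d}
    (hf : IsSymmetric f) (hg : IsSymmetric g) (x : ℕ × ℕ) :
    ((x.1.factorial : ℂ) * (x.2.factorial : ℂ))⁻¹ •
      mulTensor ((contractX ^ x.1 * contractY ^ x.2 : Module.End ℂ (𝒫 ⊗[ℂ] 𝒫))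
        (kernelPoly ⇑f ⊗ₜ[ℂ] kernelPoly ⇑g)) =
      productCoeff a b c d x • kernelPoly ⇑(contraction f g x.1 x.2) := by
  rw [mulTensor_contract_kernelPoly hf hg, smul_smul, productCoeff_eq]

lemma sum_range_antidiagonal_of_le {M : Type*} [AddCommMonoid M] {R N : ℕ} (hRN : R ≤ N)
    {G : ℕ × ℕ → M} (h : ∀ x, R ≤ x.1 + x.2 → G x = 0) :
    ∑ r ∈ range N, ∑ x ∈ antidiagonal r, G x = ∑ r ∈ range R, ∑ x ∈ antidiagonal r, G x := by
  refine (sum_subset (range_mono hRN) fun r _ hr => sum_eq_zero fun x hx => h x ?_).symm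
  rw [HasAntidiagonal.mem_antidiagonal.1 hx]
  simpa using hr

/-- Raising i by one turns 1/i! into (i+1)/(i+1)!. This is the source of the weight i in ϑ_r and
ς_r. -/
lemma contractExp_mul_contractX (N : ℕ) :
    (contractExp N * contractX : Module.End ℂ (𝒫 ⊗[ℂ] 𝒫)) =
      ∑ r ∈ range (N + 2), ∑ x ∈ antidiagonal r,
        ((x.1 : ℂ) * ((x.1.factorial : ℂ) * (x.2.factorial : ℂ))⁻¹) •
          (contractX ^ x.1 * contractY ^ x.2) := by
  rw [sum_range_succ', contractExp, sum_mul]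
  simp only [HasAntidiagonal.antidiagonal_zero, sum_singleton, Nat.cast_zero, zero_mul, zero_smul,
    add_zero]
  refine sum_congr rfl fun r _ => ?_
  rw [inv_factorial_smul_contract_pow, sum_mul, Nat.antidiagonal_succ, sum_cons, sum_map]
  simp only [Nat.cast_zero, zero_mul, zero_smul, zero_add]
  refine sum_congr rfl fun x _ => ?_
  simp only [Function.Embedding.prodMap, Function.Embedding.coeFn_mk, Prod.map,
    Function.Embedding.refl_apply, Nat.succ_eq_add_one]
  rw [smul_mul_assoc, mul_assoc, ← (contractX_commute_contractY.pow_right x.2).eq, ← mul_assoc,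
    ← pow_succ]
  congr 1
  have h1 : (x.1.factorial : ℂ) ≠ 0 := by exact_mod_cast x.1.factorial_ne_zero
  have h2 : (x.2.factorial : ℂ) ≠ 0 := by exact_mod_cast x.2.factorial_ne_zero
  have h3 : ((x.1 : ℂ) + 1) ≠ 0 := by exact_mod_cast x.1.succ_ne_zero
  rw [Nat.factorial_succ]
  push_cast
  field_simp

/-- The orders need to match only where the coefficient is non-zero: the other terms contribute zero
to both sides, whatever `toOrder` makes of them. -/
lemma kernelPoly_sum_toOrder {κ : Type*} (s : Finset κ) (c : κ → ℂ) {a b : κ → ℕ} {m n : ℕ}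
    (f : ∀ k, ChaosKernel ι (a k) (b k)) (h : ∀ k ∈ s, c k ≠ 0 → a k = m ∧ b k = n) :
    kernelPoly ⇑(∑ k ∈ s, c k • toOrder m n (symmetrize (f k))) =
      ∑ k ∈ s, c k • kernelPoly ⇑(f k) := by
  rw [lp.coeFn_sum, map_sum]
  refine sum_congr rfl fun k hk => ?_
  rw [lp.coeFn_smul, map_smul]
  by_cases hc : c k = 0
  · rw [hc, zero_smul, zero_smul]
  · rw [kernelPoly_toOrder (h k hk hc).1 (h k hk hc).2, kernelPoly_symmetrize]

section Kernels

variable {m n : ℕ} (f : ChaosKernel ι m n) {r : ℕ}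

lemma kernelPoly_psi (hr : r ≤ m + n) : kernelPoly ⇑(psi f r) =
    ∑ x ∈ antidiagonal r, productCoeff m n n m x •
      kernelPoly ⇑(contraction f (revConj f) x.1 x.2) := by
  rw [psi, kernelPoly_sum_toOrder _ _ fun x : ℕ × ℕ => contraction f (revConj f) x.1 x.2]
  · refine sum_congr rfl fun x _ => ?_
    congr 1
    rw [productCoeff]
    ring
  · intro x hx hc
    rw [HasAntidiagonal.mem_antidiagonal] at hx
    have h1 : x.1 ≤ m := by
      by_contra h
      exact hc (by simp [Nat.choose_eq_zero_of_lt (not_le.1 h)])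
    have h2 : x.2 ≤ n := by
      by_contra h
      exact hc (by simp [Nat.choose_eq_zero_of_lt (not_le.1 h)])
    omega

lemma kernelPoly_vartheta (hr : r ≤ m + n) : kernelPoly ⇑(vartheta f r) =
    (m : ℂ)⁻¹ • ∑ x ∈ antidiagonal r, ((x.1 : ℂ) * productCoeff m n n m x) •
      kernelPoly ⇑(contraction f (revConj f) x.1 x.2) := by
  rw [vartheta, kernelPoly_sum_toOrder _ _ fun x : ℕ × ℕ => contraction f (revConj f) x.1 x.2,
    smul_sum]
  · refine sum_congr rfl fun x _ => ?_
    rw [smul_smul]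
    congr 1
    rw [productCoeff]
    ring
  · intro x hx hc
    rw [HasAntidiagonal.mem_antidiagonal] at hx
    have h1 : x.1 ≤ m := by
      by_contra h
      exact hc (by simp [Nat.choose_eq_zero_of_lt (not_le.1 h)])
    have h2 : x.2 ≤ n := by
      by_contra h
      exact hc (by simp [Nat.choose_eq_zero_of_lt (not_le.1 h)])
    omega

lemma kernelPoly_varphi : kernelPoly ⇑(varphi f r) =
    ∑ x ∈ antidiagonal r, productCoeff m n m n x •
      kernelPoly ⇑(contraction f f x.1 x.2) := by
  rw [varphi, kernelPoly_sum_toOrder _ _ fun x : ℕ × ℕ => contraction f f x.1 x.2]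
  · refine sum_congr rfl fun x _ => ?_
    congr 1
    rw [productCoeff]
    ring
  · intro x hx hc
    rw [HasAntidiagonal.mem_antidiagonal] at hx
    have h1 : x.1 ≤ m ∧ x.1 ≤ n ∧ x.2 ≤ m ∧ x.2 ≤ n := by
      refine ⟨?_, ?_, ?_, ?_⟩ <;>
      · by_contra h
        exact hc (by simp [Nat.choose_eq_zero_of_lt (not_le.1 h)])
    omega

lemma kernelPoly_varsigma : kernelPoly ⇑(varsigma f r) =
    (m : ℂ)⁻¹ • ∑ x ∈ antidiagonal r, ((x.1 : ℂ) * productCoeff m n m n x) •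
      kernelPoly ⇑(contraction f f x.1 x.2) := by
  rw [varsigma, kernelPoly_sum_toOrder _ _ fun x : ℕ × ℕ => contraction f f x.1 x.2, smul_sum]
  · refine sum_congr rfl fun x _ => ?_
    rw [smul_smul]
    congr 1
    rw [productCoeff]
    ring
  · intro x hx hc
    rw [HasAntidiagonal.mem_antidiagonal] at hx
    have h1 : x.1 ≤ m ∧ x.1 ≤ n ∧ x.2 ≤ m ∧ x.2 ≤ n := by
      refine ⟨?_, ?_, ?_, ?_⟩ <;>
      · by_contra h
        exact hc (by simp [Nat.choose_eq_zero_of_lt (not_le.1 h)])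
    omega

omit [Fintype ι] in
lemma isSymmetric_psi : IsSymmetric (psi f r) :=
  isSymmetric_sum_smul _ _ fun _ _ => isSymmetric_toOrder (isSymmetric_symmetrize _)

omit [Fintype ι] in
lemma isSymmetric_varphi : IsSymmetric (varphi f r) :=
  isSymmetric_sum_smul _ _ fun _ _ => isSymmetric_toOrder (isSymmetric_symmetrize _)

end Kernels

variable [DecidableEq ι]

/-- The product formula for complex multiple Wiener–Itô integrals. -/
theorem wick_kernelPoly_mul {a b c d : ℕ} {f : ChaosKernel ι a b} {g : ChaosKernel ι c d}
    (hf : IsSymmetric f) (hg : IsSymmetric g) {R : ℕ}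
    (hR : ∀ x : ℕ × ℕ, R ≤ x.1 + x.2 → productCoeff a b c d x = 0) :
    wick (kernelPoly ⇑f) * wick (kernelPoly ⇑g) = wick (∑ r ∈ range R, ∑ x ∈ antidiagonal r,
      productCoeff a b c d x • kernelPoly ⇑(contraction f g x.1 x.2)) := by
  have hN : a + b ≤ a + b + R := Nat.le_add_right _ _
  rw [wick_mul_wick ((totalDegree_kernelPoly _).trans hN), contractExp, LinearMap.sum_apply,
    ← sum_range_antidiagonal_of_le (N := a + b + R + 1) (by omega)
      fun x hx => by rw [hR x hx, zero_smul], map_sum]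
  congr 1
  refine sum_congr rfl fun r _ => ?_
  rw [inv_factorial_smul_contract_pow, LinearMap.sum_apply, map_sum]
  exact sum_congr rfl fun x _ => by
    rw [LinearMap.smul_apply, map_smul, inv_smul_mulTensor_contract hf hg]

omit [DecidableEq ι] in
lemma exists_totalDegree_le (A : ι → 𝒫) (R : ℕ) :
    ∃ N, R ≤ N + 2 ∧ ∀ k, (A k).totalDegree ≤ N :=
  ⟨R + univ.sup fun k => (A k).totalDegree, by omega, fun k =>
    (le_sup (f := fun k => (A k).totalDegree) (mem_univ k)).trans (Nat.le_add_left _ _)⟩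

/-- The sum over k of ∂_k ⊗ ∂̄_k is `contractX`, so the product formula applied to derivatives is
exp(contract) composed with one more contraction of the first type. -/
theorem sum_wick_pderiv_mul {a b c d : ℕ} {f : ChaosKernel ι a b} {g : ChaosKernel ι c d}
    (hf : IsSymmetric f) (hg : IsSymmetric g) {R : ℕ}
    (hR : ∀ x : ℕ × ℕ, R ≤ x.1 + x.2 → productCoeff a b c d x = 0) :
    ∑ k, wick (pderiv (.inl k) (kernelPoly ⇑f)) * wick (pderiv (.inr k) (kernelPoly ⇑g)) =
      wick (∑ r ∈ range R, ∑ x ∈ antidiagonal r,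
        ((x.1 : ℂ) * productCoeff a b c d x) • kernelPoly ⇑(contraction f g x.1 x.2)) := by
  -- One truncation level has to serve all derivatives at once.
  obtain ⟨N, hRN, hN⟩ := exists_totalDegree_le (fun k => pderiv (.inl k) (kernelPoly ⇑f)) R
  have h1 : ∑ k, wick (pderiv (.inl k) (kernelPoly ⇑f)) * wick (pderiv (.inr k) (kernelPoly ⇑g)) =
      wick (mulTensor ((contractExp N * contractX : Module.End ℂ (𝒫 ⊗[ℂ] 𝒫))
        (kernelPoly ⇑f ⊗ₜ[ℂ] kernelPoly ⇑g))) := by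
    rw [Module.End.mul_apply, contractX, LinearMap.sum_apply, map_sum, map_sum, map_sum]
    exact sum_congr rfl fun k _ => by rw [wick_mul_wick (hN k)]; rfl
  rw [h1, contractExp_mul_contractX, LinearMap.sum_apply,
    ← sum_range_antidiagonal_of_le hRN
      fun x hx => by rw [hR x hx, mul_zero, zero_smul], map_sum]
  congr 1
  refine sum_congr rfl fun r _ => ?_
  rw [LinearMap.sum_apply, map_sum]
  exact sum_congr rfl fun x _ => by
    rw [LinearMap.smul_apply, map_smul, mul_smul, inv_smul_mulTensor_contract hf hg, smul_smul]

omit [DecidableEq ι] in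
lemma sum_X_mul_pderiv_wordSum {a : ℕ} {ψ : (Fin a → ι) → 𝒫} (h : PermInvariant ψ)
    (h0 : ∀ k p, pderiv (.inl k) (ψ p) = 0) :
    ∑ k, X (.inl k) * pderiv (.inl k) (wordSum .inl ψ) = (a : ℂ) • wordSum .inl ψ := by
  rcases a with _ | a
  · rw [Nat.cast_zero, zero_smul]
    exact sum_eq_zero fun k _ => by rw [pderiv_wordSum_zero (h0 k), mul_zero]
  · have h1 : ∀ k, X (.inl k) * pderiv (.inl k) (wordSum .inl ψ) =
        ((a + 1 : ℕ) : ℂ) • (wordSum .inl (fun p => ψ (Fin.snoc p k)) * X (.inl k)) := by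
      intro k
      rw [pderiv_wordSum Sum.inl_injective h (h0 k), mul_smul_comm, mul_comm]
    rw [sum_congr rfl fun k _ => h1 k, ← smul_sum, ← wordSum_succ]

section Kernels

variable {m n : ℕ} {f : ChaosKernel ι m n}

lemma wick_mul_wick_revConj (hf : IsSymmetric f) : wick (kernelPoly ⇑f) * wick (kernelPoly ⇑(revConj f)) =
    ∑ r ∈ range (m + n + 1), wick (kernelPoly ⇑(psi f r)) := by
  rw [wick_kernelPoly_mul hf (isSymmetric_revConj hf) (R := m + n + 1)
    fun x hx => productCoeff_eq_zero (by omega), map_sum]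
  exact sum_congr rfl fun r hr => by rw [kernelPoly_psi f (by simp at hr; omega)]

/-- When `f` is contracted with itself, both i and j are at most min m n, whence the range of r. -/
lemma wick_mul_self (hf : IsSymmetric f) : wick (kernelPoly ⇑f) * wick (kernelPoly ⇑f) =
    ∑ r ∈ range (2 * min m n + 1), wick (kernelPoly ⇑(varphi f r)) := by
  rw [wick_kernelPoly_mul hf hf (R := 2 * min m n + 1)
    fun x hx => productCoeff_eq_zero (by omega), map_sum]
  exact sum_congr rfl fun r hr => by rw [kernelPoly_varphi f]

lemma sum_wick_pderiv_mul_revConj (hf : IsSymmetric f) (hm : m ≠ 0) :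
    ∑ k, wick (pderiv (.inl k) (kernelPoly ⇑f)) *
      wick (pderiv (.inr k) (kernelPoly ⇑(revConj f))) =
    (m : ℂ) • ∑ r ∈ range (m + n + 1), wick (kernelPoly ⇑(vartheta f r)) := by
  have hm' : (m : ℂ) ≠ 0 := by exact_mod_cast hm
  rw [sum_wick_pderiv_mul hf (isSymmetric_revConj hf) (R := m + n + 1)
    fun x hx => productCoeff_eq_zero (by omega), map_sum, smul_sum]
  exact sum_congr rfl fun r hr => by
    rw [kernelPoly_vartheta f (by simp at hr; omega), map_smul, smul_inv_smul₀ hm']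

lemma sum_wick_pderiv_mul_self (hf : IsSymmetric f) (hm : m ≠ 0) :
    ∑ k, wick (pderiv (.inl k) (kernelPoly ⇑f)) * wick (pderiv (.inr k) (kernelPoly ⇑f)) =
    (m : ℂ) • ∑ r ∈ range (2 * min m n + 1), wick (kernelPoly ⇑(varsigma f r)) := by
  have hm' : (m : ℂ) ≠ 0 := by exact_mod_cast hm
  rw [sum_wick_pderiv_mul hf hf (R := 2 * min m n + 1)
    fun x hx => productCoeff_eq_zero (by omega), map_sum, smul_sum]
  exact sum_congr rfl fun r hr => by
    rw [kernelPoly_varsigma f, map_smul, smul_inv_smul₀ hm']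

omit [DecidableEq ι] in
/-- Euler's identity in the variables of the first kind. -/
lemma sum_X_mul_pderiv_kernelPoly (hf : IsSymmetric f) :
    ∑ k, X (.inl k) * pderiv (.inl k) (kernelPoly ⇑f) = (m : ℂ) • kernelPoly ⇑f := by
  rw [kernelPoly_eq_wordSum]
  exact sum_X_mul_pderiv_wordSum (SymmFun.permInvariant_fst hf)
    fun k p => pderiv_inl_wordSum_inr _ _

/-- Euler's identity writes m times the kernel polynomial as a sum of letters times derivatives, and
each letter is then moved across by adjointness. -/
lemma gaussE_wick_mul (hf : IsSymmetric f) (G : 𝒫) : (m : ℂ) * gaussE (wick (kernelPoly ⇑f) * G) =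
    ∑ k, gaussE (wick (pderiv (.inl k) (kernelPoly ⇑f)) * pderiv (.inr k) G) := by
  rw [← smul_eq_mul, ← map_smul, ← smul_mul_assoc, ← map_smul, ← sum_X_mul_pderiv_kernelPoly hf,
    map_sum, sum_mul, map_sum]
  exact sum_congr rfl fun k _ => gaussE_wick_X_mul _ _ _

/-- The fourth moment, by integration by parts. -/
theorem gaussE_fourth_eq (hf : IsSymmetric f) (hm : m ≠ 0) :
    gaussE (wick (kernelPoly ⇑f) * wick (kernelPoly ⇑(revConj f)) *
      (wick (kernelPoly ⇑f) * wick (kernelPoly ⇑(revConj f)))) =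
    2 * ∑ r ∈ range (m + n + 1), gaussE (wick (kernelPoly ⇑(vartheta f r)) *
        (wick (kernelPoly ⇑f) * wick (kernelPoly ⇑(revConj f)))) +
      ∑ r ∈ range (2 * min m n + 1), gaussE (wick (kernelPoly ⇑(varsigma f r)) *
        (wick (kernelPoly ⇑(revConj f)) * wick (kernelPoly ⇑(revConj f)))) := by
  have hm' : (m : ℂ) ≠ 0 := by exact_mod_cast hm
  have h1 := sum_wick_pderiv_mul_revConj hf hm
  have h2 := sum_wick_pderiv_mul_self hf hm
  set F := kernelPoly ⇑f
  set Q := kernelPoly ⇑(revConj f)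
  have h3 := gaussE_wick_mul hf (wick Q * (wick F * wick Q))
  -- Here the rest of the fourth moment is conj F · F · conj F. The derivative hits either of the
  -- two equal factors conj F, whence the 2, or the factor F.
  have h4 : ∀ k, gaussE (wick (pderiv (.inl k) F) *
        pderiv (.inr k) (wick Q * (wick F * wick Q))) =
      2 * gaussE (wick (pderiv (.inl k) F) * wick (pderiv (.inr k) Q) * (wick F * wick Q)) +
        gaussE (wick (pderiv (.inl k) F) * wick (pderiv (.inr k) F) * (wick Q * wick Q)) := by
    intro k
    rw [two_mul, ← map_add, ← map_add]
    congr 1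
    simp only [Derivation.leibniz, smul_eq_mul, wick_pderiv]
    ring
  rw [sum_congr rfl fun k _ => h4 k, sum_add_distrib, ← mul_sum, ← map_sum, ← map_sum, ← sum_mul,
    ← sum_mul, h1, h2] at h3
  simp only [smul_mul_assoc, map_smul, smul_eq_mul, sum_mul, map_sum] at h3
  apply mul_left_cancel₀ hm'
  rw [mul_assoc (wick F), h3]
  ring

end Kernels

end ProductFormula

/-! ### Moments of real Gaussian variables -/

section RealMoments

variable {Ω : Type*} [MeasurableSpace Ω] {P : Measure Ω}

/-- Repeated differentiation of g' = v t g. At t = 0 only the second term remains, which is the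
recursion for the moments; for n = 0 the factor n removes the truncated order n - 1. -/
lemma iteratedDeriv_exp_sq (v : ℝ) (n : ℕ) (t : ℝ) :
    iteratedDeriv (n + 1) (fun t : ℝ => Real.exp (v * t ^ 2 / 2)) t =
      v * t * iteratedDeriv n (fun t : ℝ => Real.exp (v * t ^ 2 / 2)) t +
        n * v * iteratedDeriv (n - 1) (fun t : ℝ => Real.exp (v * t ^ 2 / 2)) t := by
  set g := fun t : ℝ => Real.exp (v * t ^ 2 / 2) with hg
  have hs : ContDiff ℝ (⊤ : ℕ∞) g := by fun_prop
  have hd : ∀ k, Differentiable ℝ (iteratedDeriv k g) := fun k =>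
    hs.differentiable_iteratedDeriv k (WithTop.coe_lt_coe.2 (ENat.natCast_lt_top k))
  induction n generalizing t with
  | zero =>
    rw [iteratedDeriv_succ, iteratedDeriv_zero]
    have : HasDerivAt g (Real.exp (v * t ^ 2 / 2) * (v * (2 * t) / 2)) t := by
      have h := ((((hasDerivAt_id t).pow 2).const_mul v).div_const 2).exp
      simpa using h
    rw [this.deriv]
    simp [hg]
    ring
  | succ n ih =>
    rw [iteratedDeriv_succ]
    refine (congrFun (congrArg deriv (funext ih)) t).trans ?_
    have h1 : HasDerivAt (fun t => v * t * iteratedDeriv n g t + n * v * iteratedDeriv (n - 1) g t)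
        (v * 1 * iteratedDeriv n g t + v * t * iteratedDeriv (n + 1) g t +
          n * v * deriv (iteratedDeriv (n - 1) g) t) t := by
      refine HasDerivAt.add (HasDerivAt.mul ((hasDerivAt_id t).const_mul v) ?_) ?_
      · rw [iteratedDeriv_succ]
        exact (hd n t).hasDerivAt
      · exact ((hd _ t).hasDerivAt).const_mul _
    rw [h1.deriv, ← iteratedDeriv_succ]
    rcases n with _ | n
    · simp
      ring
    · simp only [Nat.add_sub_cancel]
      push_cast
      ring

lemma integral_pow_add_two_of_gaussianReal {X : Ω → ℝ} {v : NNReal}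
    (hX : P.map X = gaussianReal 0 v) (n : ℕ) :
    ∫ ω, X ω ^ (n + 2) ∂P = (n + 1) * v * ∫ ω, X ω ^ n ∂P := by
  have hX_meas : AEMeasurable X P := aemeasurable_of_map_neZero (by rw [hX]; infer_instance)
  have h0 : (0 : ℝ) ∈ interior (integrableExpSet id (gaussianReal 0 v)) := by
    rw [integrableExpSet_id_gaussianReal]; simp
  have hm : mgf id (gaussianReal 0 v) = fun t => Real.exp (v * t ^ 2 / 2) := by
    funext t
    rw [mgf_gaussianReal (by rw [Measure.map_id])]
    simp
  have key : ∀ n, ∫ ω, X ω ^ n ∂P =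
      iteratedDeriv n (fun t : ℝ => Real.exp (v * t ^ 2 / 2)) 0 := by
    intro n
    rw [← hm, iteratedDeriv_mgf_zero h0, ← hX, integral_map hX_meas (by fun_prop)]
    simp
  rw [key, key, iteratedDeriv_exp_sq]
  push_cast
  simp

/-- Variance 1/2 is that of the real part of a standard complex Gaussian variable; the recursion
multiplies by (2a+1)/2 at each step. -/
lemma integral_pow_of_gaussianReal_half [IsProbabilityMeasure P] {X : Ω → ℝ}
    (hX : P.map X = gaussianReal 0 (1 / 2)) (a : ℕ) :
    (∫ ω, X ω ^ (2 * a) ∂P) * (4 ^ a * a.factorial) = (2 * a).factorial := by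
  induction a with
  | zero => simp
  | succ a ih =>
    rw [show 2 * (a + 1) = 2 * a + 2 by ring, integral_pow_add_two_of_gaussianReal hX]
    simp only [Nat.factorial_succ, pow_succ]
    push_cast
    rw [← ih]
    ring

end RealMoments

/-! ### Mixed moments of one complex Gaussian variable -/

section OneVariable

variable {Ω : Type*} [MeasurableSpace Ω] {P : Measure Ω} [IsProbabilityMeasure P]

lemma infinite_unit_circle : {c : ℂ | ‖c‖ = 1}.Infinite := by
  have h1 : IsPreconnected (Metric.sphere (0 : ℂ) 1) :=
    isPreconnected_sphere (by rw [Complex.rank_real_complex]; norm_num) _ _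
  have h2 : (Metric.sphere (0 : ℂ) 1).Nontrivial :=
    ⟨1, by simp, -1, by simp, by norm_num⟩
  have h3 := h1.infinite_of_nontrivial h2
  convert h3 using 1
  ext; simp

/-- The mixed moments of a standard complex Gaussian variable. -/
lemma integral_pow_mul_conj_pow {X : Ω → ℂ} (hX : AllMoments P X)
    (hlaw : ∀ c : ℂ, ‖c‖ = 1 → P.map (fun ω => (c * X ω).re) = gaussianReal 0 (1 / 2))
    (a b : ℕ) :
    ∫ ω, X ω ^ a * conj (X ω) ^ b ∂P = if a = b then (a.factorial : ℂ) else 0 := by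
  have hI : ∀ a b, Integrable (fun ω => X ω ^ a * conj (X ω) ^ b) P := fun a b =>
    memLp_one_iff_integrable.1 (((hX.pow a).mul (hX.conj.pow b)) 1 (by norm_num))
  set N := a + b
  set A : ℕ → ℂ := fun k => ∫ ω, X ω ^ k * conj (X ω) ^ (N - k) ∂P with hA
  set μ : ℝ := ∫ ω, ((1 : ℂ) * X ω).re ^ N ∂P with hμ
  have hmom : ∀ c : ℂ, ‖c‖ = 1 → ∫ ω, (c * X ω).re ^ N ∂P = μ := by
    have h : ∀ c : ℂ, ‖c‖ = 1 →
        ∫ ω, (c * X ω).re ^ N ∂P = ∫ x, x ^ N ∂(gaussianReal 0 (1 / 2)) := by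
      intro c hc
      rw [← hlaw c hc, integral_map]
      · exact aemeasurable_of_map_neZero (by rw [hlaw c hc]; infer_instance)
      · fun_prop
    intro c hc
    rw [h c hc, hμ, h 1 (by simp)]
  -- For unimodular c one has 2 Re(cX) · c = c²X + conj X. The N-th power is expanded by the
  -- binomial theorem, and the moment of Re(cX) is the same number `μ` for all such c.
  have hcirc : ∀ c : ℂ, ‖c‖ = 1 →
      ∑ k ∈ range (N + 1), (N.choose k * A k) * c ^ (2 * k) = (2 ^ N * μ) * c ^ N := by
    intro c hc
    have hcc : c * conj c = 1 := by
      rw [Complex.mul_conj, Complex.normSq_eq_norm_sq, hc]; simp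
    have h1 : ∀ ω, (((2 * (c * X ω).re) ^ N : ℝ) : ℂ) * c ^ N =
        ∑ k ∈ range (N + 1), (N.choose k : ℂ) * (X ω ^ k * conj (X ω) ^ (N - k)) * c ^ (2 * k) := by
      intro ω
      have h2 : ((2 * (c * X ω).re : ℝ) : ℂ) * c = c ^ 2 * X ω + conj (X ω) := by
        rw [← Complex.add_conj, map_mul]
        linear_combination (conj (X ω)) * hcc
      rw [Complex.ofReal_pow, ← mul_pow, h2, add_pow]
      refine sum_congr rfl fun k _ => ?_
      rw [mul_pow, pow_mul]
      ring
    have h2 : ∫ ω, (((2 * (c * X ω).re) ^ N : ℝ) : ℂ) * c ^ N ∂P = (2 ^ N * μ) * c ^ N := by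
      rw [integral_mul_const, integral_complex_ofReal]
      simp only [mul_pow]
      rw [integral_const_mul, hmom c hc]
      push_cast
      ring
    rw [← h2, integral_congr_ae (Filter.Eventually.of_forall h1), integral_finsetSum]
    · exact sum_congr rfl fun k _ => by rw [integral_mul_const, integral_const_mul]
    · exact fun k _ => ((hI _ _).const_mul _).mul_const _
  -- Both sides are polynomials in c that agree on the infinite unit circle.
  have hpoly : (∑ k ∈ range (N + 1), Polynomial.monomial (2 * k) (N.choose k * A k) -
      Polynomial.monomial N (2 ^ N * μ : ℂ)) = 0 := by
    refine Polynomial.eq_zero_of_infinite_isRoot _ (infinite_unit_circle.mono fun c hc => ?_)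
    rw [Set.mem_ofPred_eq, Polynomial.IsRoot, Polynomial.eval_sub, Polynomial.eval_finsetSum,
      Polynomial.eval_monomial, ← hcirc c hc, sub_eq_zero]
    exact sum_congr rfl fun k _ => Polynomial.eval_monomial
  -- Degree 2a isolates `A a`. The other side has only degree N = a + b, which equals 2a exactly
  -- when a = b.
  have hcoeff := congrArg (fun p => p.coeff (2 * a)) hpoly
  simp only [Polynomial.coeff_sub, Polynomial.finsetSum_coeff, Polynomial.coeff_monomial,
    Polynomial.coeff_zero] at hcoeff
  rw [sum_eq_single a (fun k _ hk => if_neg (by omega)) (fun h => absurd (by simp [N]) h),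
    if_pos rfl, sub_eq_zero] at hcoeff
  have hAa : A a = ∫ ω, X ω ^ a * conj (X ω) ^ b ∂P := by simp [hA, N]
  have hch : (N.choose a : ℂ) ≠ 0 := by
    exact_mod_cast (Nat.choose_pos (Nat.le_add_right a b)).ne'
  rw [← hAa]
  by_cases hab : a = b
  · subst hab
    have hN : N = 2 * a := by omega
    rw [if_pos rfl]
    rw [if_pos hN, hN] at hcoeff
    have hm := integral_pow_of_gaussianReal_half (hlaw 1 (by simp)) a
    rw [← hN, ← hμ] at hm
    have h4 : ((4 : ℂ) ^ a) = 2 ^ (2 * a) := by rw [pow_mul]; norm_num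
    have hm' : (μ : ℂ) * (2 ^ (2 * a) * a.factorial) = (2 * a).factorial := by
      rw [← h4, ← hN]; exact_mod_cast hm
    have hc := Nat.choose_mul_factorial_mul_factorial (show a ≤ 2 * a by omega)
    rw [show 2 * a - a = a by omega] at hc
    have hc' : ((2 * a).choose a : ℂ) * a.factorial * a.factorial = (2 * a).factorial := by
      exact_mod_cast hc
    have hf : (a.factorial : ℂ) ≠ 0 := by exact_mod_cast a.factorial_ne_zero
    rw [hN] at hch
    apply mul_left_cancel₀ (mul_ne_zero hch hf)
    linear_combination (a.factorial : ℂ) * hcoeff + hm' - hc'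
  · rw [if_neg hab]
    rw [if_neg (by omega)] at hcoeff
    exact (mul_eq_zero.1 hcoeff).resolve_left hch

end OneVariable

/-! ### Additivity, real covariances and independence for the isonormal process -/

section Isonormal

variable {Ω H : Type*} [MeasurableSpace Ω] [NormedAddCommGroup H] [InnerProductSpace ℂ H]
  {Z : H → Ω → ℂ} {P : Measure Ω}

namespace IsComplexIsonormal

lemma allMoments (hZ : IsComplexIsonormal Z P) (h : H) : AllMoments P (Z h) :=
  fun _ hr => (hZ.isGaussianProcess.hasGaussianLaw_eval h).memLp hr

lemma isProbabilityMeasure (hZ : IsComplexIsonormal Z P) : IsProbabilityMeasure P :=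
  (hZ.isGaussianProcess.hasGaussianLaw ∅).isProbabilityMeasure

lemma integrable_mul (hZ : IsComplexIsonormal Z P) (g h : H) :
    Integrable (fun ω => Z g ω * Z h ω) P :=
  memLp_one_iff_integrable.1 (((hZ.allMoments g).mul (hZ.allMoments h)) 1 (by norm_num))

lemma integrable_mul_conj (hZ : IsComplexIsonormal Z P) (g h : H) :
    Integrable (fun ω => Z g ω * conj (Z h ω)) P :=
  memLp_one_iff_integrable.1 (((hZ.allMoments g).mul (hZ.allMoments h).conj) 1 (by norm_num))

lemma inner_toLp (hZ : IsComplexIsonormal Z P) (g h : H) :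
    inner ℂ ((hZ.allMoments h 2 (by norm_num)).toLp) ((hZ.allMoments g 2 (by norm_num)).toLp) =
      (inner ℂ h g : ℂ) := by
  rw [← hZ.covariance, L2.inner_def]
  refine integral_congr_ae ?_
  filter_upwards [(hZ.allMoments h 2 (by norm_num)).coeFn_toLp,
    (hZ.allMoments g 2 (by norm_num)).coeFn_toLp] with ω h1 h2
  rw [h1, h2, RCLike.inner_apply]

/-- Linearity is not part of the definition: by the covariance formula, the L² norm of Z(g + h) -
Z(g) - Z(h) expands to zero. -/
lemma ae_add (hZ : IsComplexIsonormal Z P) (g h : H) :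
    ∀ᵐ ω ∂P, Z (g + h) ω = Z g ω + Z h ω := by
  have key : (hZ.allMoments (g + h) 2 (by norm_num)).toLp =
      (hZ.allMoments g 2 (by norm_num)).toLp + (hZ.allMoments h 2 (by norm_num)).toLp := by
    rw [← sub_eq_zero, ← inner_self_eq_zero (𝕜 := ℂ)]
    simp only [inner_sub_left, inner_sub_right, inner_add_left, inner_add_right, hZ.inner_toLp]
    ring
  filter_upwards [(hZ.allMoments (g + h) 2 (by norm_num)).coeFn_toLp,
    (hZ.allMoments g 2 (by norm_num)).coeFn_toLp, (hZ.allMoments h 2 (by norm_num)).coeFn_toLp,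
    Lp.coeFn_add (hZ.allMoments g 2 (by norm_num)).toLp (hZ.allMoments h 2 (by norm_num)).toLp]
    with ω h1 h2 h3 h4
  rw [← h1, ← h2, ← h3, key, h4, Pi.add_apply]

/-- Polarization of E[Z(h)²] = 0, which is available because Z is additive almost surely. -/
lemma integral_mul (hZ : IsComplexIsonormal Z P) (g h : H) : ∫ ω, Z g ω * Z h ω ∂P = 0 := by
  have h1 : ∫ ω, (Z g ω ^ 2 + 2 * (Z g ω * Z h ω) + Z h ω ^ 2) ∂P = 0 := by
    rw [← hZ.symmetric (g + h)]
    refine integral_congr_ae ?_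
    filter_upwards [hZ.ae_add g h] with ω hω
    rw [hω]
    ring
  have hi : ∀ g, Integrable (fun ω => Z g ω ^ 2) P := fun g => by
    simpa only [sq] using hZ.integrable_mul g g
  have hi2 : Integrable (fun ω => Z g ω ^ 2 + 2 * (Z g ω * Z h ω)) P :=
    (hi g).add ((hZ.integrable_mul g h).const_mul 2)
  rw [integral_add hi2 (hi h), integral_add (hi g) ((hZ.integrable_mul g h).const_mul 2), integral_const_mul,
    hZ.symmetric, hZ.symmetric] at h1
  simpa using h1

/-- Re w · Re w' is half the real part of w w' + w conj w', and the first product has mean zero by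
`integral_mul`. -/
lemma integral_re_mul_re (hZ : IsComplexIsonormal Z P) (g h : H) (c d : ℂ) :
    ∫ ω, (c * Z g ω).re * (d * Z h ω).re ∂P = (c * conj d * inner ℂ h g).re / 2 := by
  have h1 : ∀ ω, (c * Z g ω).re * (d * Z h ω).re =
      ((c * d) / 2 * (Z g ω * Z h ω) + c * conj d / 2 * (Z g ω * conj (Z h ω))).re := by
    intro ω
    simp only [Complex.add_re, Complex.mul_re, Complex.mul_im, Complex.div_ofNat_re,
      Complex.div_ofNat_im, Complex.conj_re, Complex.conj_im]
    ring
  have hi : Integrable (fun ω =>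
      (c * d) / 2 * (Z g ω * Z h ω) + c * conj d / 2 * (Z g ω * conj (Z h ω))) P :=
    ((hZ.integrable_mul g h).const_mul _).add ((hZ.integrable_mul_conj g h).const_mul _)
  rw [integral_congr_ae (Filter.Eventually.of_forall h1)]
  have h2 := integral_re (𝕜 := ℂ) hi
  simp only [RCLike.re_eq_complex_re] at h2
  rw [h2, integral_add ((hZ.integrable_mul g h).const_mul _)
    ((hZ.integrable_mul_conj g h).const_mul _), integral_const_mul, integral_const_mul,
    hZ.integral_mul, hZ.covariance, mul_zero, zero_add, div_mul_eq_mul_div, Complex.div_ofNat_re]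

lemma integral_re (hZ : IsComplexIsonormal Z P) (g : H) (c : ℂ) :
    ∫ ω, (c * Z g ω).re ∂P = 0 := by
  have := hZ.isProbabilityMeasure
  have hi : Integrable (fun ω => c * Z g ω) P :=
    (memLp_one_iff_integrable.1 (hZ.allMoments g 1 (by norm_num))).const_mul c
  have h2 := _root_.integral_re (𝕜 := ℂ) hi
  simp only [RCLike.re_eq_complex_re] at h2
  rw [h2, integral_const_mul, hZ.centered, mul_zero, Complex.zero_re]

/-- The real part of a complex multiple, as a real linear form. -/
def reMul (c : ℂ) : ℂ →L[ℝ] ℝ := Complex.reCLM ∘L (ContinuousLinearMap.mul ℝ ℂ c)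

lemma reMul_apply (c z : ℂ) : reMul c z = (c * z).re := rfl

lemma memLp_re (hZ : IsComplexIsonormal Z P) (g : H) (c : ℂ) :
    MemLp (fun ω => (c * Z g ω).re) 2 P :=
  ((hZ.isGaussianProcess.hasGaussianLaw_eval g).map_fun (reMul c)).memLp_two

lemma covariance_re (hZ : IsComplexIsonormal Z P) (g h : H) (c d : ℂ) :
    cov[fun ω => (c * Z g ω).re, fun ω => (d * Z h ω).re; P] =
      (c * conj d * inner ℂ h g).re / 2 := by
  have := hZ.isProbabilityMeasure
  rw [covariance_eq_sub (hZ.memLp_re g c) (hZ.memLp_re h d), hZ.integral_re, zero_mul, sub_zero]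
  exact hZ.integral_re_mul_re g h c d

lemma map_re (hZ : IsComplexIsonormal Z P) {g : H} (hg : ‖g‖ = 1) {c : ℂ} (hc : ‖c‖ = 1) :
    P.map (fun ω => (c * Z g ω).re) = gaussianReal 0 (1 / 2) := by
  have h := (hZ.isGaussianProcess.hasGaussianLaw_eval g).map_fun (reMul c)
  simp only [reMul_apply] at h
  rw [h.map_eq_gaussianReal, hZ.integral_re, ← covariance_self h.aemeasurable, hZ.covariance_re,
    inner_self_eq_norm_sq_to_K, hg, Complex.mul_conj, Complex.normSq_eq_norm_sq, hc]
  congr 1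
  ext
  norm_num

/-- The independence criterion tests real linear functionals on ℂ; this reduces them to the real
parts treated above. -/
lemma exists_reMul (L : StrongDual ℝ ℂ) : ∃ c : ℂ, ∀ z, L z = (c * z).re := by
  refine ⟨⟨L 1, -L Complex.I⟩, fun z => ?_⟩
  have : z = z.re • (1 : ℂ) + z.im • Complex.I := by simp
  conv_lhs => rw [this]
  rw [map_add, map_smul, map_smul, Complex.mul_re]
  simp only [smul_eq_mul]
  ring

/-- The family is jointly Gaussian, and orthogonality makes every real covariance between different
modes vanish. -/
lemma iIndepFun {κ : Type*} [Fintype κ] (hZ : IsComplexIsonormal Z P) {e : κ → H}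
    (he : Orthonormal ℂ e) : ProbabilityTheory.iIndepFun (fun k => Z (e k)) P := by
  have hlaw : HasGaussianLaw (fun ω k => Z (e k) ω) P := by
    have h := (hZ.isGaussianProcess.comp_right e).hasGaussianLaw univ
    let L : (((univ : Finset κ) : Type _) → ℂ) →L[ℝ] (κ → ℂ) :=
      ContinuousLinearMap.pi fun k => ContinuousLinearMap.proj ⟨k, mem_univ k⟩
    exact h.map_fun L
  refine hlaw.iIndepFun_of_covariance_strongDual fun i j hij L₁ L₂ => ?_
  obtain ⟨c, hc⟩ := exists_reMul L₁
  obtain ⟨d, hd⟩ := exists_reMul L₂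
  have h := hZ.covariance_re (e i) (e j) c d
  rw [he.2 hij.symm] at h
  simpa [Function.comp_def, hc, hd] using h

end IsComplexIsonormal

end Isonormal

/-! ### Complex conjugation of polynomials -/

section ConjPoly

variable {ι : Type*}

local notation "𝒫" => MvPolynomial (ι ⊕ ι) ℂ

/-- Complex conjugation of polynomials in `z_k` and `conj z_k`. -/
def conjPoly : 𝒫 →+* 𝒫 :=
  (rename Sum.swap : 𝒫 →ₐ[ℂ] 𝒫).toRingHom.comp (MvPolynomial.map (starRingEnd ℂ))

lemma conjPoly_monomial (α : ι ⊕ ι →₀ ℕ) (c : ℂ) :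
    conjPoly (monomial α c) = monomial (α.mapDomain Sum.swap) (conj c) := by
  simp [conjPoly, map_monomial, rename_monomial]

lemma conjPoly_X (s : ι ⊕ ι) : conjPoly (X s : 𝒫) = X s.swap := by
  simp [conjPoly]

lemma conjPoly_smul (c : ℂ) (A : 𝒫) : conjPoly (c • A) = conj c • conjPoly A := by
  rw [smul_eq_C_mul, smul_eq_C_mul, map_mul]
  congr 1
  simp [conjPoly]

lemma conjPoly_wordMonomial (c : ι → ι ⊕ ι) {a : ℕ} (p : Fin a → ι) :
    conjPoly (wordMonomial c p) = wordMonomial (fun k => (c k).swap) p := by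
  simp [wordMonomial, conjPoly_X]

variable [Fintype ι]

lemma conjPoly_wick (A : 𝒫) : conjPoly (wick A) = wick (conjPoly A) := by
  induction A using MvPolynomial.induction_on' with
  | monomial α c =>
    rw [conjPoly_monomial, wick_monomial, wick_monomial, conjPoly_smul]
    congr 1
    rw [wickMonomial, wickMonomial, map_prod]
    refine prod_congr rfl fun k => fun _ => ?_
    have h : ∀ s : ι ⊕ ι, α.mapDomain Sum.swap s.swap = α s := fun s =>
      Finsupp.mapDomain_apply Sum.swap_leftInverse.injective α s
    rw [map_hermitePoly, conjPoly_X, conjPoly_X, hermitePoly_comm]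
    have hl := h (.inl k)
    have hr := h (.inr k)
    simp only [Sum.swap_inl, Sum.swap_inr] at hl hr ⊢
    rw [hl, hr]
  | add A B hA hB => simp [hA, hB]

lemma conjPoly_kernelPoly {a b : ℕ} (f : ChaosKernel ι a b) :
    conjPoly (kernelPoly ⇑f) = kernelPoly ⇑(revConj f) := by
  rw [kernelPoly_apply, kernelPoly_apply, map_sum]
  refine Fintype.sum_equiv (Equiv.prodComm _ _) _ _ fun x => ?_
  rw [conjPoly_smul, map_mul, conjPoly_wordMonomial, conjPoly_wordMonomial, mul_comm]
  rfl

lemma conjPoly_wick_kernelPoly {a b : ℕ} (f : ChaosKernel ι a b) :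
    conjPoly (wick (kernelPoly ⇑f)) = wick (kernelPoly ⇑(revConj f)) := by
  rw [conjPoly_wick, conjPoly_kernelPoly]

end ConjPoly

/-! ### The three expansions over finitely many modes -/

section FiniteMoments

variable {ι : Type*} [Fintype ι] [DecidableEq ι]

/-- The hypothesis `hab` says that the orders determine the index, so orthogonality leaves only the
diagonal terms. -/
lemma gaussE_sum_mul_sum_revConj {s : Finset ℕ} {a b : ℕ → ℕ}
    (hab : ∀ r ∈ s, ∀ t ∈ s, a r = a t → b r = b t → r = t)
    (f : ∀ r, ChaosKernel ι (a r) (b r)) {g : ∀ r, ChaosKernel ι (a r) (b r)}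
    (hg : ∀ r, IsSymmetric (g r)) :
    gaussE ((∑ r ∈ s, wick (kernelPoly ⇑(f r))) * ∑ r ∈ s, wick (kernelPoly ⇑(revConj (g r)))) =
      ∑ r ∈ s, ((a r).factorial * (b r).factorial : ℂ) * inner ℂ (g r) (f r) := by
  rw [sum_mul_sum, map_sum]
  refine sum_congr rfl fun r hr => ?_
  rw [map_sum, sum_eq_single r]
  · rw [← pairing_apply, pairing_kernelPoly_revConj _ (hg r)]
  · intro t ht hne
    rw [← pairing_apply]
    refine pairing_kernelPoly_of_ne ?_ _ (isSymmetric_revConj (hg t))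
    by_contra! h
    exact hne (hab t ht r hr h.1.symm h.2.symm)
  · exact fun h => absurd hr h

omit [Fintype ι] [DecidableEq ι] in
lemma inner_self_eq_ofReal {a b : ℕ} (f : ChaosKernel ι a b) :
    inner ℂ f f = ((‖f‖ ^ 2 : ℝ) : ℂ) := by
  rw [inner_self_eq_norm_sq_to_K, Complex.ofReal_pow]
  rfl

omit [DecidableEq ι] in
lemma norm_sq_eq_sum {a b : ℕ} (f : ChaosKernel ι a b) : ‖f‖ ^ 2 = ∑ x, ‖f x‖ ^ 2 := by
  have h := lp.norm_rpow_eq_tsum (p := 2) (by norm_num) f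
  simpa [tsum_fintype] using h

/-- A kernel of order zero is a scalar, and its integral is that constant. -/
lemma norm_of_order_zero {a b : ℕ} (ha : a = 0) (hb : b = 0) (h : ChaosKernel ι a b) :
    ‖h‖ = ‖gaussE (wick (kernelPoly ⇑h))‖ := by
  subst ha hb
  have h2 : ‖h‖ ^ 2 = ‖h (Fin.elim0, Fin.elim0)‖ ^ 2 := by
    rw [norm_sq_eq_sum]
    exact Fintype.sum_eq_single _ fun x hx => (hx (Subsingleton.elim _ _)).elim
  rw [gaussE_wick, kernelPoly_zero_zero, constantCoeff_C]
  exact (pow_left_inj₀ (norm_nonneg _) (norm_nonneg _) two_ne_zero).1 h2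

/-- Only the full contraction (a, b) has order zero and thus a non-zero mean; its coefficient in the
product formula is a! b!. -/
lemma gaussE_wick_mul_wick {a b : ℕ} {f : ChaosKernel ι a b} {g : ChaosKernel ι b a}
    (hf : IsSymmetric f) (hg : IsSymmetric g) :
    ‖gaussE (wick (kernelPoly ⇑f) * wick (kernelPoly ⇑g))‖ =
      a.factorial * b.factorial * ‖contraction f g a b‖ := by
  rw [norm_of_order_zero (by omega) (by omega) (contraction f g a b),
    wick_kernelPoly_mul hf hg (R := a + b + 1) fun x hx => productCoeff_eq_zero (by omega),
    map_sum, map_sum, sum_eq_single (a + b), map_sum, map_sum, sum_eq_single (a, b)]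
  · rw [map_smul, map_smul, smul_eq_mul, norm_mul, productCoeff]
    simp
  · rintro ⟨i, j⟩ hx hne
    rw [HasAntidiagonal.mem_antidiagonal] at hx
    simp only [ne_eq, Prod.mk.injEq, not_and] at hne hx
    rw [productCoeff_eq_zero (by simp only; omega), zero_smul, map_zero, map_zero]
  · exact fun h => absurd (HasAntidiagonal.mem_antidiagonal (a := (a, b)).2 rfl) h
  · intro r hr hne
    simp only [mem_range] at hr
    rw [map_sum, map_sum]
    refine sum_eq_zero fun x hx => ?_
    rw [HasAntidiagonal.mem_antidiagonal] at hx
    rw [map_smul, map_smul, gaussE_wick]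
    by_cases h : (x.1 ≤ a ∧ x.1 ≤ a) ∧ (x.2 ≤ b ∧ x.2 ≤ b)
    · rw [constantCoeff_kernelPoly_of_ne (by omega), smul_zero]
    · rw [productCoeff_eq_zero h, zero_smul]
  · exact fun h => absurd (mem_range.2 (by omega)) h

omit [Fintype ι] [DecidableEq ι] in
lemma slice_zero {a b : ℕ} (φ : (Fin a → ι) × (Fin b → ι) → ℂ) (u : Fin 0 → ι) (v : Fin 0 → ι)
    (x : (Fin a → ι) × (Fin b → ι)) :
    slice φ (Nat.add_zero a) (Nat.add_zero b) u v x = φ x := by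
  have h : ∀ {c : ℕ} (p : Fin c → ι) (u : Fin 0 → ι),
      Fin.append p u ∘ Fin.cast (Nat.add_zero c).symm = p := fun p u => by
    rw [Fin.append_right_nil _ _ rfl]
    rfl
  rw [slice, h, h]

omit [DecidableEq ι] in
lemma norm_contraction_zero {a b c d : ℕ} (f : ChaosKernel ι a b) (g : ChaosKernel ι c d) :
    ‖contraction f g 0 0‖ = ‖f‖ * ‖g‖ := by
  have h1 : ∀ {a c : ℕ} (p : Fin a → ι) (p' : Fin c → ι),
      Fin.append p p' ∘ Fin.castAdd c = p := fun p p' => funext fun s => by simp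
  have h2 : ∀ {a c : ℕ} (p : Fin a → ι) (p' : Fin c → ι),
      Fin.append p p' ∘ Fin.natAdd a = p' := fun p p' => funext fun s => by simp
  have h3 : ⇑(contraction f g 0 0) = fun x : (Fin (a + c) → ι) × (Fin (b + d) → ι) =>
      f (x.1 ∘ Fin.castAdd c, x.2 ∘ Fin.castAdd d) *
        g (x.1 ∘ Fin.natAdd a, x.2 ∘ Fin.natAdd b) := by
    rw [coe_contraction f g (by simp)]
    funext x
    rw [tsum_fintype, Fintype.sum_eq_single (Fin.elim0, Fin.elim0)
      fun w hw => (hw (Subsingleton.elim _ _)).elim]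
    exact congrArg₂ _ (slice_zero _ _ _ _) (slice_zero _ _ _ _)
  have h4 : ‖contraction f g 0 0‖ ^ 2 = (‖f‖ * ‖g‖) ^ 2 := by
    rw [norm_sq_eq_sum, mul_pow, norm_sq_eq_sum f, norm_sq_eq_sum g, h3]
    change ∑ x : (Fin (a + c) → ι) × (Fin (b + d) → ι), _ = _
    rw [Fintype.sum_prod_type, Fintype.sum_prod_type, Fintype.sum_prod_type, sum_append,
      sum_mul_sum]
    refine sum_congr rfl fun p _ => sum_congr rfl fun p' _ => ?_
    rw [sum_append, sum_mul_sum]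
    refine sum_congr rfl fun q _ => sum_congr rfl fun q' _ => ?_
    simp only [h1, h2, norm_mul, mul_pow]
  exact (pow_left_inj₀ (norm_nonneg _) (by positivity) two_ne_zero).1 h4

variable {m n : ℕ} {f : ChaosKernel ι m n}

lemma gaussE_wick_mul_revConj (hf : IsSymmetric f) :
    gaussE (wick (kernelPoly ⇑f) * wick (kernelPoly ⇑(revConj f))) =
      ((m.factorial * n.factorial * ‖f‖ ^ 2 : ℝ) : ℂ) := by
  rw [← pairing_apply, pairing_kernelPoly_revConj _ hf, inner_self_eq_ofReal]
  push_cast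
  ring

omit [DecidableEq ι] in
lemma kernelPoly_psi_zero (hf : IsSymmetric f) :
    kernelPoly ⇑(psi f 0) = kernelPoly ⇑f * kernelPoly ⇑(revConj f) := by
  have h := inv_smul_mulTensor_contract hf (isSymmetric_revConj hf) (0, 0)
  rw [kernelPoly_psi f (Nat.zero_le _), HasAntidiagonal.antidiagonal_zero, sum_singleton, ← h]
  simp [mulTensor]

omit [DecidableEq ι] in
lemma kernelPoly_varphi_zero (hf : IsSymmetric f) :
    kernelPoly ⇑(varphi f 0) = kernelPoly ⇑f * kernelPoly ⇑f := by
  have h := inv_smul_mulTensor_contract hf hf (0, 0)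
  rw [kernelPoly_varphi f, HasAntidiagonal.antidiagonal_zero, sum_singleton, ← h]
  simp [mulTensor]

/-- The kernel ψ_0 is the symmetrization of f ⊗ h, and its polynomial is a product, to which
`pairing_mul_kernelPoly` applies with g = h. The reversed conjugate of h is f, so contractions of
`f` with itself appear. -/
lemma norm_psi_zero (hf : IsSymmetric f) :
    ((m + n - 0).factorial : ℝ) ^ 2 * ‖psi f 0‖ ^ 2 =
      ∑ x ∈ range (m + 1) ×ˢ range (n + 1),
        (m.choose x.1 : ℝ) * (n.choose x.1 : ℝ) * (n.choose x.2 : ℝ) * (m.choose x.2 : ℝ)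
          * ((m.factorial : ℝ) * (n.factorial : ℝ)) ^ 2 * ‖contraction f f x.1 x.2‖ ^ 2 := by
  have h1 := pairing_kernelPoly_revConj (psi f 0) (isSymmetric_psi f (r := 0))
  have h2 := pairing_mul_kernelPoly hf (isSymmetric_revConj hf)
  -- Conjugation of polynomials is multiplicative and exchanges the two factors; commuting them
  -- gives the order required by `pairing_mul_kernelPoly`.
  rw [← conjPoly_kernelPoly, kernelPoly_psi_zero hf, RingHom.map_mul, conjPoly_kernelPoly,
    conjPoly_kernelPoly, mul_comm (kernelPoly ⇑(revConj f)), h2, revConj_revConj,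
    inner_self_eq_ofReal] at h1
  apply Complex.ofReal_injective
  refine Eq.trans ?_ (h1.symm.trans ?_)
  · push_cast
    ring
  · push_cast
    exact sum_congr rfl fun x _ => by ring

lemma norm_varphi_zero (hf : IsSymmetric f) :
    ((2 * m - 0).factorial : ℝ) * ((2 * n - 0).factorial : ℝ) * ‖varphi f 0‖ ^ 2 =
      ∑ x ∈ range (m + 1) ×ˢ range (n + 1),
        (m.choose x.1 : ℝ) ^ 2 * (n.choose x.2 : ℝ) ^ 2
          * ((m.factorial : ℝ) * (n.factorial : ℝ)) ^ 2
          * ‖contraction f (revConj f) x.1 x.2‖ ^ 2 := by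
  have h1 := pairing_kernelPoly_revConj (varphi f 0) (isSymmetric_varphi f (r := 0))
  have h2 := pairing_mul_kernelPoly hf hf
  rw [← conjPoly_kernelPoly, kernelPoly_varphi_zero hf, RingHom.map_mul, conjPoly_kernelPoly, h2,
    inner_self_eq_ofReal] at h1
  apply Complex.ofReal_injective
  refine Eq.trans ?_ (h1.symm.trans ?_)
  · push_cast
    ring
  · push_cast
    exact sum_congr rfl fun x _ => by ring

/-- |F|² is real, so conjugating its expansion gives a second one, in reversed conjugates, as the
bilinear pairing requires of its second argument. -/
lemma wick_mul_wick_revConj_eq_sum_revConj (hf : IsSymmetric f) :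
    wick (kernelPoly ⇑f) * wick (kernelPoly ⇑(revConj f)) =
      ∑ r ∈ range (m + n + 1), wick (kernelPoly ⇑(revConj (psi f r))) := by
  have h := congrArg conjPoly (wick_mul_wick_revConj hf)
  simpa only [RingHom.map_mul, map_sum, conjPoly_wick_kernelPoly, revConj_revConj, mul_comm] using h

lemma wick_revConj_mul_self (hf : IsSymmetric f) :
    wick (kernelPoly ⇑(revConj f)) * wick (kernelPoly ⇑(revConj f)) =
      ∑ r ∈ range (2 * min m n + 1), wick (kernelPoly ⇑(revConj (varphi f r))) := by
  have h := congrArg conjPoly (wick_mul_self hf)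
  simpa only [RingHom.map_mul, map_sum, conjPoly_wick_kernelPoly, revConj_revConj] using h

lemma gaussE_sum_mul_psi (hf : IsSymmetric f)
    (g : ∀ r, ChaosKernel ι (m + n - r) (m + n - r)) :
    gaussE ((∑ r ∈ range (m + n + 1), wick (kernelPoly ⇑(g r))) *
        (wick (kernelPoly ⇑f) * wick (kernelPoly ⇑(revConj f)))) =
      ∑ r ∈ range (m + n + 1), ((m + n - r).factorial : ℂ) ^ 2 * inner ℂ (psi f r) (g r) := by
  rw [wick_mul_wick_revConj_eq_sum_revConj hf, gaussE_sum_mul_sum_revConj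
    (fun r hr t ht h _ => by simp only [mem_range] at hr ht; omega) _ fun r => isSymmetric_psi f]
  exact sum_congr rfl fun r _ => by rw [sq]

lemma gaussE_sum_mul_varphi (hf : IsSymmetric f)
    (g : ∀ r, ChaosKernel ι (2 * m - r) (2 * n - r)) :
    gaussE ((∑ r ∈ range (2 * min m n + 1), wick (kernelPoly ⇑(g r))) *
        (wick (kernelPoly ⇑(revConj f)) * wick (kernelPoly ⇑(revConj f)))) =
      ∑ r ∈ range (2 * min m n + 1), ((2 * m - r).factorial : ℂ) * ((2 * n - r).factorial : ℂ) *
        inner ℂ (varphi f r) (g r) := by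
  rw [wick_revConj_mul_self hf, gaussE_sum_mul_sum_revConj
    (fun r hr t ht h _ => by simp only [mem_range] at hr ht; omega) _
    fun r => isSymmetric_varphi f]

theorem gaussE_fourth_eq_psi (hf : IsSymmetric f) :
    gaussE (wick (kernelPoly ⇑f) * wick (kernelPoly ⇑(revConj f)) *
      (wick (kernelPoly ⇑f) * wick (kernelPoly ⇑(revConj f)))) =
    ((∑ r ∈ range (m + n + 1), ((m + n - r).factorial : ℝ) ^ 2 * ‖psi f r‖ ^ 2 : ℝ) : ℂ) := by
  have h := gaussE_sum_mul_psi hf fun r => psi f r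
  rw [← wick_mul_wick_revConj hf] at h
  rw [h]
  push_cast
  exact sum_congr rfl fun r _ => by rw [inner_self_eq_ofReal, Complex.ofReal_pow]

/-- The fourth moment regrouped as F² times its conjugate. -/
theorem gaussE_fourth_eq_varphi (hf : IsSymmetric f) :
    gaussE (wick (kernelPoly ⇑f) * wick (kernelPoly ⇑(revConj f)) *
      (wick (kernelPoly ⇑f) * wick (kernelPoly ⇑(revConj f)))) =
    ((∑ r ∈ range (2 * min m n + 1), ((2 * m - r).factorial : ℝ) * ((2 * n - r).factorial : ℝ) *
      ‖varphi f r‖ ^ 2 : ℝ) : ℂ) := by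
  have h := gaussE_sum_mul_varphi hf fun r => varphi f r
  rw [← wick_mul_self hf] at h
  rw [mul_mul_mul_comm, h]
  push_cast
  exact sum_congr rfl fun r _ => by rw [inner_self_eq_ofReal, Complex.ofReal_pow]

theorem gaussE_fourth_eq_inner (hf : IsSymmetric f) (hm : m ≠ 0) :
    gaussE (wick (kernelPoly ⇑f) * wick (kernelPoly ⇑(revConj f)) *
      (wick (kernelPoly ⇑f) * wick (kernelPoly ⇑(revConj f)))) =
    2 * ∑ r ∈ range (m + n + 1), ((m + n - r).factorial : ℂ) ^ 2 *
        inner ℂ (psi f r) (vartheta f r) +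
      ∑ r ∈ range (2 * min m n + 1), ((2 * m - r).factorial : ℂ) * ((2 * n - r).factorial : ℂ) *
        inner ℂ (varphi f r) (varsigma f r) := by
  rw [gaussE_fourth_eq hf hm, ← map_sum, ← map_sum, ← sum_mul, ← sum_mul,
    gaussE_sum_mul_psi hf, gaussE_sum_mul_varphi hf]

/-- The kernel of order zero in the expansion of `|F|²`. -/
lemma norm_psi_top (hf : IsSymmetric f) :
    ‖psi f (m + n)‖ = m.factorial * n.factorial * ‖f‖ ^ 2 := by
  have h := congrArg gaussE (wick_mul_wick_revConj hf)
  rw [gaussE_wick_mul_revConj hf, map_sum, sum_eq_single (m + n)] at h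
  · rw [norm_of_order_zero (by omega) (by omega) (psi f (m + n)), ← h, Complex.norm_real,
      Real.norm_of_nonneg (by positivity)]
  · intro r hr hne
    simp only [mem_range] at hr
    rw [gaussE_wick, constantCoeff_kernelPoly_of_ne (by omega)]
  · exact fun h => absurd (mem_range.2 (by omega)) h

lemma norm_varphi_top (hf : IsSymmetric f) (hmn : m = n) :
    ‖varphi f (m + n)‖ = ‖gaussE (wick (kernelPoly ⇑f) * wick (kernelPoly ⇑f))‖ := by
  have h := congrArg gaussE (wick_mul_self hf)
  rw [map_sum, sum_eq_single (m + n)] at h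
  · rw [norm_of_order_zero (by omega) (by omega) (varphi f (m + n)), ← h]
  · intro r hr hne
    simp only [mem_range] at hr
    rw [gaussE_wick, constantCoeff_kernelPoly_of_ne (by omega)]
  · exact fun h => absurd (mem_range.2 (by omega)) h

lemma gaussE_wick_mul_self_of_ne (hf : IsSymmetric f) (hmn : m ≠ n) :
    gaussE (wick (kernelPoly ⇑f) * wick (kernelPoly ⇑f)) = 0 :=
  (pairing_apply _ _).symm.trans (pairing_kernelPoly_of_ne (Or.inl hmn) _ (χ := ⇑f) hf)

lemma norm_contraction_revConj_top (hf : IsSymmetric f) :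
    m.factorial * n.factorial * ‖contraction f (revConj f) m n‖ =
      m.factorial * n.factorial * ‖f‖ ^ 2 := by
  rw [← gaussE_wick_mul_wick hf (isSymmetric_revConj hf), gaussE_wick_mul_revConj hf,
    Complex.norm_real, Real.norm_of_nonneg (by positivity)]

omit [Fintype ι] [DecidableEq ι] in
lemma vartheta_zero : vartheta f 0 = 0 := by
  simp [vartheta]

omit [Fintype ι] [DecidableEq ι] in
lemma varsigma_zero : varsigma f 0 = 0 := by
  simp [varsigma]

-- In total order m + n only (i, j) = (m, n) has non-zero binomial coefficients, and there the
-- weight i/m is 1.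
omit [Fintype ι] [DecidableEq ι] in
lemma vartheta_top (hm : m ≠ 0) : vartheta f (m + n) = psi f (m + n) := by
  have hm' : (m : ℂ) ≠ 0 := by exact_mod_cast hm
  refine sum_congr rfl fun x hx => ?_
  rw [HasAntidiagonal.mem_antidiagonal] at hx
  congr 1
  rcases lt_trichotomy x.1 m with h | h | h
  · simp [Nat.choose_eq_zero_of_lt (show n < x.2 by omega)]
  · rw [h, div_self hm', one_mul]
  · simp [Nat.choose_eq_zero_of_lt h]

omit [Fintype ι] [DecidableEq ι] in
lemma varsigma_top (hm : m ≠ 0) (hmn : m = n) : varsigma f (m + n) = varphi f (m + n) := by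
  have hm' : (m : ℂ) ≠ 0 := by exact_mod_cast hm
  refine sum_congr rfl fun x hx => ?_
  rw [HasAntidiagonal.mem_antidiagonal] at hx
  congr 1
  rcases lt_trichotomy x.1 m with h | h | h
  · simp [Nat.choose_eq_zero_of_lt (show n < x.2 by omega)]
  · rw [h, div_self hm', one_mul]
  · simp [Nat.choose_eq_zero_of_lt h]

omit [Fintype ι] [DecidableEq ι] in
lemma sum_range_eq_add_sum_Icc_add {M : Type*} [AddCommMonoid M] {l : ℕ} (hl : 1 ≤ l)
    (T : ℕ → M) :
    ∑ r ∈ range (l + 1), T r = T 0 + ∑ r ∈ Icc 1 (l - 1), T r + T l := by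
  have h : Icc 1 (l - 1) = Ico 1 l := by ext; simp; omega
  rw [sum_range_succ, range_eq_Ico, sum_eq_sum_Ico_succ_bot (by omega), h]

-- In the box the condition 0 < i + j < m + n excludes just the corners (0,0) and (m,n), which are
-- distinct since m + n ≥ 1.
omit [Fintype ι] [DecidableEq ι] in
lemma sum_product_range_eq {M : Type*} [AddCommMonoid M] {m n : ℕ} (hmn : 1 ≤ m + n)
    (S : ℕ × ℕ → M) :
    ∑ x ∈ range (m + 1) ×ˢ range (n + 1), S x = S (0, 0) +
      ∑ x ∈ range (m + 1) ×ˢ range (n + 1) with 0 < x.1 + x.2 ∧ x.1 + x.2 < m + n, S x +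
        S (m, n) := by
  rw [← sum_filter_add_sum_filter_not _ (fun x => 0 < x.1 + x.2 ∧ x.1 + x.2 < m + n)]
  have h : {x ∈ range (m + 1) ×ˢ range (n + 1) | ¬(0 < x.1 + x.2 ∧ x.1 + x.2 < m + n)} =
      {((0, 0) : ℕ × ℕ), (m, n)} := by
    ext ⟨i, j⟩
    simp only [mem_filter, mem_product, mem_range, mem_insert, mem_singleton, Prod.mk.injEq]
    omega
  rw [h, sum_pair (by simp only [ne_eq, Prod.mk.injEq]; omega), add_right_comm, add_comm]

/-- In the ψ-expansion the term r = m + n is (E|F|²)². The term r = 0 is a sum over contractions of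
`f` with itself, whose corner (0,0) is the second copy of (E|F|²)² and whose corner (m,n) is |E
F²|². -/
theorem first_expansion (hf : IsSymmetric f) (hmn : 1 ≤ m + n) {M : ℝ}
    (hM : gaussE (wick (kernelPoly ⇑f) * wick (kernelPoly ⇑(revConj f)) *
      (wick (kernelPoly ⇑f) * wick (kernelPoly ⇑(revConj f)))) = (M : ℂ)) :
    M - 2 * (m.factorial * n.factorial * ‖f‖ ^ 2) ^ 2 -
        ‖gaussE (wick (kernelPoly ⇑f) * wick (kernelPoly ⇑f))‖ ^ 2 =
      (∑ x ∈ range (min m n + 1) ×ˢ range (min m n + 1) with 0 < x.1 + x.2 ∧ x.1 + x.2 < m + n,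
          (m.choose x.1 : ℝ) * (n.choose x.1 : ℝ) * (n.choose x.2 : ℝ) * (m.choose x.2 : ℝ)
            * ((m.factorial : ℝ) * (n.factorial : ℝ)) ^ 2 * ‖contraction f f x.1 x.2‖ ^ 2)
        + ∑ r ∈ Icc 1 (m + n - 1), ((m + n - r).factorial : ℝ) ^ 2 * ‖psi f r‖ ^ 2 := by
  rw [gaussE_fourth_eq_psi hf] at hM
  rw [← Complex.ofReal_injective hM, sum_range_eq_add_sum_Icc_add hmn, norm_psi_top hf,
    norm_psi_zero hf, sum_product_range_eq hmn, norm_contraction_zero]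
  -- The box shrinks because C(n, i) or C(m, j) vanishes outside the smaller one.
  have h1 : ∑ x ∈ range (m + 1) ×ˢ range (n + 1) with 0 < x.1 + x.2 ∧ x.1 + x.2 < m + n,
        (m.choose x.1 : ℝ) * (n.choose x.1 : ℝ) * (n.choose x.2 : ℝ) * (m.choose x.2 : ℝ)
          * ((m.factorial : ℝ) * (n.factorial : ℝ)) ^ 2 * ‖contraction f f x.1 x.2‖ ^ 2 =
      ∑ x ∈ range (min m n + 1) ×ˢ range (min m n + 1) with 0 < x.1 + x.2 ∧ x.1 + x.2 < m + n,
        (m.choose x.1 : ℝ) * (n.choose x.1 : ℝ) * (n.choose x.2 : ℝ) * (m.choose x.2 : ℝ)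
          * ((m.factorial : ℝ) * (n.factorial : ℝ)) ^ 2 * ‖contraction f f x.1 x.2‖ ^ 2 := by
    refine (sum_subset (fun x => ?_) fun x hx hx' => ?_).symm
    · simp only [mem_filter, mem_product, mem_range]
      omega
    · simp only [mem_filter, mem_product, mem_range] at hx hx'
      have : n < x.1 ∨ m < x.2 := by omega
      rcases this with h | h <;> simp [Nat.choose_eq_zero_of_lt h]
  -- For m ≠ n both sides are zero: C(n, m) or C(m, n) vanishes, and F and its conjugate have
  -- different orders.
  have h2 : (m.choose m : ℝ) * (n.choose m : ℝ) * (n.choose n : ℝ) * (m.choose n : ℝ)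
      * ((m.factorial : ℝ) * (n.factorial : ℝ)) ^ 2 * ‖contraction f f m n‖ ^ 2 =
      ‖gaussE (wick (kernelPoly ⇑f) * wick (kernelPoly ⇑f))‖ ^ 2 := by
    by_cases h : m = n
    · subst h
      rw [gaussE_wick_mul_wick hf hf]
      simp
      ring
    · rw [gaussE_wick_mul_self_of_ne hf h]
      rcases lt_or_gt_of_ne h with h | h <;> simp [Nat.choose_eq_zero_of_lt h]
  rw [h1, h2]
  simp
  ring

/-- In the φ-expansion both corners of the term r = 0 equal (E|F|²)², the second one because
contracting `f` fully with h gives ‖f‖². The remaining |E F²|² is the kernel of order zero. -/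
theorem second_expansion (hf : IsSymmetric f) (hmn : 1 ≤ m + n) {M : ℝ}
    (hM : gaussE (wick (kernelPoly ⇑f) * wick (kernelPoly ⇑(revConj f)) *
      (wick (kernelPoly ⇑f) * wick (kernelPoly ⇑(revConj f)))) = (M : ℂ)) :
    M - 2 * (m.factorial * n.factorial * ‖f‖ ^ 2) ^ 2 -
        ‖gaussE (wick (kernelPoly ⇑f) * wick (kernelPoly ⇑f))‖ ^ 2 =
      (∑ x ∈ range (m + 1) ×ˢ range (n + 1) with 0 < x.1 + x.2 ∧ x.1 + x.2 < m + n,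
          (m.choose x.1 : ℝ) ^ 2 * (n.choose x.2 : ℝ) ^ 2
            * ((m.factorial : ℝ) * (n.factorial : ℝ)) ^ 2
            * ‖contraction f (revConj f) x.1 x.2‖ ^ 2)
        + ∑ r ∈ Icc 1 (min (2 * min m n) (m + n - 1)),
            ((2 * m - r).factorial : ℝ) * ((2 * n - r).factorial : ℝ) * ‖varphi f r‖ ^ 2 := by
  rw [gaussE_fourth_eq_varphi hf] at hM
  have h0 : ‖revConj f‖ = ‖f‖ := by
    have : ‖revConj f‖ ^ 2 = ‖f‖ ^ 2 := by
      rw [norm_sq_eq_sum, norm_sq_eq_sum]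
      exact Fintype.sum_equiv (Equiv.prodComm _ _) _ _ fun x => by
        rw [← RCLike.norm_conj (f _)]
        rfl
    exact (pow_left_inj₀ (norm_nonneg _) (norm_nonneg _) two_ne_zero).1 this
  have h1 := norm_varphi_zero hf
  rw [sum_product_range_eq hmn, norm_contraction_zero, h0, Nat.choose_self, Nat.choose_self] at h1
  have h2 := norm_contraction_revConj_top hf
  -- A kernel of order zero occurs only for m = n, when the range ends at r = m + n and the last
  -- term is |E F²|². Otherwise 2 min m n < m + n, no term is split off at the top, and E F² = 0.
  have h3 : ∑ r ∈ range (2 * min m n + 1), ((2 * m - r).factorial : ℝ) *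
        ((2 * n - r).factorial : ℝ) * ‖varphi f r‖ ^ 2 =
      ((2 * m - 0).factorial : ℝ) * ((2 * n - 0).factorial : ℝ) * ‖varphi f 0‖ ^ 2 +
        ∑ r ∈ Icc 1 (min (2 * min m n) (m + n - 1)),
          ((2 * m - r).factorial : ℝ) * ((2 * n - r).factorial : ℝ) * ‖varphi f r‖ ^ 2 +
        ‖gaussE (wick (kernelPoly ⇑f) * wick (kernelPoly ⇑f))‖ ^ 2 := by
    by_cases h : m = n
    · rw [← norm_varphi_top hf h, show 2 * min m n = m + n by omega,
        sum_range_eq_add_sum_Icc_add hmn, show min (m + n) (m + n - 1) = m + n - 1 by omega,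
        show (2 * m - (m + n)).factorial = 1 by rw [show 2 * m - (m + n) = 0 by omega]; rfl,
        show (2 * n - (m + n)).factorial = 1 by rw [show 2 * n - (m + n) = 0 by omega]; rfl]
      simp
    · rw [gaussE_wick_mul_self_of_ne hf h, show min (2 * min m n) (m + n - 1) = 2 * min m n by omega,
        range_eq_Ico, sum_eq_sum_Ico_succ_bot (by omega),
        show Ico (0 + 1) (2 * min m n + 1) = Icc 1 (2 * min m n) by ext; simp]
      simp
  rw [← Complex.ofReal_injective hM, h3, h1]
  have h4 := congrArg (· ^ 2) h2
  simp only [mul_pow] at h4 ⊢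
  simp only [Nat.choose_zero_right, Nat.cast_one]
  linear_combination h4

/-- The weight i removes the terms r = 0. At the top ϑ and ψ coincide, as do ς and φ when m = n, so
these terms are 2(E|F|²)² and |E F²|². -/
theorem third_expansion (hf : IsSymmetric f) (hm : 1 ≤ m) {M : ℝ}
    (hM : gaussE (wick (kernelPoly ⇑f) * wick (kernelPoly ⇑(revConj f)) *
      (wick (kernelPoly ⇑f) * wick (kernelPoly ⇑(revConj f)))) = (M : ℂ)) :
    ((M - 2 * (m.factorial * n.factorial * ‖f‖ ^ 2) ^ 2 -
        ‖gaussE (wick (kernelPoly ⇑f) * wick (kernelPoly ⇑f))‖ ^ 2 : ℝ) : ℂ) =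
      2 * (∑ r ∈ Icc 1 (m + n - 1),
          ((m + n - r).factorial : ℂ) ^ 2 * inner ℂ (psi f r) (vartheta f r))
        + ∑ r ∈ Icc 1 (min (2 * min m n) (m + n - 1)),
            ((2 * m - r).factorial : ℂ) * ((2 * n - r).factorial : ℂ)
              * inner ℂ (varphi f r) (varsigma f r) := by
  have hmn : 1 ≤ m + n := by omega
  have hm' : m ≠ 0 := by omega
  rw [gaussE_fourth_eq_inner hf hm'] at hM
  have h3 : ∑ r ∈ range (2 * min m n + 1), ((2 * m - r).factorial : ℂ) *
        ((2 * n - r).factorial : ℂ) * inner ℂ (varphi f r) (varsigma f r) =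
        ∑ r ∈ Icc 1 (min (2 * min m n) (m + n - 1)),
          ((2 * m - r).factorial : ℂ) * ((2 * n - r).factorial : ℂ) *
            inner ℂ (varphi f r) (varsigma f r) +
        ((‖gaussE (wick (kernelPoly ⇑f) * wick (kernelPoly ⇑f))‖ ^ 2 : ℝ) : ℂ) := by
    by_cases h : m = n
    · rw [← norm_varphi_top hf h, ← inner_self_eq_ofReal, show 2 * min m n = m + n by omega,
        sum_range_eq_add_sum_Icc_add hmn, show min (m + n) (m + n - 1) = m + n - 1 by omega,
        varsigma_zero, varsigma_top hm' h]
      rw [show (2 * m - (m + n)).factorial = 1 by rw [show 2 * m - (m + n) = 0 by omega]; rfl,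
        show (2 * n - (m + n)).factorial = 1 by rw [show 2 * n - (m + n) = 0 by omega]; rfl]
      simp
    · rw [gaussE_wick_mul_self_of_ne hf h, show min (2 * min m n) (m + n - 1) = 2 * min m n by omega,
        range_eq_Ico, sum_eq_sum_Ico_succ_bot (by omega), varsigma_zero,
        show Ico (0 + 1) (2 * min m n + 1) = Icc 1 (2 * min m n) by ext; simp]
      simp
  rw [h3, sum_range_eq_add_sum_Icc_add hmn, vartheta_zero, vartheta_top hm', inner_self_eq_ofReal,
    norm_psi_top hf] at hM
  push_cast at hM ⊢
  rw [← hM, Nat.sub_self, inner_zero_right]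
  simp
  ring

end FiniteMoments

/-! ### Continuity of the kernel operations -/

section KernelNorms

variable {ι : Type*} {a b c d : ℕ}

lemma norm_sq_eq_tsum {X : Type*} (f : lp (fun _ : X => ℂ) 2) : ‖f‖ ^ 2 = ∑' x, ‖f x‖ ^ 2 := by
  have h := lp.norm_rpow_eq_tsum (p := 2) (by norm_num) f
  simpa using h

lemma norm_permute (σ : Equiv.Perm (Fin a)) (τ : Equiv.Perm (Fin b)) (f : ChaosKernel ι a b) :
    ‖permute σ τ f‖ = ‖f‖ := by
  have h : ‖permute σ τ f‖ ^ 2 = ‖f‖ ^ 2 := by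
    rw [norm_sq_eq_tsum, norm_sq_eq_tsum]
    exact ((Equiv.arrowCongr σ.symm (Equiv.refl ι)).prodCongr
      (Equiv.arrowCongr τ.symm (Equiv.refl ι))).tsum_eq fun x => ‖f x‖ ^ 2
  exact (pow_left_inj₀ (norm_nonneg _) (norm_nonneg _) two_ne_zero).1 h

/-- Symmetrization as a linear map. -/
def symmetrizeₗ : ChaosKernel ι a b →ₗ[ℂ] ChaosKernel ι a b where
  toFun := symmetrize
  map_add' f g := by
    have h : ∀ σ τ, permute σ τ (f + g) = permute σ τ f + permute σ τ g := fun _ _ => rfl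
    simp only [symmetrize, h, sum_add_distrib, smul_add]
  map_smul' z f := by
    have h : ∀ σ τ, permute σ τ (z • f) = z • permute σ τ f := fun _ _ => rfl
    simp only [symmetrize, h, ← smul_sum, RingHom.id_apply]
    rw [smul_comm]

lemma norm_symmetrize_le (f : ChaosKernel ι a b) : ‖symmetrize f‖ ≤ ‖f‖ := by
  have h0 : ((a.factorial * b.factorial : ℕ) : ℝ) ≠ 0 := by
    exact_mod_cast (Nat.mul_pos a.factorial_pos b.factorial_pos).ne'
  rw [symmetrize, norm_smul, norm_inv, Complex.norm_natCast]
  refine (mul_le_mul_of_nonneg_left (norm_sum_le_of_le _ fun σ _ => norm_sum_le_of_le _ fun τ _ =>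
    (norm_permute σ τ f).le) (by positivity)).trans_eq ?_
  simp only [sum_const, card_univ, Fintype.card_perm, Fintype.card_fin, nsmul_eq_mul]
  push_cast at h0 ⊢
  field_simp

lemma continuous_symmetrize : Continuous (symmetrize : ChaosKernel ι a b → ChaosKernel ι a b) :=
  (symmetrizeₗ.mkContinuous 1 fun f => (norm_symmetrize_le f).trans_eq (one_mul _).symm).continuous

lemma norm_toOrder_le (m n : ℕ) (f : ChaosKernel ι a b) : ‖toOrder m n f‖ ≤ ‖f‖ := by
  unfold toOrder
  split_ifs with h
  · obtain ⟨rfl, rfl⟩ := h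
    exact le_rfl
  · simp

lemma continuous_toOrder (m n : ℕ) :
    Continuous (toOrder m n : ChaosKernel ι a b → ChaosKernel ι m n) := by
  by_cases h : a = m ∧ b = n
  · obtain ⟨rfl, rfl⟩ := h
    have : (toOrder a b : ChaosKernel ι a b → ChaosKernel ι a b) = id := by
      funext f
      rw [toOrder, dif_pos ⟨rfl, rfl⟩]
      rfl
    rw [this]
    exact continuous_id
  · have : (toOrder m n : ChaosKernel ι a b → ChaosKernel ι m n) = fun _ => 0 := by
      funext f
      rw [toOrder, dif_neg h]
    rw [this]
    exact continuous_const

lemma norm_revConj (f : ChaosKernel ι a b) : ‖revConj f‖ = ‖f‖ := by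
  have h : ‖revConj f‖ ^ 2 = ‖f‖ ^ 2 := by
    rw [norm_sq_eq_tsum, norm_sq_eq_tsum, ← (Equiv.prodComm _ _).tsum_eq fun x => ‖f x‖ ^ 2]
    exact tsum_congr fun x => by rw [← RCLike.norm_conj (f _)]; rfl
  exact (pow_left_inj₀ (norm_nonneg _) (norm_nonneg _) two_ne_zero).1 h

lemma revConj_sub (f g : ChaosKernel ι a b) : revConj (f - g) = revConj f - revConj g := by
  ext x
  exact map_sub (starRingEnd ℂ) _ _

lemma continuous_revConj : Continuous (revConj : ChaosKernel ι a b → ChaosKernel ι b a) :=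
  (Isometry.of_dist_eq fun f g => by
    rw [dist_eq_norm, dist_eq_norm, ← revConj_sub, norm_revConj]).continuous

lemma summable_mul_of_memlp {W : Type*} {F G : W → ℂ} (hF : Memℓp F 2) (hG : Memℓp G 2) :
    Summable fun w => F w * G w := by
  rw [memlp_iff] at hF hG
  refine Summable.of_norm_bounded (hF.add hG) fun w => ?_
  rw [norm_mul]
  nlinarith [sq_nonneg (‖F w‖ - ‖G w‖), sq_nonneg (‖F w‖), sq_nonneg (‖G w‖)]

lemma norm_tsum_mul_sq_le {W : Type*} {F G : W → ℂ} (hF : Memℓp F 2) (hG : Memℓp G 2) :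
    ‖∑' w, F w * G w‖ ^ 2 ≤ (∑' w, ‖F w‖ ^ 2) * ∑' w, ‖G w‖ ^ 2 := by
  have hF' : Memℓp (fun w => conj (F w)) 2 := by
    rw [memlp_iff] at hF ⊢
    simpa using hF
  have h := norm_inner_le_norm (𝕜 := ℂ) (⟨_, hF'⟩ : lp (fun _ : W => ℂ) 2)
    (⟨G, hG⟩ : lp (fun _ : W => ℂ) 2)
  rw [lp.inner_eq_tsum] at h
  have h2 := pow_le_pow_left₀ (norm_nonneg _) h 2
  rw [mul_pow, norm_sq_eq_tsum, norm_sq_eq_tsum] at h2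
  simpa [mul_comm] using h2

/-- Cauchy–Schwarz over the contracted variable, then summation over the two free variables
independently. -/
lemma tsum_contract_le {X Y W : Type*} {F : X × W → ℂ} {G : Y × W → ℂ} (hF : Memℓp F 2)
    (hG : Memℓp G 2) : ∑' z : X × Y, ‖∑' w, F (z.1, w) * G (z.2, w)‖ ^ 2 ≤
      (∑' x, ‖F x‖ ^ 2) * ∑' y, ‖G y‖ ^ 2 := by
  have hF1 : ∀ x, Memℓp (fun w => F (x, w)) 2 := fun x =>
    memlp_comp (φ := fun w => (x, w)) hF (Prod.mk_right_injective x)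
  have hG1 : ∀ y, Memℓp (fun w => G (y, w)) 2 := fun y =>
    memlp_comp (φ := fun w => (y, w)) hG (Prod.mk_right_injective y)
  have hc : Summable fun z : X × Y => ‖∑' w, F (z.1, w) * G (z.2, w)‖ ^ 2 :=
    memlp_iff.1 (memlp_contract hF hG)
  have hF2 : Summable fun x => ‖F x‖ ^ 2 := memlp_iff.1 hF
  have hG2 : Summable fun y => ‖G y‖ ^ 2 := memlp_iff.1 hG
  have hF3 : Summable fun x => ∑' w, ‖F (x, w)‖ ^ 2 := hF2.prod
  have hG3 : Summable fun y => ∑' w, ‖G (y, w)‖ ^ 2 := hG2.prod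
  have key : Summable fun z : X × Y => (∑' w, ‖F (z.1, w)‖ ^ 2) * ∑' w, ‖G (z.2, w)‖ ^ 2 :=
    Summable.mul_of_nonneg hF3 hG3 (fun x => tsum_nonneg fun w => by positivity)
      (fun y => tsum_nonneg fun w => by positivity)
  have h1 : ∑' x, ‖F x‖ ^ 2 = ∑' x, ∑' w, ‖F (x, w)‖ ^ 2 := hF2.tsum_prod
  have h2 : ∑' y, ‖G y‖ ^ 2 = ∑' y, ∑' w, ‖G (y, w)‖ ^ 2 := hG2.tsum_prod
  rw [h1, h2, hF3.tsum_mul_tsum hG3 key]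
  exact hc.tsum_le_tsum (fun z => norm_tsum_mul_sq_le (hF1 z.1) (hG1 z.2)) key

variable {i j : ℕ}

/-- The two factors of a contraction, as arrays of free and contracted variables. -/
lemma exists_contraction_factors (h : (i ≤ a ∧ i ≤ d) ∧ (j ≤ b ∧ j ≤ c)) :
    ∃ (φ : ((Fin (a - i) → ι) × (Fin (b - j) → ι)) × ((Fin i → ι) × (Fin j → ι)) →
        (Fin a → ι) × (Fin b → ι))
      (χ : ((Fin (c - j) → ι) × (Fin (d - i) → ι)) × ((Fin i → ι) × (Fin j → ι)) →
        (Fin c → ι) × (Fin d → ι))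
      (ξ : (Fin ((a - i) + (c - j)) → ι) × (Fin ((b - j) + (d - i)) → ι) →
        ((Fin (a - i) → ι) × (Fin (b - j) → ι)) × ((Fin (c - j) → ι) × (Fin (d - i) → ι))),
      Function.Injective φ ∧ Function.Injective χ ∧ Function.Injective ξ ∧
      ∀ (f : ChaosKernel ι a b) (g : ChaosKernel ι c d) x,
        contraction f g i j x = ∑' w, f (φ ((ξ x).1, w)) * g (χ ((ξ x).2, w)) := by
  refine ⟨fun y => (join h.1.1 y.1.1 y.2.1, join h.2.1 y.1.2 y.2.2),
    fun y => (join h.2.2 y.1.1 y.2.2, join h.1.2 y.1.2 y.2.1),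
    fun x => ((x.1 ∘ Fin.castAdd _, x.2 ∘ Fin.castAdd _), (x.1 ∘ Fin.natAdd _, x.2 ∘ Fin.natAdd _)),
    ?_, ?_, ?_, fun f g x => ?_⟩
  · rintro ⟨⟨p, q⟩, u, v⟩ ⟨⟨p', q'⟩, u', v'⟩ h'
    obtain ⟨h1, h2⟩ := Prod.ext_iff.1 h'
    obtain ⟨rfl, rfl⟩ := join_injective h.1.1 h1
    obtain ⟨rfl, rfl⟩ := join_injective h.2.1 h2
    rfl
  · rintro ⟨⟨p, q⟩, u, v⟩ ⟨⟨p', q'⟩, u', v'⟩ h'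
    obtain ⟨h1, h2⟩ := Prod.ext_iff.1 h'
    obtain ⟨rfl, rfl⟩ := join_injective h.2.2 h1
    obtain ⟨rfl, rfl⟩ := join_injective h.1.2 h2
    rfl
  · rintro ⟨p, q⟩ ⟨p', q'⟩ h
    simp only [Prod.mk.injEq] at h
    obtain ⟨⟨h1, h2⟩, h3, h4⟩ := h
    refine Prod.ext (funext fun k => ?_) (funext fun k => ?_)
    · exact Fin.addCases (fun k => congrFun h1 k) (fun k => congrFun h3 k) k
    · exact Fin.addCases (fun k => congrFun h2 k) (fun k => congrFun h4 k) k
  · rw [contraction, dif_pos h]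

/-- Both factors and the free variables are injective reindexings, and restricting a sum of squares
along an injection can only decrease it. -/
lemma norm_contraction_le (f : ChaosKernel ι a b) (g : ChaosKernel ι c d) :
    ‖contraction f g i j‖ ≤ ‖f‖ * ‖g‖ := by
  by_cases h : (i ≤ a ∧ i ≤ d) ∧ (j ≤ b ∧ j ≤ c)
  · obtain ⟨φ, χ, ξ, hφ, hχ, hξ, hfg⟩ := exists_contraction_factors (ι := ι) h
    have hF := memlp_comp (lp.memℓp f) hφ
    have hG := memlp_comp (lp.memℓp g) hχ
    have h1 := memlp_iff.1 (memlp_contract hF hG)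
    have h2 : ‖contraction f g i j‖ ^ 2 ≤ (‖f‖ * ‖g‖) ^ 2 := by
      rw [norm_sq_eq_tsum, mul_pow, norm_sq_eq_tsum f, norm_sq_eq_tsum g]
      simp only [hfg]
      refine (tsum_comp_le_tsum_of_inj h1 (fun _ => by positivity) hξ).trans
        ((tsum_contract_le hF hG).trans ?_)
      refine mul_le_mul (tsum_comp_le_tsum_of_inj (memlp_iff.1 (lp.memℓp f))
        (fun _ => by positivity) hφ) (tsum_comp_le_tsum_of_inj (memlp_iff.1 (lp.memℓp g))
        (fun _ => by positivity) hχ) (tsum_nonneg fun _ => by positivity)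
        (tsum_nonneg fun _ => by positivity)
    exact (pow_le_pow_iff_left₀ (norm_nonneg _) (by positivity) two_ne_zero).1 h2
  · rw [contraction_of_not f g h, norm_zero]
    positivity

/-- The contraction as a bilinear map. -/
def contractionₗ (i j : ℕ) : ChaosKernel ι a b →ₗ[ℂ] ChaosKernel ι c d →ₗ[ℂ]
    ChaosKernel ι ((a - i) + (c - j)) ((b - j) + (d - i)) := by
  refine LinearMap.mk₂ ℂ (fun f g => contraction f g i j) ?_ ?_ ?_ ?_ <;>
  by_cases h : (i ≤ a ∧ i ≤ d) ∧ (j ≤ b ∧ j ≤ c)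
  any_goals
    intros
    simp only [contraction_of_not _ _ h]
    simp
  all_goals
    obtain ⟨φ, χ, ξ, hφ, hχ, hξ, hfg⟩ := exists_contraction_factors (ι := ι) h
    have hs : ∀ (f : ChaosKernel ι a b) (g : ChaosKernel ι c d) x,
        Summable fun w => f (φ ((ξ x).1, w)) * g (χ ((ξ x).2, w)) := fun f g x =>
      summable_mul_of_memlp
        (memlp_comp (lp.memℓp f) (hφ.comp (Prod.mk_right_injective (ξ x).1)))
        (memlp_comp (lp.memℓp g) (hχ.comp (Prod.mk_right_injective (ξ x).2)))
  · intro f f' g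
    ext x
    simp only [hfg, lp.coeFn_add, Pi.add_apply, add_mul]
    exact (hs f g x).tsum_add (hs f' g x)
  · intro z f g
    ext x
    simp only [hfg, lp.coeFn_smul, Pi.smul_apply, smul_eq_mul, mul_assoc]
    exact tsum_mul_left
  · intro f g g'
    ext x
    simp only [hfg, lp.coeFn_add, Pi.add_apply, mul_add]
    exact (hs f g x).tsum_add (hs f g' x)
  · intro z f g
    ext x
    simp only [hfg, lp.coeFn_smul, Pi.smul_apply, smul_eq_mul, mul_left_comm _ z]
    exact tsum_mul_left

lemma continuous_contraction : Continuous fun x : ChaosKernel ι a b × ChaosKernel ι c d =>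
    contraction x.1 x.2 i j :=
  ((contractionₗ i j).mkContinuous₂ 1 fun f g => by
    rw [one_mul]; exact norm_contraction_le f g).continuous₂

end KernelNorms

/-! ### Continuity and bounds for the kernels ψ, ϑ, φ, ς -/

section FourthMomentKernels

variable {ι : Type*} {m n : ℕ} (r : ℕ)

lemma continuous_contraction_self (i j : ℕ) :
    Continuous fun f : ChaosKernel ι m n => contraction f f i j :=
  continuous_contraction.comp (continuous_id.prodMk continuous_id)

lemma continuous_contraction_revConj (i j : ℕ) :
    Continuous fun f : ChaosKernel ι m n => contraction f (revConj f) i j :=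
  continuous_contraction.comp (continuous_id.prodMk continuous_revConj)

lemma continuous_sum_smul_toOrder {X κ : Type*} [TopologicalSpace X] (s : Finset κ) (z : κ → ℂ)
    {a b : κ → ℕ} {F : ∀ k, X → ChaosKernel ι (a k) (b k)} (hF : ∀ k, Continuous (F k))
    (m n : ℕ) : Continuous fun x => ∑ k ∈ s, z k • toOrder m n (symmetrize (F k x)) := by
  refine continuous_finsetSum _ fun k _ => ?_
  have h : Continuous fun x => toOrder m n (symmetrize (F k x)) :=
    (continuous_toOrder m n).comp (continuous_symmetrize.comp (hF k))
  exact h.const_smul (z k)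

lemma continuous_psi : Continuous fun f : ChaosKernel ι m n => psi f r :=
  continuous_sum_smul_toOrder _ _ (fun x : ℕ × ℕ => continuous_contraction_revConj x.1 x.2) _ _

lemma continuous_vartheta : Continuous fun f : ChaosKernel ι m n => vartheta f r :=
  continuous_sum_smul_toOrder _ _ (fun x : ℕ × ℕ => continuous_contraction_revConj x.1 x.2) _ _

lemma continuous_varphi : Continuous fun f : ChaosKernel ι m n => varphi f r :=
  continuous_sum_smul_toOrder _ _ (fun x : ℕ × ℕ => continuous_contraction_self x.1 x.2) _ _

lemma continuous_varsigma : Continuous fun f : ChaosKernel ι m n => varsigma f r :=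
  continuous_sum_smul_toOrder _ _ (fun x : ℕ × ℕ => continuous_contraction_self x.1 x.2) _ _

/-- A bound for the norm of `f ↦ psi f r`. -/
def psiBound (m n r : ℕ) : ℝ :=
  ∑ x ∈ antidiagonal r, ‖(m.choose x.1 : ℂ) ^ 2 * (n.choose x.2 : ℂ) ^ 2
        * (x.1.factorial : ℂ) * (x.2.factorial : ℂ)‖

/-- Through the ψ-expansion this quadratic bound yields the L⁴ estimate for the integral. -/
lemma norm_psi_le (f : ChaosKernel ι m n) : ‖psi f r‖ ≤ psiBound m n r * ‖f‖ ^ 2 := by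
  rw [psiBound, sum_mul]
  refine norm_sum_le_of_le _ fun x _ => ?_
  rw [norm_smul]
  refine mul_le_mul_of_nonneg_left ?_ (norm_nonneg _)
  refine (norm_toOrder_le _ _ _).trans ((norm_symmetrize_le _).trans
    ((norm_contraction_le _ _).trans_eq ?_))
  rw [norm_revConj, sq]

end FourthMomentKernels

/-! ### Restriction of kernels to finitely many modes -/

section Restriction

variable {ι : Type*} {a b c d : ℕ} (S : Finset ι)

/-- The restriction of a kernel to the indices in `S`. -/
def restrict : ChaosKernel ι a b →ₗ[ℂ] ChaosKernel S a b where
  toFun f := ⟨fun x => f (Subtype.val ∘ x.1, Subtype.val ∘ x.2),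
    memlp_comp (lp.memℓp f) (Subtype.val_injective.comp_left.prodMap
      Subtype.val_injective.comp_left)⟩
  map_add' _ _ := rfl
  map_smul' _ _ := rfl

lemma restrict_apply (f : ChaosKernel ι a b) (x : (Fin a → S) × (Fin b → S)) :
    restrict S f x = f (Subtype.val ∘ x.1, Subtype.val ∘ x.2) := rfl

/-- The kernels that vanish outside of the indices in `S`. -/
def supportedIn : Submodule ℂ (ChaosKernel ι a b) where
  carrier := {f | ∀ x, f x ≠ 0 → (∀ s, x.1 s ∈ S) ∧ ∀ s, x.2 s ∈ S}
  add_mem' {f g} hf hg x hx := by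
    by_cases h : f x = 0
    · exact hg x fun h' => hx (by rw [lp.coeFn_add, Pi.add_apply, h, h', add_zero])
    · exact hf x h
  zero_mem' x hx := (hx rfl).elim
  smul_mem' z f hf x hx := hf x fun h => hx (by rw [lp.coeFn_smul, Pi.smul_apply, h, smul_zero])

variable {S}

lemma injective_coe_comp : Function.Injective
    fun x : (Fin a → S) × (Fin b → S) => ((Subtype.val ∘ x.1 : Fin a → ι), (Subtype.val ∘ x.2 : Fin b → ι)) :=
  Subtype.val_injective.comp_left.prodMap Subtype.val_injective.comp_left

lemma tsum_restrict {M : Type*} [AddCommMonoid M] [TopologicalSpace M]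
    {φ : (Fin a → ι) × (Fin b → ι) → M}
    (h : ∀ x, φ x ≠ 0 → (∀ s, x.1 s ∈ S) ∧ ∀ s, x.2 s ∈ S) :
    ∑' x : (Fin a → S) × (Fin b → S), φ (Subtype.val ∘ x.1, Subtype.val ∘ x.2) = ∑' x, φ x :=
  (injective_coe_comp (S := S)).tsum_eq fun x hx =>
    ⟨(fun s => ⟨x.1 s, (h x hx).1 s⟩, fun s => ⟨x.2 s, (h x hx).2 s⟩), rfl⟩

lemma norm_restrict {f : ChaosKernel ι a b} (hf : f ∈ supportedIn S) : ‖restrict S f‖ = ‖f‖ := by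
  have h : ‖restrict S f‖ ^ 2 = ‖f‖ ^ 2 := by
    rw [norm_sq_eq_tsum, norm_sq_eq_tsum]
    exact tsum_restrict (φ := fun x => ‖f x‖ ^ 2) fun x hx => hf x fun h => hx (by simp [h])
  exact (pow_left_inj₀ (norm_nonneg _) (norm_nonneg _) two_ne_zero).1 h

lemma inner_restrict {f : ChaosKernel ι a b} (hf : f ∈ supportedIn S) (g : ChaosKernel ι a b) :
    inner ℂ (restrict S f) (restrict S g) = inner ℂ f g := by
  rw [lp.inner_eq_tsum, lp.inner_eq_tsum]
  exact tsum_restrict (φ := fun x => inner ℂ (f x) (g x)) fun x hx => hf x fun h => hx (by simp [h])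

lemma isSymmetric_restrict {f : ChaosKernel ι a b} (hf : IsSymmetric f) :
    IsSymmetric (restrict S f) :=
  fun σ τ p q => hf σ τ (Subtype.val ∘ p) (Subtype.val ∘ q)

lemma restrict_revConj (f : ChaosKernel ι a b) : restrict S (revConj f) = revConj (restrict S f) :=
  rfl

lemma revConj_mem_supportedIn {f : ChaosKernel ι a b} (hf : f ∈ supportedIn S) :
    revConj f ∈ supportedIn S := fun x hx =>
  (hf (x.2, x.1) fun h => hx (by simp [revConj, h])).symm

lemma restrict_symmetrize (f : ChaosKernel ι a b) :
    restrict S (symmetrize f) = symmetrize (restrict S f) := by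
  simp only [symmetrize, map_smul, map_sum]
  rfl

lemma symmetrize_mem_supportedIn {f : ChaosKernel ι a b} (hf : f ∈ supportedIn S) :
    symmetrize f ∈ supportedIn S := by
  refine Submodule.smul_mem _ _ (Submodule.sum_mem _ fun σ _ => Submodule.sum_mem _ fun τ _ => ?_)
  intro x hx
  obtain ⟨h1, h2⟩ := hf (x.1 ∘ σ, x.2 ∘ τ) hx
  exact ⟨fun s => by simpa using h1 (σ.symm s), fun s => by simpa using h2 (τ.symm s)⟩

lemma restrict_toOrder (m n : ℕ) (f : ChaosKernel ι a b) :
    restrict S (toOrder m n f) = toOrder m n (restrict S f) := by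
  unfold toOrder
  split_ifs with h
  · rfl
  · rfl

lemma toOrder_mem_supportedIn (m n : ℕ) {f : ChaosKernel ι a b} (hf : f ∈ supportedIn S) :
    toOrder m n f ∈ supportedIn S := by
  unfold toOrder
  split_ifs with h
  · obtain ⟨rfl, rfl⟩ := h
    exact hf
  · exact Submodule.zero_mem _

lemma coe_comp_join {i : ℕ} (h : i ≤ a) (p : Fin (a - i) → S) (u : Fin i → S) :
    (Subtype.val ∘ join h p u : Fin a → ι) = join h (Subtype.val ∘ p) (Subtype.val ∘ u) := by
  funext s
  obtain ⟨s, rfl⟩ := (finCongr (Nat.sub_add_cancel h)).surjective s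
  refine Fin.addCases (fun s => ?_) (fun s => ?_) s <;> simp [join]

lemma join_left {i : ℕ} (h : i ≤ a) (p : Fin (a - i) → ι) (u : Fin i → ι) (s : Fin (a - i)) :
    ∃ t, join h p u t = p s :=
  ⟨Fin.cast (Nat.sub_add_cancel h) (Fin.castAdd i s), by simp [join]⟩

lemma join_right {i : ℕ} (h : i ≤ a) (p : Fin (a - i) → ι) (u : Fin i → ι) (s : Fin i) :
    ∃ t, join h p u t = u s :=
  ⟨Fin.cast (Nat.sub_add_cancel h) (Fin.natAdd (a - i) s), by simp [join]⟩

variable {i j : ℕ}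

/-- Every contracted variable is a variable of `f`, so support of `f` alone confines the sum to
words over `S`. -/
lemma restrict_contraction {f : ChaosKernel ι a b} (hf : f ∈ supportedIn S)
    (g : ChaosKernel ι c d) :
    restrict S (contraction f g i j) = contraction (restrict S f) (restrict S g) i j := by
  unfold contraction
  split_ifs with h
  · ext x
    refine (tsum_restrict (S := S) (φ := fun w : (Fin i → ι) × (Fin j → ι) =>
      f (join h.1.1 ((Subtype.val ∘ x.1) ∘ Fin.castAdd _) w.1,
        join h.2.1 ((Subtype.val ∘ x.2) ∘ Fin.castAdd _) w.2)
          * g (join h.2.2 ((Subtype.val ∘ x.1) ∘ Fin.natAdd _) w.2,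
            join h.1.2 ((Subtype.val ∘ x.2) ∘ Fin.natAdd _) w.1)) fun w hw => ?_).symm.trans ?_
    · obtain ⟨h1, h2⟩ := hf _ (left_ne_zero_of_mul hw)
      refine ⟨fun s => ?_, fun s => ?_⟩
      · obtain ⟨t, ht⟩ := join_right h.1.1 ((Subtype.val ∘ x.1) ∘ Fin.castAdd _) w.1 s
        exact ht ▸ h1 t
      · obtain ⟨t, ht⟩ := join_right h.2.1 ((Subtype.val ∘ x.2) ∘ Fin.castAdd _) w.2 s
        exact ht ▸ h2 t
    · refine tsum_congr fun w => ?_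
      simp only [restrict_apply, coe_comp_join]
      rfl
  · rfl

/-- Every free variable comes from one of the two factors, so here both must be supported in `S`. -/
lemma contraction_mem_supportedIn {f : ChaosKernel ι a b} (hf : f ∈ supportedIn S)
    {g : ChaosKernel ι c d} (hg : g ∈ supportedIn S) : contraction f g i j ∈ supportedIn S := by
  unfold contraction
  split_ifs with h
  · intro x hx
    obtain ⟨w, hw⟩ := not_forall.1 fun h0 => hx ((tsum_congr h0).trans tsum_zero)
    obtain ⟨h1, h2⟩ := hf _ (left_ne_zero_of_mul hw)
    obtain ⟨h3, h4⟩ := hg _ (right_ne_zero_of_mul hw)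
    refine ⟨fun s => ?_, fun s => ?_⟩
    · refine Fin.addCases (fun s => ?_) (fun s => ?_) s
      · obtain ⟨t, ht⟩ := join_left h.1.1 (x.1 ∘ Fin.castAdd _) w.1 s
        exact (show _ = x.1 (Fin.castAdd _ s) from ht) ▸ h1 t
      · obtain ⟨t, ht⟩ := join_left h.2.2 (x.1 ∘ Fin.natAdd _) w.2 s
        exact (show _ = x.1 (Fin.natAdd _ s) from ht) ▸ h3 t
    · refine Fin.addCases (fun s => ?_) (fun s => ?_) s
      · obtain ⟨t, ht⟩ := join_left h.2.1 (x.2 ∘ Fin.castAdd _) w.2 s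
        exact (show _ = x.2 (Fin.castAdd _ s) from ht) ▸ h2 t
      · obtain ⟨t, ht⟩ := join_left h.1.2 (x.2 ∘ Fin.natAdd _) w.1 s
        exact (show _ = x.2 (Fin.natAdd _ s) from ht) ▸ h4 t
  · exact Submodule.zero_mem _

variable {m n : ℕ} {f : ChaosKernel ι m n} (r : ℕ)

lemma restrict_psi (hf : f ∈ supportedIn S) : restrict S (psi f r) = psi (restrict S f) r := by
  simp only [psi, map_sum, map_smul, restrict_toOrder, restrict_symmetrize,
    restrict_contraction hf, restrict_revConj]

lemma restrict_vartheta (hf : f ∈ supportedIn S) :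
    restrict S (vartheta f r) = vartheta (restrict S f) r := by
  simp only [vartheta, map_sum, map_smul, restrict_toOrder, restrict_symmetrize,
    restrict_contraction hf, restrict_revConj]

lemma restrict_varphi (hf : f ∈ supportedIn S) :
    restrict S (varphi f r) = varphi (restrict S f) r := by
  simp only [varphi, map_sum, map_smul, restrict_toOrder, restrict_symmetrize,
    restrict_contraction hf]

lemma restrict_varsigma (hf : f ∈ supportedIn S) :
    restrict S (varsigma f r) = varsigma (restrict S f) r := by
  simp only [varsigma, map_sum, map_smul, restrict_toOrder, restrict_symmetrize,
    restrict_contraction hf]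

lemma psi_mem_supportedIn (hf : f ∈ supportedIn S) : psi f r ∈ supportedIn S :=
  Submodule.sum_mem _ fun _ _ => Submodule.smul_mem _ _ (toOrder_mem_supportedIn _ _
    (symmetrize_mem_supportedIn (contraction_mem_supportedIn hf (revConj_mem_supportedIn hf))))

lemma varphi_mem_supportedIn (hf : f ∈ supportedIn S) : varphi f r ∈ supportedIn S :=
  Submodule.sum_mem _ fun _ _ => Submodule.smul_mem _ _ (toOrder_mem_supportedIn _ _
    (symmetrize_mem_supportedIn (contraction_mem_supportedIn hf hf)))

end Restriction

/-! ### Evaluation of polynomials at the Gaussian variables -/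

section Evaluation

variable {Ω H ι : Type*} [MeasurableSpace Ω] [NormedAddCommGroup H] [InnerProductSpace ℂ H]
  {Z : H → Ω → ℂ} {P : Measure Ω}

/-- The evaluation of polynomials at `z_k = Z(e_k)`. -/
def evalAt (Z : H → Ω → ℂ) (e : ι → H) (ω : Ω) : MvPolynomial (ι ⊕ ι) ℂ →ₐ[ℂ] ℂ :=
  aeval (Sum.elim (fun k => Z (e k) ω) fun k => conj (Z (e k) ω))

omit [MeasurableSpace Ω] [NormedAddCommGroup H] [InnerProductSpace ℂ H] in
lemma conj_evalAt (e : ι → H) (ω : Ω) (A : MvPolynomial (ι ⊕ ι) ℂ) :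
    conj (evalAt Z e ω A) = evalAt Z e ω (conjPoly A) := by
  induction A using MvPolynomial.induction_on with
  | C c => simp [evalAt, conjPoly]
  | add A B hA hB => simp only [map_add, hA, hB]
  | mul_X A s hA =>
    rw [map_mul, map_mul, hA, RingHom.map_mul, map_mul, conjPoly_X]
    congr 1
    rcases s with k | k <;> simp [evalAt]

lemma allMoments_evalAt (hZ : IsComplexIsonormal Z P) (e : ι → H)
    (A : MvPolynomial (ι ⊕ ι) ℂ) : AllMoments P fun ω => evalAt Z e ω A := by
  have := hZ.isProbabilityMeasure
  induction A using MvPolynomial.induction_on with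
  | C c => simpa [evalAt] using AllMoments.const c
  | add A B hA hB =>
    intro p hp
    simp only [map_add]
    exact (hA p hp).add (hB p hp)
  | mul_X A s hA =>
    simp only [map_mul]
    refine hA.mul ?_
    rcases s with k | k
    · simpa [evalAt] using hZ.allMoments (e k)
    · simpa [evalAt] using (hZ.allMoments (e k)).conj

lemma integrable_evalAt (hZ : IsComplexIsonormal Z P) (e : ι → H) (A : MvPolynomial (ι ⊕ ι) ℂ) :
    Integrable (fun ω => evalAt Z e ω A) P :=
  memLp_one_iff_integrable.1 (allMoments_evalAt hZ e A 1 (by norm_num))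

variable [Fintype ι]

omit [MeasurableSpace Ω] [NormedAddCommGroup H] [InnerProductSpace ℂ H] in
lemma evalAt_monomial (e : ι → H) (ω : Ω) (α : ι ⊕ ι →₀ ℕ) (c : ℂ) :
    evalAt Z e ω (monomial α c) =
      c * ∏ k, Z (e k) ω ^ α (.inl k) * conj (Z (e k) ω) ^ α (.inr k) := by
  rw [evalAt, aeval_monomial, Finsupp.prod_fintype _ _ (by simp), Fintype.prod_sum_type,
    prod_mul_distrib]
  simp

/-- By independence the expectation of a monomial factors over the modes, and each factor is a mixed
moment of a standard complex Gaussian variable. -/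
theorem integral_evalAt (hZ : IsComplexIsonormal Z P) {e : ι → H} (he : Orthonormal ℂ e)
    (A : MvPolynomial (ι ⊕ ι) ℂ) : ∫ ω, evalAt Z e ω A ∂P = gaussE A := by
  have := hZ.isProbabilityMeasure
  induction A using MvPolynomial.induction_on' with
  | monomial α c =>
    simp only [evalAt_monomial]
    rw [integral_const_mul, gaussE_monomial]
    congr 1
    rw [(hZ.iIndepFun he).integral_fun_prod_comp
      (f := fun k z => z ^ α (.inl k) * conj z ^ α (.inr k))
      (fun k => (hZ.isGaussianProcess.hasGaussianLaw_eval (e k)).aemeasurable)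
      (fun k => (by fun_prop : Continuous fun z : ℂ =>
        z ^ α (.inl k) * conj z ^ α (.inr k)).aestronglyMeasurable)]
    exact prod_congr rfl fun k _ => integral_pow_mul_conj_pow (hZ.allMoments (e k))
      (fun c hc => hZ.map_re (he.1 k) hc) _ _
  | add A B hA hB =>
    simp only [map_add]
    rw [integral_add (integrable_evalAt hZ e A) (integrable_evalAt hZ e B), hA, hB]

omit [Fintype ι] in
lemma wordMonomial_mul_eq_monomial {a b : ℕ} (p : Fin a → ι) (q : Fin b → ι) :
    ∃ α : ι ⊕ ι →₀ ℕ, wordMonomial .inl p * wordMonomial .inr q = monomial α (1 : ℂ) ∧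
      ∀ k, α (.inl k) = Nat.card {s // p s = k} ∧ α (.inr k) = Nat.card {s // q s = k} := by
  classical
  refine ⟨∑ s, Finsupp.single (.inl (p s)) 1 + ∑ s, Finsupp.single (.inr (q s)) 1, ?_, fun k => ?_⟩
  · rw [← one_mul (1 : ℂ), ← monomial_mul, monomial_sum_one, monomial_sum_one]
    rfl
  · simp [Finsupp.single_apply, Nat.card_eq_fintype_card,
      Fintype.card_subtype]

-- The exponents of the monomial of two words count occurrences, as in `fourierHermite`, so its Wick
-- ordering evaluates to the same product of Hermite polynomials.
omit [MeasurableSpace Ω] [NormedAddCommGroup H] [InnerProductSpace ℂ H] in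
lemma evalAt_wick_kernelPoly (e : ι → H) (ω : Ω) {a b : ℕ}
    (φ : (Fin a → ι) × (Fin b → ι) → ℂ) :
    evalAt Z e ω (wick (kernelPoly φ)) = ∑ x, φ x * fourierHermite Z e x.1 x.2 ω := by
  rw [kernelPoly_apply, map_sum, map_sum]
  refine sum_congr rfl fun x _ => ?_
  obtain ⟨α, h1, h2⟩ := wordMonomial_mul_eq_monomial x.1 x.2
  rw [map_smul, map_smul, smul_eq_mul, h1, wick_monomial, one_smul, wickMonomial, map_prod,
    fourierHermite, finprod_eq_prod_of_fintype]
  congr 1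
  refine prod_congr rfl fun k _ => ?_
  rw [hermite_eq_hermitePoly, (h2 k).1, (h2 k).2]
  refine (map_hermitePoly (evalAt Z e ω : MvPolynomial (ι ⊕ ι) ℂ →+* ℂ) _ _ _ _).trans ?_
  simp [evalAt]

end Evaluation

/-! ### Integrals over finitely many modes and their moment bounds -/

section FiniteIntegral

variable {Ω H ι : Type*} [MeasurableSpace Ω] [NormedAddCommGroup H] [InnerProductSpace ℂ H]
  {Z : H → Ω → ℂ} {P : Measure Ω} [Fintype ι] [DecidableEq ι] {a b : ℕ}

/-- The multiple integral of a kernel over finitely many modes. -/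
def finiteIntegral (Z : H → Ω → ℂ) (e : ι → H) (f : ChaosKernel ι a b) (ω : Ω) : ℂ :=
  evalAt Z e ω (wick (kernelPoly ⇑f))

omit [DecidableEq ι] in
lemma allMoments_finiteIntegral (hZ : IsComplexIsonormal Z P) (e : ι → H)
    (f : ChaosKernel ι a b) : AllMoments P (finiteIntegral Z e f) :=
  allMoments_evalAt hZ e _

-- Extends the moment bounds to kernels that are not symmetric, such as truncations to an arbitrary
-- finite set of coefficients.
omit [DecidableEq ι] [MeasurableSpace Ω] [NormedAddCommGroup H] [InnerProductSpace ℂ H] in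
lemma finiteIntegral_symmetrize (e : ι → H) (f : ChaosKernel ι a b) :
    finiteIntegral Z e (symmetrize f) = finiteIntegral Z e f := by
  funext ω
  rw [finiteIntegral, kernelPoly_symmetrize, finiteIntegral]

omit [DecidableEq ι] in
lemma integral_finiteIntegral_sq (hZ : IsComplexIsonormal Z P) {e : ι → H} (he : Orthonormal ℂ e)
    {f : ChaosKernel ι a b} :
    ∫ ω, finiteIntegral Z e f ω ^ 2 ∂P = gaussE (wick (kernelPoly ⇑f) * wick (kernelPoly ⇑f)) := by
  rw [← integral_evalAt hZ he]
  simp only [finiteIntegral, map_mul, sq]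

lemma integral_norm_finiteIntegral_sq (hZ : IsComplexIsonormal Z P) {e : ι → H}
    (he : Orthonormal ℂ e) {f : ChaosKernel ι a b} (hf : IsSymmetric f) :
    ∫ ω, ‖finiteIntegral Z e f ω‖ ^ 2 ∂P = a.factorial * b.factorial * ‖f‖ ^ 2 := by
  apply Complex.ofReal_injective
  rw [← gaussE_wick_mul_revConj hf, ← integral_evalAt hZ he, ← integral_complex_ofReal]
  refine integral_congr_ae (Filter.Eventually.of_forall fun ω => ?_)
  simp only [map_mul]
  rw [← conjPoly_wick_kernelPoly, ← conj_evalAt, Complex.mul_conj', Complex.ofReal_pow]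
  rfl

omit [DecidableEq ι] in
lemma gaussE_fourth_eq_integral (hZ : IsComplexIsonormal Z P) {e : ι → H}
    (he : Orthonormal ℂ e) (f : ChaosKernel ι a b) :
    gaussE (wick (kernelPoly ⇑f) * wick (kernelPoly ⇑(revConj f)) *
      (wick (kernelPoly ⇑f) * wick (kernelPoly ⇑(revConj f)))) =
    ((∫ ω, ‖finiteIntegral Z e f ω‖ ^ 4 ∂P : ℝ) : ℂ) := by
  rw [← integral_evalAt hZ he, ← integral_complex_ofReal]
  refine integral_congr_ae (Filter.Eventually.of_forall fun ω => ?_)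
  simp only [map_mul]
  rw [← conjPoly_wick_kernelPoly, ← conj_evalAt, Complex.mul_conj', Complex.ofReal_pow,
    show 4 = 2 + 2 from rfl, pow_add]
  rfl

lemma integral_norm_finiteIntegral_sq_le (hZ : IsComplexIsonormal Z P) {e : ι → H}
    (he : Orthonormal ℂ e) (f : ChaosKernel ι a b) :
    ∫ ω, ‖finiteIntegral Z e f ω‖ ^ 2 ∂P ≤ a.factorial * b.factorial * ‖f‖ ^ 2 := by
  rw [← finiteIntegral_symmetrize,
    integral_norm_finiteIntegral_sq hZ he (isSymmetric_symmetrize f)]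
  gcongr
  exact norm_symmetrize_le f

/-- The constant in the bound of the fourth moment by the norm of the kernel. -/
def fourthMomentBound (a b : ℕ) : ℝ :=
  ∑ r ∈ range (a + b + 1), ((a + b - r).factorial : ℝ) ^ 2 * psiBound a b r ^ 2

lemma fourthMomentBound_nonneg (a b : ℕ) : 0 ≤ fourthMomentBound a b :=
  sum_nonneg fun _ _ => by positivity

/-- The ψ-expansion of the fourth moment with each ‖ψ_r‖ bounded quadratically in ‖f‖; the constant
is independent of the number of modes. This takes the place of hypercontractivity. -/
lemma integral_norm_finiteIntegral_fourth_le (hZ : IsComplexIsonormal Z P) {e : ι → H}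
    (he : Orthonormal ℂ e) (f : ChaosKernel ι a b) :
    ∫ ω, ‖finiteIntegral Z e f ω‖ ^ 4 ∂P ≤ fourthMomentBound a b * ‖f‖ ^ 4 := by
  have hs := isSymmetric_symmetrize f
  have h := (gaussE_fourth_eq_integral hZ he (symmetrize f)).symm.trans (gaussE_fourth_eq_psi hs)
  rw [finiteIntegral_symmetrize] at h
  rw [Complex.ofReal_injective h, fourthMomentBound, sum_mul]
  refine sum_le_sum fun r _ => ?_
  rw [mul_assoc]
  refine mul_le_mul_of_nonneg_left ?_ (by positivity)
  refine (pow_le_pow_left₀ (norm_nonneg _) (norm_psi_le r (symmetrize f)) 2).trans ?_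
  rw [mul_pow, ← pow_mul]
  gcongr
  exact norm_symmetrize_le f

end FiniteIntegral

/-! ### Tools for L², L⁴ and unconditional summability -/

section LpLemmas

variable {Ω : Type*} [MeasurableSpace Ω] {P : Measure Ω}

lemma norm_Lp_pow {p : ℝ≥0∞} {k : ℕ} (hp : p = k) (hk : k ≠ 0) (G : Lp ℂ p P) :
    ‖G‖ ^ k = ∫ ω, ‖G ω‖ ^ k ∂P := by
  subst hp
  have hk' : (k : ℝ) ≠ 0 := by exact_mod_cast hk
  rw [Lp.norm_def, (Lp.memLp G).eLpNorm_eq_integral_rpow_norm (by simpa using hk) (by simp),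
    ENNReal.toReal_natCast, ENNReal.toReal_ofReal (by positivity), ← Real.rpow_natCast,
    ← Real.rpow_mul (integral_nonneg fun ω => by positivity), inv_mul_cancel₀ hk', Real.rpow_one]
  simp only [Real.rpow_natCast]

lemma summable_smul_of_norm_sum_sq_le {X E : Type*} [NormedAddCommGroup E] [NormedSpace ℂ E]
    [CompleteSpace E] (v : X → E) {f : X → ℂ} (hf : Summable fun x => ‖f x‖ ^ 2) {K : ℝ}
    (hK : 0 ≤ K) (h : ∀ T : Finset X, ‖∑ x ∈ T, f x • v x‖ ^ 2 ≤ K * ∑ x ∈ T, ‖f x‖ ^ 2) :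
    Summable fun x => f x • v x := by
  rw [summable_iff_vanishing_norm]
  intro ε hε
  -- Cauchy's criterion for the squared coefficients; K + 1 avoids division by zero.
  obtain ⟨s, hs⟩ := summable_iff_vanishing_norm.1 hf (ε ^ 2 / (K + 1)) (by positivity)
  refine ⟨s, fun t ht => ?_⟩
  have h1 := hs t ht
  rw [Real.norm_of_nonneg (sum_nonneg fun _ _ => by positivity), lt_div_iff₀ (by positivity)] at h1
  refine lt_of_pow_lt_pow_left₀ 2 hε.le ((h t).trans_lt ?_)
  have : 0 ≤ ∑ x ∈ t, ‖f x‖ ^ 2 := sum_nonneg fun _ _ => by positivity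
  nlinarith

lemma coeFn_sum_smul_toLp {X : Type*} {p : ℝ≥0∞} {Y : X → Ω → ℂ} (hY : ∀ x, MemLp (Y x) p P)
    (f : X → ℂ) (T : Finset X) :
    ⇑(∑ x ∈ T, f x • (hY x).toLp) =ᵐ[P] fun ω => ∑ x ∈ T, f x * Y x ω := by
  classical
  induction T using Finset.induction_on with
  | empty =>
    rw [sum_empty]
    filter_upwards [Lp.coeFn_zero ℂ p P] with ω h
    simpa using h
  | insert x T hx ih =>
    rw [sum_insert hx]
    filter_upwards [ih, Lp.coeFn_add (f x • (hY x).toLp) (∑ x ∈ T, f x • (hY x).toLp),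
      Lp.coeFn_smul (f x) (hY x).toLp, (hY x).coeFn_toLp] with ω h1 h2 h3 h4
    rw [h2, Pi.add_apply, h1, h3, Pi.smul_apply, h4, sum_insert hx, smul_eq_mul]

instance fact_one_le_four : Fact ((1 : ℝ≥0∞) ≤ 4) := ⟨by norm_num⟩

variable [IsProbabilityMeasure P]

/-- The inclusion of `L⁴` into `L²` of a probability space. -/
def inclLp : Lp ℂ 4 P →L[ℂ] Lp ℂ 2 P :=
  LinearMap.mkContinuous
    { toFun := fun G => ((Lp.memLp G).mono_exponent (by norm_num : (2 : ℝ≥0∞) ≤ 4)).toLp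
      map_add' := fun G G' => by
        rw [← MemLp.toLp_add]
        exact MemLp.toLp_congr _ _ (Lp.coeFn_add G G')
      map_smul' := fun c G => by
        rw [RingHom.id_apply, ← MemLp.toLp_const_smul]
        exact MemLp.toLp_congr _ _ (Lp.coeFn_smul c G) } 1 fun G => by
    rw [one_mul, LinearMap.coe_mk, AddHom.coe_mk, Lp.norm_toLp, Lp.norm_def]
    exact ENNReal.toReal_mono (Lp.eLpNorm_ne_top G)
      (eLpNorm_le_eLpNorm_of_exponent_le (by norm_num) (Lp.aestronglyMeasurable G))

lemma coeFn_inclLp (G : Lp ℂ 4 P) : ⇑(inclLp G) =ᵐ[P] G :=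
  ((Lp.memLp G).mono_exponent (by norm_num : (2 : ℝ≥0∞) ≤ 4)).coeFn_toLp

lemma inclLp_toLp {Y : Ω → ℂ} (h4 : MemLp Y 4 P) (h2 : MemLp Y 2 P) :
    inclLp h4.toLp = h2.toLp :=
  MemLp.toLp_congr ((Lp.memLp h4.toLp).mono_exponent (by norm_num)) h2 h4.coeFn_toLp

end LpLemmas

/-! ### Convergence of the defining series in L² and L⁴ -/

section Integral

variable {Ω H ι : Type*} [MeasurableSpace Ω] [NormedAddCommGroup H] [InnerProductSpace ℂ H]
  {Z : H → Ω → ℂ} {P : Measure Ω} {m n : ℕ}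

-- Modes outside `S` do not occur in the words and contribute J_{0,0} = 1.
omit [MeasurableSpace Ω] [NormedAddCommGroup H] [InnerProductSpace ℂ H] in
lemma fourierHermite_coe (Z : H → Ω → ℂ) (e : ι → H) (S : Finset ι) (p : Fin m → S)
    (q : Fin n → S) :
    fourierHermite Z (fun k : S => e k) p q =
      fourierHermite Z e (Subtype.val ∘ p) (Subtype.val ∘ q) := by
  funext ω
  have h0 : ∀ {N : ℕ} (t : Fin N → S) (k : ι), k ∉ S →
      Nat.card {s // (Subtype.val ∘ t) s = k} = 0 := by
    intro N t k hk
    have : IsEmpty {s // (Subtype.val ∘ t) s = k} := ⟨fun s => hk (s.2 ▸ (t s.1).2)⟩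
    exact Nat.card_of_isEmpty
  rw [fourierHermite, fourierHermite, finprod_eq_prod_of_fintype,
    finprod_eq_prod_of_mulSupport_subset (s := S), ← prod_coe_sort S]
  · refine prod_congr rfl fun k _ => ?_
    simp only [Function.comp_apply, Subtype.ext_iff]
  · intro k hk
    by_contra hkS
    refine hk ?_
    rw [mem_coe] at hkS
    simp only [h0 p k hkS, h0 q k hkS]
    simp [hermite]

omit [MeasurableSpace Ω] [NormedAddCommGroup H] [InnerProductSpace ℂ H] in
lemma sum_mul_fourierHermite (e : ι → H) {S : Finset ι} {g : ChaosKernel ι m n}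
    (hg : g ∈ supportedIn S) {T : Finset ((Fin m → ι) × (Fin n → ι))} (hT : ∀ x ∉ T, g x = 0)
    (ω : Ω) :
    ∑ x ∈ T, g x * fourierHermite Z e x.1 x.2 ω =
      finiteIntegral Z (fun k : S => e k) (restrict S g) ω := by
  rw [finiteIntegral, evalAt_wick_kernelPoly, ← tsum_fintype (L := .unconditional _)]
  simp only [restrict_apply, fourierHermite_coe]
  rw [tsum_restrict (φ := fun x => g x * fourierHermite Z e x.1 x.2 ω)
    fun x hx => hg x (left_ne_zero_of_mul hx)]
  exact (tsum_eq_sum fun x hx => by rw [hT x hx, zero_mul]).symm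

/-- The truncation of a kernel to finitely many coefficients. -/
def truncate (T : Finset ((Fin m → ι) × (Fin n → ι))) (f : ChaosKernel ι m n) :
    ChaosKernel ι m n := by
  classical exact ∑ x ∈ T, lp.single 2 x (f x)

lemma truncate_apply_of_mem {T : Finset ((Fin m → ι) × (Fin n → ι))} (f : ChaosKernel ι m n)
    {x : (Fin m → ι) × (Fin n → ι)} (hx : x ∈ T) : truncate T f x = f x := by
  classical
  rw [truncate, lp.coeFn_sum, Finset.sum_apply]
  simp only [lp.coeFn_single, Finset.sum_pi_single, if_pos hx]

lemma truncate_apply_of_notMem {T : Finset ((Fin m → ι) × (Fin n → ι))} (f : ChaosKernel ι m n)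
    {x : (Fin m → ι) × (Fin n → ι)} (hx : x ∉ T) : truncate T f x = 0 := by
  classical
  rw [truncate, lp.coeFn_sum, Finset.sum_apply]
  simp only [lp.coeFn_single, Finset.sum_pi_single, if_neg hx]

lemma norm_truncate_sq (T : Finset ((Fin m → ι) × (Fin n → ι))) (f : ChaosKernel ι m n) :
    ‖truncate T f‖ ^ 2 = ∑ x ∈ T, ‖f x‖ ^ 2 := by
  classical
  have h := lp.norm_sum_single (p := 2) (by norm_num) (fun x => f x) T
  simpa [truncate] using h

lemma tendsto_truncate (f : ChaosKernel ι m n) :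
    Filter.Tendsto (fun T => truncate T f) Filter.atTop (nhds f) := by
  classical
  exact lp.hasSum_single (by norm_num) f

lemma exists_truncate_mem_supportedIn (T : Finset ((Fin m → ι) × (Fin n → ι)))
    (f : ChaosKernel ι m n) : ∃ S : Finset ι, truncate T f ∈ supportedIn S := by
  classical
  refine ⟨T.biUnion fun x => univ.image x.1 ∪ univ.image x.2, fun x hx => ?_⟩
  have hxT : x ∈ T := by
    by_contra h
    exact hx (truncate_apply_of_notMem f h)
  exact ⟨fun s => mem_biUnion.2 ⟨x, hxT, by simp⟩, fun s => mem_biUnion.2 ⟨x, hxT, by simp⟩⟩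

/-- The pairs of words over `S`. -/
def words (m n : ℕ) (S : Finset ι) : Finset ((Fin m → ι) × (Fin n → ι)) :=
  Fintype.piFinset (fun _ => S) ×ˢ Fintype.piFinset (fun _ => S)

lemma mem_words {S : Finset ι} {x : (Fin m → ι) × (Fin n → ι)} :
    x ∈ words m n S ↔ (∀ s, x.1 s ∈ S) ∧ ∀ s, x.2 s ∈ S := by
  simp [words]

/-- The letters of a pair of words form a finite set, so these truncations exhaust all coefficients.
-/
lemma tendsto_words : Filter.Tendsto (words m n : Finset ι → _) Filter.atTop Filter.atTop := by
  classical
  refine Filter.tendsto_atTop_finset_of_monotone (fun S S' h x hx => ?_) fun x =>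
    ⟨univ.image x.1 ∪ univ.image x.2, mem_words.2 ⟨fun s => by simp, fun s => by simp⟩⟩
  obtain ⟨h1, h2⟩ := mem_words.1 hx
  exact mem_words.2 ⟨fun s => h (h1 s), fun s => h (h2 s)⟩

lemma truncate_words_mem_supportedIn (S : Finset ι) (f : ChaosKernel ι m n) :
    truncate (words m n S) f ∈ supportedIn S := fun x hx => by
  by_contra h
  exact hx (truncate_apply_of_notMem f fun h' => h (mem_words.1 h'))

/-- The words over `S` are stable under permutation of letters, which fails for a general finite set
of words; hence the limit is taken along these truncations. -/
lemma isSymmetric_truncate_words (S : Finset ι) {f : ChaosKernel ι m n} (hf : IsSymmetric f) :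
    IsSymmetric (truncate (words m n S) f) := by
  intro σ τ p q
  have h : (p ∘ σ, q ∘ τ) ∈ words m n S ↔ (p, q) ∈ words m n S := by
    simp only [mem_words, Function.comp_apply]
    exact and_congr (σ.surjective.forall (p := fun s => p s ∈ S)).symm
      (τ.surjective.forall (p := fun s => q s ∈ S)).symm
  by_cases hx : (p, q) ∈ words m n S
  · rw [truncate_apply_of_mem f hx, truncate_apply_of_mem f (h.2 hx), hf]
  · rw [truncate_apply_of_notMem f hx, truncate_apply_of_notMem f (mt h.1 hx)]

lemma allMoments_fourierHermite (hZ : IsComplexIsonormal Z P) (e : ι → H) (p : Fin m → ι)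
    (q : Fin n → ι) : AllMoments P (fourierHermite Z e p q) := by
  classical
  -- A Fourier–Hermite polynomial is the finite integral of a kernel with a single coefficient, and
  -- finite integrals have all moments.
  set g : ChaosKernel ι m n := lp.single 2 (p, q) (1 : ℂ) with hg
  have hgx : ∀ x, g x = if x = (p, q) then 1 else 0 := fun x => by
    simp [hg, Pi.single_apply]
  have hgS : g ∈ supportedIn (univ.image p ∪ univ.image q) := by
    intro x hx
    have : x = (p, q) := by
      by_contra h
      exact hx (by rw [hgx, if_neg h])
    subst this
    exact ⟨fun s => by simp, fun s => by simp⟩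
  have h := sum_mul_fourierHermite (Z := Z) e hgS (T := {(p, q)})
    fun x hx => by rw [hgx, if_neg (by simpa using hx)]
  simp only [sum_singleton, hgx, if_true, one_mul] at h
  have h' : fourierHermite Z e p q = _ := funext h
  rw [h']
  exact allMoments_finiteIntegral hZ _ _

omit [MeasurableSpace Ω] [NormedAddCommGroup H] [InnerProductSpace ℂ H] in
lemma truncate_sum_eq (e : ι → H) {S : Finset ι} {T : Finset ((Fin m → ι) × (Fin n → ι))}
    {f : ChaosKernel ι m n} (hS : truncate T f ∈ supportedIn S) (ω : Ω) :
    ∑ x ∈ T, f x * fourierHermite Z e x.1 x.2 ω =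
      finiteIntegral Z (fun k : S => e k) (restrict S (truncate T f)) ω := by
  rw [← sum_mul_fourierHermite e hS fun x hx => truncate_apply_of_notMem f hx]
  exact sum_congr rfl fun x hx => by rw [truncate_apply_of_mem f hx]

variable (hZ : IsComplexIsonormal Z P) {e : ι → H} (he : Orthonormal ℂ e)
include he

lemma norm_sum_smul_toLp_two_le (f : ChaosKernel ι m n) (T : Finset ((Fin m → ι) × (Fin n → ι))) :
    ‖∑ x ∈ T, f x • (hZ.memLp_fourierHermite e x.1 x.2).toLp‖ ^ 2 ≤
      (m.factorial * n.factorial) * ∑ x ∈ T, ‖f x‖ ^ 2 := by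
  classical
  obtain ⟨S, hS⟩ := exists_truncate_mem_supportedIn T f
  have he' : Orthonormal ℂ fun k : S => e k := he.comp _ Subtype.val_injective
  have h1 := integral_norm_finiteIntegral_sq_le hZ he' (restrict S (truncate T f))
  rw [norm_restrict hS, norm_truncate_sq] at h1
  rw [norm_Lp_pow (k := 2) (by norm_num) two_ne_zero]
  refine Eq.trans_le (integral_congr_ae ?_) h1
  filter_upwards [coeFn_sum_smul_toLp
    (fun x : (Fin m → ι) × (Fin n → ι) => hZ.memLp_fourierHermite e x.1 x.2) f T] with ω h
  rw [h, truncate_sum_eq e hS]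

lemma norm_sum_smul_toLp_four_le (f : ChaosKernel ι m n) (T : Finset ((Fin m → ι) × (Fin n → ι))) :
    ‖∑ x ∈ T, f x • (allMoments_fourierHermite hZ e x.1 x.2 4 (by norm_num)).toLp‖ ^ 2 ≤
      Real.sqrt (fourthMomentBound m n) * ∑ x ∈ T, ‖f x‖ ^ 2 := by
  classical
  obtain ⟨S, hS⟩ := exists_truncate_mem_supportedIn T f
  have he' : Orthonormal ℂ fun k : S => e k := he.comp _ Subtype.val_injective
  have h1 := integral_norm_finiteIntegral_fourth_le hZ he' (restrict S (truncate T f))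
  rw [norm_restrict hS, (by ring : ‖truncate T f‖ ^ 4 = (‖truncate T f‖ ^ 2) ^ 2),
    norm_truncate_sq] at h1
  have h0 : (0 : ℝ) ≤ Real.sqrt (fourthMomentBound m n) * ∑ x ∈ T, ‖f x‖ ^ 2 := by positivity
  -- After squaring, the left side is the fourth power of the L⁴ norm, that is, the fourth moment.
  refine (pow_le_pow_iff_left₀ (by positivity) h0 two_ne_zero).1 ?_
  rw [← pow_mul, mul_pow, Real.sq_sqrt (fourthMomentBound_nonneg m n),
    norm_Lp_pow (k := 2 * 2) (by norm_num) (by norm_num)]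
  refine Eq.trans_le (integral_congr_ae ?_) h1
  filter_upwards [coeFn_sum_smul_toLp (fun x : (Fin m → ι) × (Fin n → ι) =>
    allMoments_fourierHermite hZ e x.1 x.2 4 (by norm_num)) f T] with ω h
  rw [h, truncate_sum_eq e hS]

lemma summable_smul_toLp_two (f : ChaosKernel ι m n) :
    Summable fun x : (Fin m → ι) × (Fin n → ι) =>
      f x • (hZ.memLp_fourierHermite e x.1 x.2).toLp :=
  summable_smul_of_norm_sum_sq_le _ (memlp_iff.1 (lp.memℓp f)) (by positivity)
    (norm_sum_smul_toLp_two_le hZ he f)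

lemma summable_smul_toLp_four (f : ChaosKernel ι m n) :
    Summable fun x : (Fin m → ι) × (Fin n → ι) =>
      f x • (allMoments_fourierHermite hZ e x.1 x.2 4 (by norm_num)).toLp :=
  summable_smul_of_norm_sum_sq_le _ (memlp_iff.1 (lp.memℓp f)) (by positivity)
    (norm_sum_smul_toLp_four_le hZ he f)

end Integral

/-! ### Complex conjugation on L² -/

section ConjLp

variable {Ω : Type*} [MeasurableSpace Ω] {P : Measure Ω}

/-- Complex conjugation on `L²`. -/
def conjLp : Lp ℂ 2 P →L[ℝ] Lp ℂ 2 P :=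
  ContinuousLinearMap.compLpL 2 P (Complex.conjCLE : ℂ →L[ℝ] ℂ)

lemma coeFn_conjLp (G : Lp ℂ 2 P) : ⇑(conjLp G) =ᵐ[P] fun ω => conj (G ω) :=
  ContinuousLinearMap.coeFn_compLpL (Complex.conjCLE : ℂ →L[ℝ] ℂ) G

/-- Writes E[G²] as an inner product, so that it depends continuously on G in L². -/
lemma inner_conjLp_self (G : Lp ℂ 2 P) : inner ℂ (conjLp G) G = ∫ ω, G ω ^ 2 ∂P := by
  rw [L2.inner_def]
  refine integral_congr_ae ?_
  filter_upwards [coeFn_conjLp G] with ω h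
  rw [h, RCLike.inner_apply, Complex.conj_conj, sq]

lemma conjLp_smul_toLp (c : ℂ) {Y Y' : Ω → ℂ} (hY : MemLp Y 2 P) (hY' : MemLp Y' 2 P)
    (h : ∀ ω, conj (Y ω) = Y' ω) : conjLp (c • hY.toLp) = conj c • hY'.toLp := by
  refine Lp.ext ?_
  filter_upwards [coeFn_conjLp (c • hY.toLp), Lp.coeFn_smul c hY.toLp,
    Lp.coeFn_smul (conj c) hY'.toLp, hY.coeFn_toLp, hY'.coeFn_toLp] with ω h1 h2 h3 h4 h5
  rw [h1, h2, h3, Pi.smul_apply, Pi.smul_apply, h4, h5, smul_eq_mul, map_mul, h, smul_eq_mul]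

end ConjLp

/-! ### Passage to infinitely many modes -/

section Limit

variable {Ω H ι : Type*} [MeasurableSpace Ω] [NormedAddCommGroup H] [InnerProductSpace ℂ H]
  {Z : H → Ω → ℂ} {P : Measure Ω} {m n : ℕ}

omit [MeasurableSpace Ω] [NormedAddCommGroup H] [InnerProductSpace ℂ H] in
lemma conj_fourierHermite (e : ι → H) (p : Fin m → ι) (q : Fin n → ι) (ω : Ω) :
    conj (fourierHermite Z e p q ω) = fourierHermite Z e q p ω := by
  classical
  have hcard : ∀ {N : ℕ} (t : Fin N → ι) (k : ι), k ∉ univ.image t →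
      Nat.card {s // t s = k} = 0 := by
    intro N t k hk
    have : IsEmpty {s // t s = k} := ⟨fun s => hk (mem_image.2 ⟨s.1, mem_univ _, s.2⟩)⟩
    exact Nat.card_of_isEmpty
  have hfin : (Function.mulSupport fun k =>
      hermite (Nat.card {s // p s = k}) (Nat.card {s // q s = k}) (Z (e k) ω) 1).Finite := by
    refine (univ.image p ∪ univ.image q).finite_toSet.subset fun k hk => ?_
    by_contra hk'
    simp only [coe_union, Set.mem_union, mem_coe, not_or] at hk'
    refine hk ?_
    simp only [hcard p k hk'.1, hcard q k hk'.2]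
    simp [hermite]
  exact (MonoidHom.map_finprod (starRingEnd ℂ : ℂ →* ℂ) hfin).trans
    (finprod_congr fun k => conj_hermite _ _ _)

/-- The truncation of a kernel to the finite set `S` of modes. -/
def modeTruncate (S : Finset ι) (f : ChaosKernel ι m n) : ChaosKernel S m n :=
  restrict S (truncate (words m n S) f)

variable (hZ : IsComplexIsonormal Z P) (e : HilbertBasis ι ℂ H) (f : ChaosKernel ι m n)

lemma conjLp_multipleIntegral :
    conjLp (multipleIntegral hZ e f) = multipleIntegral hZ e (revConj f) := by
  rw [multipleIntegral, multipleIntegral,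
    conjLp.map_tsum (summable_smul_toLp_two hZ e.orthonormal f),
    ← (Equiv.prodComm (Fin m → ι) (Fin n → ι)).tsum_eq]
  exact tsum_congr fun x =>
    conjLp_smul_toLp _ _ _ (conj_fourierHermite e x.1 x.2)

/-- The multiple integral as an element of `L⁴`. -/
def multipleIntegralFour : Lp ℂ 4 P :=
  ∑' x : (Fin m → ι) × (Fin n → ι),
    f x • (allMoments_fourierHermite hZ e x.1 x.2 4 (by norm_num)).toLp

/-- The inclusion of L⁴ in L² is continuous and maps the L⁴ series term by term to the L² series, so
both sums are the same function. In particular the integral lies in L⁴. -/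
lemma multipleIntegral_ae_eq :
    ⇑(multipleIntegral hZ e f) =ᵐ[P] multipleIntegralFour hZ e f := by
  have := hZ.isProbabilityMeasure
  have h : inclLp (multipleIntegralFour hZ e f) = multipleIntegral hZ e f := by
    rw [multipleIntegral, multipleIntegralFour,
      inclLp.map_tsum (summable_smul_toLp_four hZ e.orthonormal f)]
    exact tsum_congr fun x => by rw [map_smul, inclLp_toLp]
  rw [← h]
  exact coeFn_inclLp _

lemma tendsto_sum_words_two : Filter.Tendsto (fun S => ∑ x ∈ words m n S,
      f x • (hZ.memLp_fourierHermite e x.1 x.2).toLp) Filter.atTop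
    (nhds (multipleIntegral hZ e f)) :=
  (summable_smul_toLp_two hZ e.orthonormal f).hasSum.comp tendsto_words

lemma tendsto_sum_words_four : Filter.Tendsto (fun S => ∑ x ∈ words m n S,
      f x • (allMoments_fourierHermite hZ e x.1 x.2 4 (by norm_num)).toLp) Filter.atTop
    (nhds (multipleIntegralFour hZ e f)) :=
  (summable_smul_toLp_four hZ e.orthonormal f).hasSum.comp tendsto_words

lemma sum_words_ae_eq {p : ℝ≥0∞} (h : ∀ x : (Fin m → ι) × (Fin n → ι),
    MemLp (fourierHermite Z e x.1 x.2) p P) (S : Finset ι) :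
    ⇑(∑ x ∈ words m n S, f x • (h x).toLp) =ᵐ[P]
      finiteIntegral Z (fun k : S => e k) (modeTruncate S f) := by
  classical
  filter_upwards [coeFn_sum_smul_toLp h f (words m n S)] with ω h1
  rw [h1, truncate_sum_eq e (truncate_words_mem_supportedIn S f)]
  rfl

lemma tendsto_integral_norm_sq : Filter.Tendsto (fun S : Finset ι =>
      ∫ ω, ‖finiteIntegral Z (fun k : S => e k) (modeTruncate S f) ω‖ ^ 2 ∂P) Filter.atTop
    (nhds (∫ ω, ‖multipleIntegral hZ e f ω‖ ^ 2 ∂P)) := by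
  have h := (tendsto_sum_words_two hZ e f).norm.pow 2
  simp only [norm_Lp_pow (p := 2) (k := 2) (by norm_num) two_ne_zero] at h
  refine h.congr fun S => integral_congr_ae ?_
  filter_upwards [sum_words_ae_eq e f (fun x => hZ.memLp_fourierHermite e x.1 x.2) S] with ω h1
  rw [h1]

lemma tendsto_integral_sq : Filter.Tendsto (fun S : Finset ι =>
      ∫ ω, finiteIntegral Z (fun k : S => e k) (modeTruncate S f) ω ^ 2 ∂P) Filter.atTop
    (nhds (∫ ω, multipleIntegral hZ e f ω ^ 2 ∂P)) := by
  have h0 := tendsto_sum_words_two hZ e f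
  have h : Filter.Tendsto _ _ _ := ((conjLp.continuous.tendsto _).comp h0).inner (𝕜 := ℂ) h0
  simp only [Function.comp_apply, inner_conjLp_self] at h
  refine h.congr fun S => integral_congr_ae ?_
  filter_upwards [sum_words_ae_eq e f (fun x => hZ.memLp_fourierHermite e x.1 x.2) S] with ω h1
  rw [h1]

lemma tendsto_integral_norm_fourth : Filter.Tendsto (fun S : Finset ι =>
      ∫ ω, ‖finiteIntegral Z (fun k : S => e k) (modeTruncate S f) ω‖ ^ 4 ∂P) Filter.atTop
    (nhds (∫ ω, ‖multipleIntegral hZ e f ω‖ ^ 4 ∂P)) := by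
  have h := (tendsto_sum_words_four hZ e f).norm.pow 4
  simp only [norm_Lp_pow (p := 4) (k := 4) (by norm_num) four_ne_zero] at h
  have h2 : ∫ ω, ‖multipleIntegralFour hZ e f ω‖ ^ 4 ∂P =
      ∫ ω, ‖multipleIntegral hZ e f ω‖ ^ 4 ∂P := by
    refine integral_congr_ae ?_
    filter_upwards [multipleIntegral_ae_eq hZ e f] with ω h1
    rw [h1]
  rw [h2] at h
  refine h.congr fun S => integral_congr_ae ?_
  filter_upwards [sum_words_ae_eq e f
    (fun x => allMoments_fourierHermite hZ e x.1 x.2 4 (by norm_num)) S] with ω h1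
  rw [h1]

lemma memLp_four_multipleIntegral : MemLp (multipleIntegral hZ e f) 4 P :=
  (memLp_congr_ae (multipleIntegral_ae_eq hZ e f)).2 (Lp.memLp _)

variable {f}

/-- An identity between the fourth cumulant and a continuous function of the kernel extends from
kernels over finitely many modes. -/
lemma cumulant_eq_of_forall_finset {E : Type*} [TopologicalSpace E] [T2Space E] {ρ : ℝ → E}
    (hρ : Continuous ρ) {Φ : ChaosKernel ι m n → E} (hΦ : Continuous Φ) (hf : IsSymmetric f)
    (h : ∀ (S : Finset ι) (g : ChaosKernel ι m n), IsSymmetric g → g ∈ supportedIn S → ∀ M : ℝ,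
      gaussE (wick (kernelPoly ⇑(restrict S g)) * wick (kernelPoly ⇑(revConj (restrict S g))) *
        (wick (kernelPoly ⇑(restrict S g)) * wick (kernelPoly ⇑(revConj (restrict S g))))) =
          (M : ℂ) →
      ρ (M - 2 * (m.factorial * n.factorial * ‖restrict S g‖ ^ 2) ^ 2 -
        ‖gaussE (wick (kernelPoly ⇑(restrict S g)) * wick (kernelPoly ⇑(restrict S g)))‖ ^ 2) =
          Φ g) :
    ρ ((∫ ω, ‖multipleIntegral hZ e f ω‖ ^ 4 ∂P) -
      2 * (∫ ω, ‖multipleIntegral hZ e f ω‖ ^ 2 ∂P) ^ 2 -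
        ‖∫ ω, multipleIntegral hZ e f ω ^ 2 ∂P‖ ^ 2) = Φ f := by
  classical
  have h1 := (hρ.tendsto _).comp (((tendsto_integral_norm_fourth hZ e f).sub
    (((tendsto_integral_norm_sq hZ e f).pow 2).const_mul 2)).sub
      ((tendsto_integral_sq hZ e f).norm.pow 2))
  have h2 := (hΦ.tendsto _).comp ((tendsto_truncate f).comp tendsto_words)
  -- Along the truncations to `S` the moments converge to those of the integral and the kernels
  -- converge to `f`; the identity over finitely many modes makes the two sequences equal.
  refine tendsto_nhds_unique (h1.congr fun S => ?_) h2
  have he : Orthonormal ℂ fun k : S => e k := e.orthonormal.comp _ Subtype.val_injective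
  have hs := isSymmetric_truncate_words S hf
  simp only [Function.comp_apply, modeTruncate]
  rw [integral_norm_finiteIntegral_sq hZ he (isSymmetric_restrict hs),
    integral_finiteIntegral_sq hZ he]
  exact h S _ hs (truncate_words_mem_supportedIn S f) _ (gaussE_fourth_eq_integral hZ he _)

end Limit

end ComplexChaos

end

/-! ### The main theorem -/

theorem mainTheorem7
    {Ω : Type*} [MeasurableSpace Ω] {P : Measure Ω} [IsProbabilityMeasure P]
    {H : Type*} [NormedAddCommGroup H] [InnerProductSpace ℂ H] [CompleteSpace H]
    [TopologicalSpace.SeparableSpace H]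
    {Z : H → Ω → ℂ} (hZ : IsComplexIsonormal Z P)
    {ι : Type*} (e : HilbertBasis ι ℂ H)
    (m n : ℕ) (hmn : 1 ≤ m + n) (f : ChaosKernel ι m n) (hf : IsSymmetric f)
    (F : Lp ℂ 2 P) (hF : F = multipleIntegral hZ e f) :
    -- the multiple integral is well defined, and the fourth moment is finite
    (Summable fun x : (Fin m → ι) × (Fin n → ι) =>
      f x • (hZ.memLp_fourierHermite e x.1 x.2).toLp) ∧
    MemLp F 4 P ∧
    -- the reversed complex conjugate of `f` is the kernel of `conj F`
    (∀ᵐ ω ∂P, conj (F ω) = multipleIntegral hZ e (revConj f) ω) ∧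
    -- first expansion
    ((∫ ω, ‖F ω‖ ^ 4 ∂P) - 2 * (∫ ω, ‖F ω‖ ^ 2 ∂P) ^ 2 - ‖∫ ω, F ω ^ 2 ∂P‖ ^ 2 =
      (∑ x ∈ range (min m n + 1) ×ˢ range (min m n + 1) with 0 < x.1 + x.2 ∧ x.1 + x.2 < m + n,
          (m.choose x.1 : ℝ) * (n.choose x.1 : ℝ) * (n.choose x.2 : ℝ) * (m.choose x.2 : ℝ)
            * ((m.factorial : ℝ) * (n.factorial : ℝ)) ^ 2 * ‖contraction f f x.1 x.2‖ ^ 2)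
        + ∑ r ∈ Icc 1 (m + n - 1), ((m + n - r).factorial : ℝ) ^ 2 * ‖psi f r‖ ^ 2) ∧
    -- second expansion
    ((∫ ω, ‖F ω‖ ^ 4 ∂P) - 2 * (∫ ω, ‖F ω‖ ^ 2 ∂P) ^ 2 - ‖∫ ω, F ω ^ 2 ∂P‖ ^ 2 =
      (∑ x ∈ range (m + 1) ×ˢ range (n + 1) with 0 < x.1 + x.2 ∧ x.1 + x.2 < m + n,
          (m.choose x.1 : ℝ) ^ 2 * (n.choose x.2 : ℝ) ^ 2
            * ((m.factorial : ℝ) * (n.factorial : ℝ)) ^ 2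
            * ‖contraction f (revConj f) x.1 x.2‖ ^ 2)
        + ∑ r ∈ Icc 1 (min (2 * min m n) (m + n - 1)),
            ((2 * m - r).factorial : ℝ) * ((2 * n - r).factorial : ℝ) * ‖varphi f r‖ ^ 2) ∧
    -- third expansion (`inner ℂ y x` is the inner product `⟨x, y⟩` that is linear in `x`)
    (1 ≤ m →
      (((∫ ω, ‖F ω‖ ^ 4 ∂P) - 2 * (∫ ω, ‖F ω‖ ^ 2 ∂P) ^ 2 - ‖∫ ω, F ω ^ 2 ∂P‖ ^ 2 : ℝ) : ℂ) =
        2 * (∑ r ∈ Icc 1 (m + n - 1),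
            ((m + n - r).factorial : ℂ) ^ 2 * inner ℂ (psi f r) (vartheta f r))
          + ∑ r ∈ Icc 1 (min (2 * min m n) (m + n - 1)),
              ((2 * m - r).factorial : ℂ) * ((2 * n - r).factorial : ℂ)
                * inner ℂ (varphi f r) (varsigma f r)) := by
  classical
  subst hF
  refine ⟨summable_smul_toLp_two hZ e.orthonormal f, memLp_four_multipleIntegral hZ e f, ?_, ?_, ?_,
    fun hm => ?_⟩
  · filter_upwards [coeFn_conjLp (multipleIntegral hZ e f)] with ω h
    rw [← h, conjLp_multipleIntegral]
  · refine cumulant_eq_of_forall_finset hZ e (ρ := id) continuous_id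
      (Φ := fun f => (∑ x ∈ range (min m n + 1) ×ˢ range (min m n + 1) with
          0 < x.1 + x.2 ∧ x.1 + x.2 < m + n,
        (m.choose x.1 : ℝ) * (n.choose x.1 : ℝ) * (n.choose x.2 : ℝ) * (m.choose x.2 : ℝ)
          * ((m.factorial : ℝ) * (n.factorial : ℝ)) ^ 2 * ‖contraction f f x.1 x.2‖ ^ 2)
        + ∑ r ∈ Icc 1 (m + n - 1), ((m + n - r).factorial : ℝ) ^ 2 * ‖psi f r‖ ^ 2) ?_ hf ?_
    · refine (continuous_finsetSum _ fun x _ => continuous_const.mul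
        ((continuous_contraction_self x.1 x.2).norm.pow 2)).add
        (continuous_finsetSum _ fun r _ => continuous_const.mul ((continuous_psi r).norm.pow 2))
    · intro S g hg hS M hM
      refine (first_expansion (isSymmetric_restrict hg) hmn hM).trans ?_
      -- For kernels supported in `S`, restriction commutes with the kernel operations and preserves
      -- norms, so the finite formula is the same function of the unrestricted kernel.
      simp only [← restrict_contraction hS, ← restrict_psi _ hS,
        norm_restrict (contraction_mem_supportedIn hS hS), norm_restrict (psi_mem_supportedIn _ hS)]
  · refine cumulant_eq_of_forall_finset hZ e (ρ := id) continuous_id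
      (Φ := fun f => (∑ x ∈ range (m + 1) ×ˢ range (n + 1) with
          0 < x.1 + x.2 ∧ x.1 + x.2 < m + n,
        (m.choose x.1 : ℝ) ^ 2 * (n.choose x.2 : ℝ) ^ 2
          * ((m.factorial : ℝ) * (n.factorial : ℝ)) ^ 2
          * ‖contraction f (revConj f) x.1 x.2‖ ^ 2)
        + ∑ r ∈ Icc 1 (min (2 * min m n) (m + n - 1)),
          ((2 * m - r).factorial : ℝ) * ((2 * n - r).factorial : ℝ) * ‖varphi f r‖ ^ 2) ?_ hf ?_
    · refine (continuous_finsetSum _ fun x _ => continuous_const.mul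
        ((continuous_contraction_revConj x.1 x.2).norm.pow 2)).add
        (continuous_finsetSum _ fun r _ => continuous_const.mul ((continuous_varphi r).norm.pow 2))
    · intro S g hg hS M hM
      refine (second_expansion (isSymmetric_restrict hg) hmn hM).trans ?_
      simp only [← restrict_revConj, ← restrict_contraction hS, ← restrict_varphi _ hS,
        norm_restrict (contraction_mem_supportedIn hS (revConj_mem_supportedIn hS)),
        norm_restrict (varphi_mem_supportedIn _ hS)]
  -- The inner products are complex, so the real cumulant is compared after the embedding of ℝ in ℂ.
  · refine cumulant_eq_of_forall_finset hZ e (ρ := fun x : ℝ => (x : ℂ)) Complex.continuous_ofReal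
      (Φ := fun f => 2 * (∑ r ∈ Icc 1 (m + n - 1),
          ((m + n - r).factorial : ℂ) ^ 2 * inner ℂ (psi f r) (vartheta f r))
        + ∑ r ∈ Icc 1 (min (2 * min m n) (m + n - 1)),
            ((2 * m - r).factorial : ℂ) * ((2 * n - r).factorial : ℂ)
              * inner ℂ (varphi f r) (varsigma f r)) ?_ hf ?_
    · exact (continuous_const.mul (continuous_finsetSum _ fun r _ => continuous_const.mul
        ((continuous_psi r).inner (continuous_vartheta r)))).add
        (continuous_finsetSum _ fun r _ => continuous_const.mul
          ((continuous_varphi r).inner (continuous_varsigma r)))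
    · intro S g hg hS M hM
      refine (third_expansion (isSymmetric_restrict hg) hm hM).trans ?_
      simp only [← restrict_psi _ hS, ← restrict_vartheta _ hS, ← restrict_varphi _ hS,
        ← restrict_varsigma _ hS, inner_restrict (psi_mem_supportedIn _ hS),
        inner_restrict (varphi_mem_supportedIn _ hS)]
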